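/- Let $\alpha,\beta>0$ with $\alpha+\beta<1$, and let $T=T_{\alpha,\beta}$ be the three-interval exchange of $[0,1)$ given by $Tx=x+1-\alpha$ on $X_1=[0,\alpha)$, $Tx=x+1-2\alpha-\beta$ on $X_2=[\alpha,\alpha+\beta)$ and $Tx=x-\alpha-\beta$ on $X_3=[\alpha+\beta,1)$. Assume the i.d.o.c. condition: for integers $p,q$, none of the relations $p\alpha+q\beta=p-q$ with $(p,q)\ne(0,0)$, $p\alpha+q\beta=p-q+1$, $p\alpha+q\beta=p-q-1$ holds. Let $L$ be the set of all finite factors of the trajectories $(x_n)_{n\ge 0}$, $x_n=i$ if $T^nx\in X_i$, for $x\in[0,1)$ (natural coding), and let $X_L\subset\{1,2,3\}^{\mathbb N}$ be the set of sequences all of whose finite factors are in $L$, with the one-sided shift. This system has exactly one shift-invariant probability measure $\mu$. Let $e_n$ be the smallest positive value of $\mu[w]$ over the words $w\in L$ of length $n$, where $[w]$ is the set of sequences in $X_L$ that begin with $w$, and put $$\mathcal B(\alpha,\beta)=\limsup_{n\to+\infty}\frac1{n e_n}\in[0,+\infty].$$ Let $\Sigma\subset[0,+\infty]$, the upper BL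 spectrum of three-interval exchanges, be the set of all values $\mathcal B(\alpha,\beta)$ for $(\alpha,\beta)$ as above. Then the smallest element of $\Sigma$ is $2\sqrt5$, and it is the only element of $\Sigma$ smaller than $\frac{12+29\sqrt3}{13}$. Moreover $\Sigma$ is closed in $[0,+\infty]$, and $6$ is an element and an accumulation point of $\Sigma$. The same holds for the set of values $\mathcal B(\alpha,\beta)$ where in addition $\alpha<\frac12$ and $2\alpha+\beta>1$. -/

import Mathlib

open MeasureTheory Filter Topology
open scoped ENNReal

/-! ### Symbolic dynamical systems -/

/-- The one-sided shift `S (x₀ x₁ x₂ …) = x₁ x₂ …`. -/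
def shift {A : Type*} (x : ℕ → A) : ℕ → A := fun n => x (n + 1)

/-- The factor `x_r x_{r+1} … x_{r+n-1}` (of length `n`) of an infinite sequence. -/
def factor {A : Type*} (x : ℕ → A) (r n : ℕ) : List A :=
  List.ofFn (fun i : Fin n => x (r + i))

/-- The space `X_L` of the symbolic system of a language: all sequences whose factors are in `L`. -/
def symbolicSpace {A : Type*} (L : Language A) : Set (ℕ → A) :=
  {x | ∀ r n : ℕ, factor x r n ∈ L}

/-- The cylinder `[w]` in `X_L`. -/
def wordCylinder {A : Type*} (L : Language A) (w : List A) : Set (ℕ → A) :=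
  {x | x ∈ symbolicSpace L ∧ factor x 0 w.length = w}

/-- `μ` is a shift-invariant probability measure on `X_L`, seen as a measure on the space of all
sequences that is carried by `X_L`. -/
structure IsInvariantProbability {A : Type*} [MeasurableSpace A] (L : Language A)
    (μ : Measure (ℕ → A)) : Prop where
  isProbabilityMeasure : IsProbabilityMeasure μ
  carried : μ (symbolicSpace L)ᶜ = 0
  invariant : MeasurePreserving shift μ μ

/-- `e_n(μ)`: the smallest positive frequency of the words of length `n` of `L`. -/
noncomputable def smallestFrequency {A : Type*} [MeasurableSpace A] (L : Language A)
    (μ : Measure (ℕ → A)) (n : ℕ) : ℝ≥0∞ :=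
  sInf {p | 0 < p ∧ ∃ w ∈ L, w.length = n ∧ μ (wordCylinder L w) = p}

/-- `𝓑 = limsup 1 / (n e_n)`, in `[0, ∞]`. -/
noncomputable def upperBL {A : Type*} [MeasurableSpace A] (L : Language A)
    (μ : Measure (ℕ → A)) : ℝ≥0∞ :=
  limsup (fun n : ℕ => ((n : ℝ≥0∞) * smallestFrequency L μ n)⁻¹) atTop

/-- The upper BL spectrum of a family of (uniquely ergodic) symbolic systems, given by their
languages: the set of values of `𝓑`, computed with the invariant probability measure. -/
def upperBLSpectrum {A : Type*} [MeasurableSpace A] (F : Set (Language A)) : Set ℝ≥0∞ :=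
  {b | ∃ L ∈ F, ∃ μ : Measure (ℕ → A), IsInvariantProbability L μ ∧ b = upperBL L μ}

/-- The language of the transformation `T` of `X`, coded by the partition into the level sets
of `c`: all finite factors of the trajectories `n ↦ c (T^n x)`, `x ∈ X`. -/
def codingLanguage {E A : Type*} (X : Set E) (T : E → E) (c : E → A) : Language A :=
  {w | ∃ x ∈ X, ∃ r n : ℕ, w = factor (fun k => c (T^[k] x)) r n}

/-! ### Three-interval exchanges -/

/-- The three-interval exchange with parameters `α`, `β`, considered on `[0, 1)`. -/
noncomputable def threeIET (α β : ℝ) (x : ℝ) : ℝ :=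
  if x < α then x + 1 - α
  else if x < α + β then x + 1 - 2 * α - β
  else x - α - β

/-- The natural partition of `[0, 1)` into `[0, α)`, `[α, α + β)`, `[α + β, 1)`,
labelled `0`, `1`, `2`. -/
noncomputable def natPartition (α β : ℝ) (x : ℝ) : Fin 3 :=
  if x < α then 0 else if x < α + β then 1 else 2

/-- The language of the natural coding of the three-interval exchange. -/
noncomputable def ietLanguage (α β : ℝ) : Language (Fin 3) :=
  codingLanguage (Set.Ico (0 : ℝ) 1) (threeIET α β) (natPartition α β)

/-- The i.d.o.c. condition: no (non-trivial) rational relation `pα + qβ = p - q`,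
`pα + qβ = p - q + 1` or `pα + qβ = p - q - 1`. -/
def IDOC (α β : ℝ) : Prop :=
  (∀ p q : ℤ, ¬ (p = 0 ∧ q = 0) → (p : ℝ) * α + q * β ≠ p - q) ∧
  (∀ p q : ℤ, (p : ℝ) * α + q * β ≠ p - q + 1) ∧
  (∀ p q : ℤ, (p : ℝ) * α + q * β ≠ p - q - 1)

/-- Parameters of the three-interval exchanges that satisfy the i.d.o.c. condition. -/
def idocParams : Set (ℝ × ℝ) :=
  {a | 0 < a.1 ∧ 0 < a.2 ∧ a.1 + a.2 < 1 ∧ IDOC a.1 a.2}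

/-- The same, under the additional normalization `α < 1/2` and `2α + β > 1`. -/
def normalizedIdocParams : Set (ℝ × ℝ) :=
  {a | a ∈ idocParams ∧ a.1 < 1 / 2 ∧ 1 < 2 * a.1 + a.2}

/-- The upper BL spectrum of the naturally coded three-interval exchanges with parameters in
`P`. -/
def ietUpperBLSpectrum (P : Set (ℝ × ℝ)) : Set ℝ≥0∞ :=
  upperBLSpectrum ((fun a : ℝ × ℝ => ietLanguage a.1 a.2) '' P)

/-! The exchange is the first return map to [0,1) of the rotation by 1-α on a circle of length 1+β;
points of the middle interval need two rotation steps, all others one. The cylinders of order n are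
the intervals between consecutive preimages of the two discontinuities, and by unique ergodicity
their measures are their lengths. Since α and α+β lie on the backward rotation orbits of the points
1 and 0, a difference of two cut points is, up to sign, (1+β)Y with Y = e·r + n' - mζ, where ζ =
(1-α)/(1+β), r = 1/(1+β), e is 0 or 1, and |m| is at most about (1+β)n. Conversely each such value
with Y small and |m| large is a difference of cut points at an order near |m|/(1+β). The factors 1+β
cancel, so the lower limit of n·e_n equals the lower limit c of |XY| over the far points of a plane
lattice and one translate of it, and 𝓑 = 1/c (`upperBL_eq`). The i.d.o.c. condition says that no
such point has Y = 0.

The grid is then renormalized by continued fractions. A letter (a, b) records a partial quotient and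
a digit of the translation vector; a step changes the basis of the lattice, rescales both axes, and
preserves the product divided by the covolume. When the letters are bounded, every far point with a
small product has bounded coefficients at a suitable time, so c is the lower limit in k of a minimum
of finitely many continuous functions of the state at time k (`isLiminf_of_isGridLiminf`,
`isGridLiminf_of_nondegenerate`). A state is determined up to an exponentially small error by the
letters around it. Thus `gridSpectrum` behaves like a dynamical Lagrange spectrum over sequences
with 0 ≤ b ≤ a and 1 ≤ a, all of which occur.

Closedness follows by gluing longer and longer stretches of almost optimal sequences along common
windows (`mem_gridSpectrum_of_tendsto`). Finite prefixes do not affect lower limits; a suitable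
prefix moves the initial state into the region of the normalized parameters, so both families give
the same spectrum. The value 0 of c, that is 𝓑 = ∞, comes from Liouville numbers.

The isolated minimum is found by a finite search: if c exceeds 1000/4787, the letters are eventually
at most 4, and interval arithmetic eliminates every bi-extendable word of length 9 other than
(4,2)^9. The constant sequence (4,2) gives an explicit quadratic form over √5, with minimum 1/(2√5).

For the value 6, take the period (3,1)(1,0)(5,3)(4,2)^n with n even. As n grows, the critical
products all tend to 1/6, while all others stay above 10/59. One critical product is strictly below
1/6 for each n, because two expansions beginning with n fours compare like their tails. These lower
limits approach 1/6 from below without reaching it, and closedness supplies 1/6 itself. -/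

/-! ### Coded grids -/

/-- A state `(η, x, ζ, r)` of a grid: the lattice is spanned by `(1, -ζ)` and `(η, 1)`, and the
shift vector is `(x, r)`. -/
abbrev GridState := ℝ × ℝ × ℝ × ℝ

/-- First coordinate of the grid point `e • (x, r) + m • (1, -ζ) + n • (η, 1)`. -/
noncomputable def gridX (s : GridState) (p : ℤ × ℤ × ℤ) : ℝ :=
  p.1 * s.2.1 + p.2.1 + p.2.2 * s.1

/-- Second coordinate of the grid point `e • (x, r) + m • (1, -ζ) + n • (η, 1)`. -/
noncomputable def gridY (s : GridState) (p : ℤ × ℤ × ℤ) : ℝ :=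
  p.1 * s.2.2.2 + p.2.2 - p.2.1 * s.2.2.1

/-- The product of the coordinates of a grid point, normalized by the covolume. -/
noncomputable def gridNorm (s : GridState) (p : ℤ × ℤ × ℤ) : ℝ :=
  |gridX s p * gridY s p| / (1 + s.1 * s.2.2.1)

/-- The compact region that contains the states of coded grids. -/
def gridBox : Set GridState := Set.Icc (0, 0, 0, -1) (1, 2, 1, 1)

/-- The non-zero grid points with coefficients at most `C`. -/
noncomputable def gridPoints (C : ℕ) : Finset (ℤ × ℤ × ℤ) :=
  (({0, 1} : Finset ℤ) ×ˢ (Finset.Icc (-C : ℤ) C) ×ˢ (Finset.Icc (-C : ℤ) C)).erase (0, 0, 0)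

lemma mem_gridPoints {C : ℕ} {p : ℤ × ℤ × ℤ} : p ∈ gridPoints C ↔
    p ≠ (0, 0, 0) ∧ (p.1 = 0 ∨ p.1 = 1) ∧ |p.2.1| ≤ C ∧ |p.2.2| ≤ C := by
  simp [gridPoints, abs_le]

lemma gridPoints_nonempty (C : ℕ) : (gridPoints C).Nonempty :=
  ⟨(1, 0, 0), by simp [mem_gridPoints]⟩

/-- The minimum of the normalized products over the grid points with coefficients at most `C`. -/
noncomputable def gridMin (C : ℕ) (s : GridState) : ℝ :=
  (gridPoints C).inf' (gridPoints_nonempty C) (gridNorm s)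

lemma gridMin_le {C : ℕ} {s : GridState} {p : ℤ × ℤ × ℤ} (hp : p ∈ gridPoints C) :
    gridMin C s ≤ gridNorm s p := Finset.inf'_le _ hp

lemma exists_gridMin_eq (C : ℕ) (s : GridState) : ∃ p ∈ gridPoints C, gridMin C s = gridNorm s p :=
  Finset.exists_mem_eq_inf' _ _

lemma le_gridMin_iff {C : ℕ} {s : GridState} {c : ℝ} :
    c ≤ gridMin C s ↔ ∀ p ∈ gridPoints C, c ≤ gridNorm s p := Finset.le_inf'_iff _ _

lemma continuousOn_gridNorm (p : ℤ × ℤ × ℤ) : ContinuousOn (fun s => gridNorm s p) gridBox := by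
  unfold gridNorm gridX gridY
  refine ContinuousOn.div (by fun_prop) (by fun_prop) ?_
  rintro ⟨η, x, ζ, r⟩ ⟨h1, h2⟩
  have h3 : 0 ≤ η := h1.1
  have h4 : 0 ≤ ζ := h1.2.2.1
  have : 0 ≤ η * ζ := mul_nonneg h3 h4
  simp only
  linarith

lemma continuousOn_gridMin (C : ℕ) : ContinuousOn (gridMin C) gridBox :=
  ContinuousOn.finset_inf'_apply _ fun p _ => continuousOn_gridNorm p

lemma gridMin_uniform (C : ℕ) {ε : ℝ} (hε : 0 < ε) : ∃ δ > 0, ∀ s ∈ gridBox, ∀ t ∈ gridBox,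
    dist s t < δ → |gridMin C s - gridMin C t| < ε := by
  have h := isCompact_Icc.uniformContinuousOn_of_continuous (continuousOn_gridMin C)
  rw [Metric.uniformContinuousOn_iff] at h
  obtain ⟨δ, hδ, H⟩ := h ε hε
  exact ⟨δ, hδ, fun s hs t ht hd => by simpa [Real.dist_eq] using H s hs t ht hd⟩

lemma gridNorm_nonneg {s : GridState} (hs : s ∈ gridBox) (p : ℤ × ℤ × ℤ) : 0 ≤ gridNorm s p := by
  have h3 : 0 ≤ s.1 := hs.1.1
  have h4 : 0 ≤ s.2.2.1 := hs.1.2.2.1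
  unfold gridNorm
  positivity

/-- A coded grid: a sequence of letters `(a, b)` and the states of the grid, which satisfy the
recursions of the continued fraction algorithm (with numeration of the shift vector). -/
structure CodedGrid where
  a : ℕ → ℕ
  b : ℕ → ℕ
  η : ℕ → ℝ
  x : ℕ → ℝ
  ζ : ℕ → ℝ
  r : ℕ → ℝ
  one_le_a : ∀ k, 1 ≤ a k
  b_le_a : ∀ k, b k ≤ a k
  η_nonneg : ∀ k, 0 ≤ η k
  η_le : ∀ k, η k ≤ 1
  x_nonneg : ∀ k, 0 ≤ x k
  x_le : ∀ k, x k ≤ 1 + η k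
  ζ_nonneg : ∀ k, 0 ≤ ζ k
  ζ_le : ∀ k, ζ k ≤ 1
  r_ge : ∀ k, -ζ k ≤ r k
  r_le : ∀ k, r k ≤ 1
  η_succ : ∀ k, η (k + 1) * (a k + η k) = 1
  x_succ : ∀ k, x (k + 1) = η (k + 1) * (b k + x k)
  ζ_eq : ∀ k, ζ k * (a k + ζ (k + 1)) = 1
  r_eq : ∀ k, r k = ζ k * (b k - r (k + 1))

/-! ### Renormalization of grids by continued fractions -/

namespace CodedGrid

variable (G : CodedGrid)

/-- The state of the grid at time `k`. -/
noncomputable def state (k : ℕ) : GridState := (G.η k, G.x k, G.ζ k, G.r k)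

lemma state_mem (k : ℕ) : G.state k ∈ gridBox := by
  have h1 := G.η_nonneg k; have h2 := G.η_le k; have h3 := G.x_nonneg k; have h4 := G.x_le k
  have h5 := G.ζ_nonneg k; have h6 := G.ζ_le k; have h7 := G.r_ge k; have h8 := G.r_le k
  exact ⟨⟨h1, h3, h5, by simp [state]; linarith⟩, ⟨h2, by simp [state]; linarith, h6, h8⟩⟩

lemma one_le_a' (k : ℕ) : (1 : ℝ) ≤ G.a k := by exact_mod_cast G.one_le_a k

lemma ζ_pos (k : ℕ) : 0 < G.ζ k := by
  rcases (G.ζ_nonneg k).lt_or_eq with h | h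
  · exact h
  · have := G.ζ_eq k
    rw [← h] at this; simp at this

lemma η_pos (k : ℕ) : 0 < G.η (k + 1) := by
  rcases (G.η_nonneg (k + 1)).lt_or_eq with h | h
  · exact h
  · have := G.η_succ k
    rw [← h] at this; simp at this

/-- Coefficients at time `k + 1` from coefficients at time `k`. -/
def next (k : ℕ) (p : ℤ × ℤ × ℤ) : ℤ × ℤ × ℤ :=
  (p.1, p.2.2, p.2.1 - p.1 * G.b k - p.2.2 * G.a k)

/-- Coefficients at time `k` from coefficients at time `k + 1`. -/
def prev (k : ℕ) (p : ℤ × ℤ × ℤ) : ℤ × ℤ × ℤ :=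
  (p.1, p.1 * G.b k + p.2.1 * G.a k + p.2.2, p.2.1)

lemma next_prev (k : ℕ) (p : ℤ × ℤ × ℤ) : G.next k (G.prev k p) = p := by
  obtain ⟨e, m, n⟩ := p
  simp only [next, prev, Prod.mk.injEq, true_and]
  ring

lemma prev_next (k : ℕ) (p : ℤ × ℤ × ℤ) : G.prev k (G.next k p) = p := by
  obtain ⟨e, m, n⟩ := p
  simp [next, prev]

/-- A step is a change of basis of the grid followed by a diagonal map: the first coordinate is
multiplied by η_{k+1}, the second by -1/ζ_k. The determinant 1 + ηζ is multiplied by η_{k+1}/ζ_k,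
which is why the normalized product is invariant. -/
lemma gridX_next (k : ℕ) (p : ℤ × ℤ × ℤ) :
    gridX (G.state (k + 1)) (G.next k p) = G.η (k + 1) * gridX (G.state k) p := by
  have h1 := G.η_succ k
  have h2 := G.x_succ k
  simp only [gridX, next, state, h2]
  push_cast
  linear_combination (-(p.2.2 : ℝ)) * h1

lemma gridY_next (k : ℕ) (p : ℤ × ℤ × ℤ) :
    gridY (G.state k) p = -G.ζ k * gridY (G.state (k + 1)) (G.next k p) := by
  have h1 := G.ζ_eq k
  have h2 := G.r_eq k
  simp only [gridY, next, state, h2]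
  push_cast
  linear_combination (-(p.2.2 : ℝ)) * h1

lemma one_add_pos (k : ℕ) : 0 < 1 + G.η k * G.ζ k := by
  have := mul_nonneg (G.η_nonneg k) (G.ζ_nonneg k)
  linarith

lemma covolume_next (k : ℕ) :
    G.ζ k * (1 + G.η (k + 1) * G.ζ (k + 1)) = G.η (k + 1) * (1 + G.η k * G.ζ k) := by
  have h1 := G.η_succ k
  have h2 := G.ζ_eq k
  linear_combination G.η (k + 1) * h2 - G.ζ k * h1

lemma gridNorm_next (k : ℕ) (p : ℤ × ℤ × ℤ) :
    gridNorm (G.state (k + 1)) (G.next k p) = gridNorm (G.state k) p := by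
  have h0 := G.covolume_next k
  have h1 := G.one_add_pos k
  have h2 := G.one_add_pos (k + 1)
  have h3 := G.ζ_pos k
  have h4 := G.η_pos k
  have e1 : gridNorm (G.state (k + 1)) (G.next k p) = |gridX (G.state (k + 1)) (G.next k p)
      * gridY (G.state (k + 1)) (G.next k p)| / (1 + G.η (k + 1) * G.ζ (k + 1)) := rfl
  have e2 : gridNorm (G.state k) p = |gridX (G.state k) p * gridY (G.state k) p| /
      (1 + G.η k * G.ζ k) := rfl
  rw [e1, e2, gridX_next, gridY_next G k p]
  simp only [abs_mul, abs_neg, abs_of_pos h3, abs_of_pos h4]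
  rw [div_eq_div_iff h2.ne' h1.ne']
  linear_combination (-|gridX (G.state k) p| * |gridY (G.state (k + 1)) (G.next k p)|) * h0

/-- Coefficients at time `k` of a grid point with given coefficients at time `0`. -/
def coeff (p : ℤ × ℤ × ℤ) : ℕ → ℤ × ℤ × ℤ
  | 0 => p
  | k + 1 => G.next k (coeff p k)

lemma coeff_surjective (k : ℕ) (q : ℤ × ℤ × ℤ) : ∃ p, G.coeff p k = q := by
  induction k generalizing q with
  | zero => exact ⟨q, rfl⟩
  | succ k ih =>
    obtain ⟨p, hp⟩ := ih (G.prev k q)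
    exact ⟨p, by rw [coeff, hp, next_prev]⟩

lemma coeff_fst (p : ℤ × ℤ × ℤ) (k : ℕ) : (G.coeff p k).1 = p.1 := by
  induction k with
  | zero => rfl
  | succ k ih => rw [coeff, next, ih]

lemma coeff_zero (k : ℕ) : G.coeff (0, 0, 0) k = (0, 0, 0) := by
  induction k with
  | zero => rfl
  | succ k ih => rw [coeff, ih]; simp [next]

lemma coeff_ne_zero {p : ℤ × ℤ × ℤ} (hp : p ≠ (0, 0, 0)) (k : ℕ) : G.coeff p k ≠ (0, 0, 0) := by
  induction k with
  | zero => exact hp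
  | succ k ih =>
    intro h
    apply ih
    rw [coeff] at h
    have := congrArg (G.prev k) h
    rw [prev_next] at this
    rw [this]; simp [prev]

lemma gridNorm_coeff (p : ℤ × ℤ × ℤ) (k : ℕ) :
    gridNorm (G.state k) (G.coeff p k) = gridNorm (G.state 0) p := by
  induction k with
  | zero => rfl
  | succ k ih => rw [coeff, gridNorm_next, ih]

/-- The product `η₁ ⋯ η_k`. -/
noncomputable def prodη (k : ℕ) : ℝ := ∏ i ∈ Finset.range k, G.η (i + 1)

/-- The product `ζ₀ ⋯ ζ_{k-1}`. -/
noncomputable def prodζ (k : ℕ) : ℝ := ∏ i ∈ Finset.range k, G.ζ i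

lemma prodη_succ (k : ℕ) : G.prodη (k + 1) = G.prodη k * G.η (k + 1) := Finset.prod_range_succ _ _

lemma prodζ_succ (k : ℕ) : G.prodζ (k + 1) = G.prodζ k * G.ζ k := Finset.prod_range_succ _ _

lemma prodη_pos (k : ℕ) : 0 < G.prodη k := Finset.prod_pos fun i _ => G.η_pos i

lemma prodζ_pos (k : ℕ) : 0 < G.prodζ k := Finset.prod_pos fun i _ => G.ζ_pos i

lemma gridX_coeff (p : ℤ × ℤ × ℤ) (k : ℕ) :
    gridX (G.state k) (G.coeff p k) = G.prodη k * gridX (G.state 0) p := by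
  induction k with
  | zero => simp [prodη, coeff]
  | succ k ih => rw [coeff, gridX_next, ih, prodη_succ]; ring

lemma abs_gridY_coeff (p : ℤ × ℤ × ℤ) (k : ℕ) :
    |gridY (G.state 0) p| = G.prodζ k * |gridY (G.state k) (G.coeff p k)| := by
  induction k with
  | zero => simp [prodζ, coeff]
  | succ k ih =>
    rw [ih, gridY_next, prodζ_succ, abs_mul, abs_neg, abs_of_pos (G.ζ_pos k), coeff]; ring

/-- A single η may be close to 1, so geometric decay is only available in steps of two. -/
lemma η_mul_η_le (k : ℕ) : G.η (k + 2) * G.η (k + 1) ≤ 1 / 2 := by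
  have h1 := G.η_succ (k + 1)
  have h2 := G.one_le_a' (k + 1)
  have h3 := G.η_le (k + 1)
  have h4 := G.η_pos k
  have h5 := G.η_pos (k + 1)
  have h6 : G.η (k + 1 + 1) * 1 ≤ G.η (k + 1 + 1) * G.a (k + 1) :=
    mul_le_mul_of_nonneg_left h2 h5.le
  have h7 : G.η (k + 1 + 1) * G.η (k + 1) ≤ G.η (k + 1 + 1) * 1 :=
    mul_le_mul_of_nonneg_left h3 h5.le
  change G.η (k + 1 + 1) * _ ≤ _
  nlinarith

lemma ζ_mul_ζ_le (k : ℕ) : G.ζ k * G.ζ (k + 1) ≤ 1 / 2 := by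
  have h1 := G.ζ_eq k
  have h2 := G.one_le_a' k
  have h3 := G.ζ_le (k + 1)
  have h4 := G.ζ_pos k
  have h6 : G.ζ k * 1 ≤ G.ζ k * G.a k := mul_le_mul_of_nonneg_left h2 h4.le
  have h7 : G.ζ k * G.ζ (k + 1) ≤ G.ζ k * 1 := mul_le_mul_of_nonneg_left h3 h4.le
  nlinarith

lemma prodη_le (k : ℕ) : G.prodη (2 * k) ≤ (1 / 2) ^ k ∧ G.prodη (2 * k + 1) ≤ (1 / 2) ^ k := by
  have h : ∀ k, G.prodη (2 * k) ≤ (1 / 2) ^ k := by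
    intro k
    induction k with
    | zero => simp [prodη]
    | succ k ih =>
      rw [show 2 * (k + 1) = 2 * k + 1 + 1 by ring, prodη_succ, prodη_succ, pow_succ, mul_assoc]
      have := G.η_mul_η_le (2 * k)
      rw [mul_comm] at this
      exact mul_le_mul ih this (mul_nonneg (G.η_nonneg _) (G.η_nonneg _)) (by positivity)
  refine ⟨h k, ?_⟩
  rw [prodη_succ]
  calc _ ≤ G.prodη (2 * k) * 1 :=
        mul_le_mul_of_nonneg_left (G.η_le _) (G.prodη_pos _).le
    _ ≤ _ := by rw [mul_one]; exact h k

lemma prodζ_le (k : ℕ) : G.prodζ (2 * k) ≤ (1 / 2) ^ k := by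
  induction k with
  | zero => simp [prodζ]
  | succ k ih =>
    rw [show 2 * (k + 1) = 2 * k + 1 + 1 by ring, prodζ_succ, prodζ_succ, pow_succ, mul_assoc]
    exact mul_le_mul ih (G.ζ_mul_ζ_le _) (mul_nonneg (G.ζ_nonneg _) (G.ζ_nonneg _)) (by positivity)

lemma prodη_anti : Antitone G.prodη := antitone_nat_of_succ_le fun k => by
  rw [prodη_succ]
  exact mul_le_of_le_one_right (G.prodη_pos k).le (G.η_le _)

lemma prodζ_anti : Antitone G.prodζ := antitone_nat_of_succ_le fun k => by
  rw [prodζ_succ]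
  exact mul_le_of_le_one_right (G.prodζ_pos k).le (G.ζ_le _)

lemma tendsto_prodη : Tendsto G.prodη atTop (𝓝 0) := by
  rw [Metric.tendsto_atTop]
  intro ε hε
  obtain ⟨N, hN⟩ := exists_pow_lt_of_lt_one hε (by norm_num : (1 / 2 : ℝ) < 1)
  refine ⟨2 * N, fun n hn => ?_⟩
  rw [Real.dist_eq, sub_zero, abs_of_pos (G.prodη_pos n)]
  exact ((G.prodη_anti hn).trans (G.prodη_le N).1).trans_lt hN

lemma tendsto_prodζ : Tendsto G.prodζ atTop (𝓝 0) := by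
  rw [Metric.tendsto_atTop]
  intro ε hε
  obtain ⟨N, hN⟩ := exists_pow_lt_of_lt_one hε (by norm_num : (1 / 2 : ℝ) < 1)
  refine ⟨2 * N, fun n hn => ?_⟩
  rw [Real.dist_eq, sub_zero, abs_of_pos (G.prodζ_pos n)]
  exact ((G.prodζ_anti hn).trans (G.prodζ_le N)).trans_lt hN

/-- The coded grid seen from time `k₀` on. -/
def drop (k₀ : ℕ) : CodedGrid where
  a k := G.a (k₀ + k)
  b k := G.b (k₀ + k)
  η k := G.η (k₀ + k)
  x k := G.x (k₀ + k)
  ζ k := G.ζ (k₀ + k)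
  r k := G.r (k₀ + k)
  one_le_a _ := G.one_le_a _
  b_le_a _ := G.b_le_a _
  η_nonneg _ := G.η_nonneg _
  η_le _ := G.η_le _
  x_nonneg _ := G.x_nonneg _
  x_le _ := G.x_le _
  ζ_nonneg _ := G.ζ_nonneg _
  ζ_le _ := G.ζ_le _
  r_ge _ := G.r_ge _
  r_le _ := G.r_le _
  η_succ _ := G.η_succ _
  x_succ _ := G.x_succ _
  ζ_eq _ := G.ζ_eq _
  r_eq _ := G.r_eq _

lemma drop_state (k₀ k : ℕ) : (G.drop k₀).state k = G.state (k₀ + k) := rfl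

end CodedGrid

/-! ### States are determined by the letters around them -/

/-- The difference of two solutions is multiplied by products of consecutive values u, and two
consecutive ones multiply to at most 1/2. The sign σ allows one statement for both recursions: σ = 1
for the past pair (η, x), σ = -1 for the future pair (ζ, r). -/
lemma two_step_contraction {σ c c' d d' u₀ u₁ u₂ v₀ v₁ v₂ u₀' u₁' u₂' v₀' v₁' v₂' : ℝ}
    (hσ : |σ| = 1) (hc : 1 ≤ c) (hc' : 1 ≤ c')
    (h₁ : u₁ * (c + u₀) = 1) (h₂ : u₂ * (c' + u₁) = 1)
    (h₁' : u₁' * (c + u₀') = 1) (h₂' : u₂' * (c' + u₁') = 1)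
    (k₁ : v₁ = u₁ * (d + σ * v₀)) (k₂ : v₂ = u₂ * (d' + σ * v₁))
    (k₁' : v₁' = u₁' * (d + σ * v₀')) (k₂' : v₂' = u₂' * (d' + σ * v₁'))
    (p₀ : 0 ≤ u₀) (p₀' : 0 ≤ u₀') (p₁' : u₁' ≤ 1)
    (w₁ : |v₁'| ≤ 2) (w₂ : |v₂'| ≤ 2) :
    |u₂ - u₂'| ≤ |u₀ - u₀'| / 4 ∧ |v₂ - v₂'| ≤ |v₀ - v₀'| / 2 + 2 * |u₀ - u₀'| := by
  have q₁ : 0 < u₁ := pos_of_mul_pos_left (by rw [h₁]; norm_num) (by linarith)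
  have q₁' : 0 < u₁' := pos_of_mul_pos_left (by rw [h₁']; norm_num) (by linarith)
  have q₂ : 0 < u₂ := pos_of_mul_pos_left (by rw [h₂]; norm_num) (by linarith)
  have q₂' : 0 < u₂' := pos_of_mul_pos_left (by rw [h₂']; norm_num) (by linarith)
  have s : u₂ * u₁ ≤ 1 / 2 := by nlinarith
  have s' : u₂' * u₁' ≤ 1 / 2 := by nlinarith
  have d₁ : u₁ - u₁' = -(u₁ * u₁') * (u₀ - u₀') := by
    linear_combination u₁' * h₁ - u₁ * h₁'
  have d₂ : u₂ - u₂' = -(u₂ * u₂') * (u₁ - u₁') := by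
    linear_combination u₂' * h₂ - u₂ * h₂'
  have e₁ : v₁ - v₁' = u₁ * (σ * (v₀ - v₀') - (u₀ - u₀') * v₁') := by
    have t : v₁' * (c + u₀') = d + σ * v₀' := by
      rw [k₁']; linear_combination (d + σ * v₀') * h₁'
    linear_combination k₁ - u₁ * t + v₁' * h₁
  have e₂ : v₂ - v₂' = u₂ * (σ * (v₁ - v₁') - (u₁ - u₁') * v₂') := by
    have t : v₂' * (c' + u₁') = d' + σ * v₁' := by
      rw [k₂']; linear_combination (d' + σ * v₁') * h₂'
    linear_combination k₂ - u₂ * t + v₂' * h₂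
  have a₁ : |u₁ - u₁'| = u₁ * u₁' * |u₀ - u₀'| := by
    rw [d₁, abs_mul, abs_neg, abs_of_pos (mul_pos q₁ q₁')]
  have a₂ : |u₂ - u₂'| = u₂ * u₂' * |u₁ - u₁'| := by
    rw [d₂, abs_mul, abs_neg, abs_of_pos (mul_pos q₂ q₂')]
  have b₁ : |v₁ - v₁'| ≤ u₁ * (|v₀ - v₀'| + 2 * |u₀ - u₀'|) := by
    rw [e₁, abs_mul, abs_of_pos q₁]
    refine mul_le_mul_of_nonneg_left ((abs_sub _ _).trans ?_) q₁.le
    rw [abs_mul, abs_mul, hσ]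
    nlinarith [abs_nonneg (u₀ - u₀'), abs_nonneg (v₀ - v₀')]
  have b₂ : |v₂ - v₂'| ≤ u₂ * (|v₁ - v₁'| + 2 * |u₁ - u₁'|) := by
    rw [e₂, abs_mul, abs_of_pos q₂]
    refine mul_le_mul_of_nonneg_left ((abs_sub _ _).trans ?_) q₂.le
    rw [abs_mul, abs_mul, hσ]
    nlinarith [abs_nonneg (u₁ - u₁'), abs_nonneg (v₁ - v₁')]
  have z := abs_nonneg (u₀ - u₀')
  constructor
  · have : (u₂ * u₁) * (u₂' * u₁') ≤ 1 / 2 * (1 / 2) :=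
      mul_le_mul s s' (mul_pos q₂' q₁').le (by norm_num)
    calc |u₂ - u₂'| = (u₂ * u₁) * (u₂' * u₁') * |u₀ - u₀'| := by rw [a₂, a₁]; ring
      _ ≤ 1 / 2 * (1 / 2) * |u₀ - u₀'| := mul_le_mul_of_nonneg_right this z
      _ = _ := by ring
  · have z' := abs_nonneg (v₀ - v₀')
    have t : |u₁ - u₁'| ≤ u₁ * |u₀ - u₀'| := by
      rw [a₁]
      have : u₁ * u₁' ≤ u₁ := mul_le_of_le_one_right q₁.le p₁'
      exact mul_le_mul_of_nonneg_right this z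
    calc |v₂ - v₂'| ≤ u₂ * (|v₁ - v₁'| + 2 * |u₁ - u₁'|) := b₂
      _ ≤ u₂ * (u₁ * (|v₀ - v₀'| + 2 * |u₀ - u₀'|) + 2 * (u₁ * |u₀ - u₀'|)) := by
          apply mul_le_mul_of_nonneg_left _ q₂.le
          linarith
      _ = (u₂ * u₁) * (|v₀ - v₀'| + 4 * |u₀ - u₀'|) := by ring
      _ ≤ 1 / 2 * (|v₀ - v₀'| + 4 * |u₀ - u₀'|) := by
          apply mul_le_mul_of_nonneg_right s; positivity
      _ = _ := by ring

lemma iterated_contraction {σ : ℝ} (hσ : |σ| = 1) {K : ℕ} {c d u v u' v' : ℕ → ℝ}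
    (hc : ∀ i < 2 * K, 1 ≤ c i)
    (hu : ∀ i < 2 * K, u (i + 1) * (c i + u i) = 1)
    (hu' : ∀ i < 2 * K, u' (i + 1) * (c i + u' i) = 1)
    (hv : ∀ i < 2 * K, v (i + 1) = u (i + 1) * (d i + σ * v i))
    (hv' : ∀ i < 2 * K, v' (i + 1) = u' (i + 1) * (d i + σ * v' i))
    (pu : ∀ i, 0 ≤ u i) (pu' : ∀ i, 0 ≤ u' i) (lu : ∀ i, u i ≤ 1) (lu' : ∀ i, u' i ≤ 1)
    (lv : ∀ i, |v i| ≤ 2) (lv' : ∀ i, |v' i| ≤ 2) :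
    |u (2 * K) - u' (2 * K)| ≤ 12 * (1 / 2) ^ K ∧ |v (2 * K) - v' (2 * K)| ≤ 12 * (1 / 2) ^ K := by
  -- The second bound solves e_{j+1} ≤ e_j/2 + 2·4^{-j} with e_0 ≤ 4; the subtracted term makes the
  -- induction close.
  have key : ∀ j ≤ K, |u (2 * j) - u' (2 * j)| ≤ (1 / 4) ^ j ∧
      |v (2 * j) - v' (2 * j)| ≤ 12 * (1 / 2) ^ j - 8 * (1 / 4) ^ j := by
    intro j hj
    induction j with
    | zero =>
      have h1 := lv 0; have h2 := lv' 0; have h3 := lu 0; have h4 := lu' 0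
      have h5 := pu 0; have h6 := pu' 0
      rw [abs_le] at h1 h2
      constructor
      · simp [abs_le]; constructor <;> linarith
      · simp [abs_le]; constructor <;> linarith
    | succ j ih =>
      obtain ⟨i1, i2⟩ := ih (by omega)
      obtain ⟨t1, t2⟩ := two_step_contraction hσ (hc (2 * j) (by omega)) (hc (2 * j + 1) (by omega))
        (hu (2 * j) (by omega)) (hu (2 * j + 1) (by omega))
        (hu' (2 * j) (by omega)) (hu' (2 * j + 1) (by omega))
        (hv (2 * j) (by omega)) (hv (2 * j + 1) (by omega))
        (hv' (2 * j) (by omega)) (hv' (2 * j + 1) (by omega))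
        (pu _) (pu' _) (lu' _) (lv' _) (lv' _)
      rw [show 2 * (j + 1) = 2 * j + 1 + 1 by ring, pow_succ, pow_succ]
      constructor
      · linarith
      · linarith
  obtain ⟨h1, h2⟩ := key K le_rfl
  have h3 : (1 / 4 : ℝ) ^ K ≤ (1 / 2) ^ K := by
    apply pow_le_pow_left₀ <;> norm_num
  have h4 : (0 : ℝ) ≤ (1 / 4 : ℝ) ^ K := by positivity
  constructor <;> linarith

/-- `c` is the lower limit of the sequence `f`. -/
def IsLiminf (f : ℕ → ℝ) (c : ℝ) : Prop :=
  (∀ ε > 0, ∀ᶠ k in atTop, c - ε < f k) ∧ ∀ ε > 0, ∃ᶠ k in atTop, f k < c + ε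

lemma IsLiminf.unique {f : ℕ → ℝ} {c d : ℝ} (h : IsLiminf f c) (h' : IsLiminf f d) : c = d := by
  have key : ∀ {c d : ℝ}, IsLiminf f c → IsLiminf f d → c ≤ d := by
    intro c d h h'
    by_contra! hlt
    obtain ⟨k, h1, h2⟩ := ((h'.2 ((c - d) / 2) (by linarith)).and_eventually
      (h.1 ((c - d) / 2) (by linarith))).exists
    linarith
  exact le_antisymm (key h h') (key h' h)

lemma exists_isLiminf {f : ℕ → ℝ} {l u : ℝ} (hl : ∀ᶠ k in atTop, l ≤ f k)
    (hu : ∃ᶠ k in atTop, f k ≤ u) : ∃ c, l ≤ c ∧ c ≤ u ∧ IsLiminf f c := by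
  set S : Set ℝ := {d | ∀ᶠ k in atTop, d ≤ f k}
  have hb : ∀ d ∈ S, d ≤ u := by
    intro d hd
    obtain ⟨k, h1, h2⟩ := (hu.and_eventually hd).exists
    exact h2.trans h1
  have hbdd : BddAbove S := ⟨u, hb⟩
  refine ⟨sSup S, le_csSup hbdd hl, csSup_le ⟨l, hl⟩ hb, fun ε hε => ?_, fun ε hε => ?_⟩
  · obtain ⟨d, hd, hd'⟩ := exists_lt_of_lt_csSup ⟨l, hl⟩ (show sSup S - ε < sSup S by linarith)
    exact Eventually.mono hd fun k hk => hd'.trans_le hk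
  · by_contra hcon
    rw [not_frequently] at hcon
    have : sSup S + ε ∈ S := hcon.mono fun k hk => not_lt.1 hk
    have := le_csSup hbdd this
    linarith

/-- The two sequences are asymptotically equal along a shift, hence have the same lower limit. -/
lemma IsLiminf.congr {f g : ℕ → ℝ} {c : ℝ} (h : IsLiminf f c) (m n : ℕ)
    (hfg : ∀ ε > 0, ∀ᶠ k in atTop, |f (k + m) - g (k + n)| < ε) : IsLiminf g c := by
  constructor
  · intro ε hε
    have h1 := (tendsto_add_atTop_nat m).eventually (h.1 (ε / 2) (by linarith))
    have h2 := hfg (ε / 2) (by linarith)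
    have h3 : ∀ᶠ k in atTop, c - ε < g (k + n) := by
      filter_upwards [h1, h2] with k k1 k2
      rw [abs_lt] at k2
      linarith
    rw [← map_add_atTop_eq_nat n]
    exact h3
  · intro ε hε hcon
    have h2 := hfg (ε / 2) (by linarith)
    have h3 := (tendsto_add_atTop_nat n).eventually hcon
    have h1 : ∀ᶠ k in atTop, ¬ f (k + m) < c + ε / 2 := by
      filter_upwards [h3, h2] with k k1 k2
      rw [abs_lt] at k2
      intro h; apply k1; linarith
    refine h.2 (ε / 2) (by linarith) ?_
    rw [← map_add_atTop_eq_nat m]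
    exact h1

namespace CodedGrid

variable (G G' : CodedGrid)

lemma x_abs_le (k : ℕ) : |G.x k| ≤ 2 := by
  have := G.x_nonneg k; have := G.x_le k; have := G.η_le k
  rw [abs_le]; constructor <;> linarith

lemma r_abs_le (k : ℕ) : |G.r k| ≤ 1 := by
  have := G.r_ge k; have := G.r_le k; have := G.ζ_le k
  rw [abs_le]; constructor <;> linarith

variable {G G'} in
lemma past_close {t t' K : ℕ}
    (h : ∀ i < 2 * K, G.a (t + i) = G'.a (t' + i) ∧ G.b (t + i) = G'.b (t' + i)) :
    |G.η (t + 2 * K) - G'.η (t' + 2 * K)| ≤ 12 * (1 / 2) ^ K ∧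
      |G.x (t + 2 * K) - G'.x (t' + 2 * K)| ≤ 12 * (1 / 2) ^ K := by
  refine iterated_contraction (σ := 1) (by simp) (c := fun i => G.a (t + i))
    (d := fun i => G.b (t + i)) (u := fun i => G.η (t + i)) (v := fun i => G.x (t + i))
    (u' := fun i => G'.η (t' + i)) (v' := fun i => G'.x (t' + i)) (fun i _ => G.one_le_a' _)
    (fun i _ => G.η_succ _) (fun i hi => ?_) (fun i _ => ?_) (fun i hi => ?_)
    (fun i => G.η_nonneg _) (fun i => G'.η_nonneg _) (fun i => G.η_le _) (fun i => G'.η_le _)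
    (fun i => G.x_abs_le _) (fun i => G'.x_abs_le _)
  · rw [(h i hi).1]; exact G'.η_succ _
  · rw [one_mul]; exact G.x_succ _
  · rw [(h i hi).2, one_mul]; exact G'.x_succ _

variable {G G'} in
lemma future_close {t t' K : ℕ}
    (h : ∀ i < 2 * K, G.a (t + i) = G'.a (t' + i) ∧ G.b (t + i) = G'.b (t' + i)) :
    |G.ζ t - G'.ζ t'| ≤ 12 * (1 / 2) ^ K ∧ |G.r t - G'.r t'| ≤ 12 * (1 / 2) ^ K := by
  have aux : ∀ s i, i < 2 * K → s + (2 * K - 1 - i) + 1 = s + (2 * K - i) := by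
    intro s i hi; omega
  have aux' : ∀ s i, i < 2 * K → s + (2 * K - 1 - i) = s + (2 * K - (i + 1)) := by
    intro s i hi; omega
  -- The recursion for (ζ, r) determines time k from time k+1, so it is run with time reversed.
  have := iterated_contraction (σ := -1) (by simp) (K := K)
    (c := fun i => G.a (t + (2 * K - 1 - i)))
    (d := fun i => G.b (t + (2 * K - 1 - i))) (u := fun i => G.ζ (t + (2 * K - i)))
    (v := fun i => G.r (t + (2 * K - i)))
    (u' := fun i => G'.ζ (t' + (2 * K - i))) (v' := fun i => G'.r (t' + (2 * K - i)))
    (fun i _ => G.one_le_a' _)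
    (fun i hi => ?_) (fun i hi => ?_) (fun i hi => ?_) (fun i hi => ?_)
    (fun i => G.ζ_nonneg _) (fun i => G'.ζ_nonneg _) (fun i => G.ζ_le _) (fun i => G'.ζ_le _)
    (fun i => (G.r_abs_le _).trans (by norm_num)) (fun i => (G'.r_abs_le _).trans (by norm_num))
  · simpa using this
  · have := G.ζ_eq (t + (2 * K - 1 - i))
    rw [aux t i hi] at this
    rw [← aux' t i hi]; exact this
  · have := G'.ζ_eq (t' + (2 * K - 1 - i))
    rw [aux t' i hi, ← (h _ (by omega)).1] at this
    rw [← aux' t' i hi]; exact this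
  · have := G.r_eq (t + (2 * K - 1 - i))
    rw [aux t i hi] at this
    rw [← aux' t i hi]; linarith
  · have := G'.r_eq (t' + (2 * K - 1 - i))
    rw [aux t' i hi, ← (h _ (by omega)).2] at this
    rw [← aux' t' i hi]; linarith

variable {G G'} in
lemma state_close {t t' K : ℕ}
    (h : ∀ i < 4 * K, G.a (t + i) = G'.a (t' + i) ∧ G.b (t + i) = G'.b (t' + i)) :
    dist (G.state (t + 2 * K)) (G'.state (t' + 2 * K)) ≤ 12 * (1 / 2) ^ K := by
  obtain ⟨h1, h2⟩ := past_close fun i (hi : i < 2 * K) => h i (by omega)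
  obtain ⟨h3, h4⟩ := future_close (G := G) (G' := G') (t := t + 2 * K) (t' := t' + 2 * K) (K := K)
    fun i hi => by simpa [add_assoc] using h (2 * K + i) (by omega)
  simp only [state, Prod.dist_eq, Real.dist_eq, max_le_iff]
  exact ⟨h1, h2, h3, h4⟩

/-- Letters in a large window determine the state up to a small error. -/
lemma exists_window {C : ℕ} {ε : ℝ} (hε : 0 < ε) : ∃ K : ℕ, ∀ G G' : CodedGrid, ∀ k k' : ℕ,
    K ≤ k → K ≤ k' → (∀ i < 2 * K, G.a (k - K + i) = G'.a (k' - K + i) ∧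
      G.b (k - K + i) = G'.b (k' - K + i)) →
    |gridMin C (G.state k) - gridMin C (G'.state k')| < ε := by
  obtain ⟨δ, hδ, H⟩ := gridMin_uniform C hε
  obtain ⟨N, hN⟩ := exists_pow_lt_of_lt_one (show 0 < δ / 12 by positivity)
    (by norm_num : (1 / 2 : ℝ) < 1)
  -- The radius is 2N because the contraction by 1/2 costs two letters, on either side of the state.
  refine ⟨2 * N, fun G G' k k' hk hk' h => H _ (G.state_mem _) _ (G'.state_mem _) ?_⟩
  have := state_close (G := G) (G' := G') (t := k - 2 * N) (t' := k' - 2 * N) (K := N)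
    fun i hi => h i (by omega)
  rw [Nat.sub_add_cancel hk, Nat.sub_add_cancel hk'] at this
  linarith

/-- Sequences of letters that are eventually equal give the same lower limit. -/
lemma isLiminf_of_letters_eventually_eq {C : ℕ} {c : ℝ} {m n : ℕ}
    (h : IsLiminf (fun k => gridMin C (G.state k)) c)
    (hl : ∀ k, G.a (k + m) = G'.a (k + n) ∧ G.b (k + m) = G'.b (k + n)) :
    IsLiminf (fun k => gridMin C (G'.state k)) c := by
  refine h.congr m n fun ε hε => ?_
  obtain ⟨K, hK⟩ := exists_window (C := C) hε
  filter_upwards [eventually_ge_atTop K] with k hk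
  refine hK G G' _ _ (by omega) (by omega) fun i hi => ?_
  have := hl (k - K + i)
  rwa [show k - K + i + m = k + m - K + i by omega, show k - K + i + n = k + n - K + i by omega]
    at this

end CodedGrid

/-! ### Lower limits over far points and over times -/

/-- `c` is the lower limit of the normalized products over the grid points that go to infinity in
the horizontal direction. -/
def IsGridLiminf (s : GridState) (c : ℝ) : Prop :=
  (∀ ε > 0, ∃ J : ℝ, ∀ p : ℤ × ℤ × ℤ, (p.1 = 0 ∨ p.1 = 1) → J ≤ |gridX s p| →
    c - ε < gridNorm s p) ∧
  ∀ ε > 0, ∀ J : ℝ, ∃ p : ℤ × ℤ × ℤ, (p.1 = 0 ∨ p.1 = 1) ∧ J ≤ |gridX s p| ∧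
    gridNorm s p < c + ε

/-- No non-zero grid point lies on the horizontal axis. -/
def GridNondegenerate (s : GridState) : Prop :=
  ∀ p : ℤ × ℤ × ℤ, (p.1 = 0 ∨ p.1 = 1) → p ≠ (0, 0, 0) → gridY s p ≠ 0

/-- Cramer's rule: the determinant 1 + ηζ is at least 1, and the translation vector contributes at
most 2 + 1. -/
lemma coeff_abs_le_of_coordinates {s : GridState} (hs : s ∈ gridBox) {p : ℤ × ℤ × ℤ}
    (hp : p.1 = 0 ∨ p.1 = 1) {A B : ℝ} (hX : |gridX s p| ≤ A) (hY : |gridY s p| ≤ B) :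
    |(p.2.1 : ℝ)| ≤ A + B + 3 ∧ |(p.2.2 : ℝ)| ≤ A + B + 3 := by
  obtain ⟨e, m, n⟩ := p
  obtain ⟨η, x, ζ, r⟩ := s
  obtain ⟨⟨h1, h2, h3, h4⟩, ⟨h5, h6, h7, h8⟩⟩ := hs
  simp only [gridX, gridY] at *
  have hη : 0 ≤ η := h1
  have hη' : η ≤ 1 := h5
  have hζ : 0 ≤ ζ := h3
  have hζ' : ζ ≤ 1 := h7
  have hx : |(e : ℝ) * x| ≤ 2 := by
    have hx0 : 0 ≤ x := h2
    have hx2 : x ≤ 2 := h6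
    rcases hp with rfl | rfl
    · simp
    · simp only [Int.cast_one, one_mul]; rw [abs_of_nonneg hx0]; exact hx2
  have hr : |(e : ℝ) * r| ≤ 1 := by
    rcases hp with rfl | rfl
    · simp
    · simpa using abs_le.2 ⟨h4, h8⟩
  set X := (e : ℝ) * x + m + n * η with hXd
  set Y := (e : ℝ) * r + n - m * ζ with hYd
  have hd : 1 ≤ 1 + η * ζ := by have := mul_nonneg hη hζ; linarith
  have em : (m : ℝ) * (1 + η * ζ) = X - e * x - η * (Y - e * r) := by rw [hXd, hYd]; ring
  have en : (n : ℝ) * (1 + η * ζ) = (Y - e * r) + ζ * (X - e * x) := by rw [hXd, hYd]; ring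
  have t1 : |X - e * x| ≤ A + 2 := (abs_sub _ _).trans (by linarith)
  have t2 : |Y - e * r| ≤ B + 1 := (abs_sub _ _).trans (by linarith)
  have mono : ∀ z : ℝ, |z| ≤ |z * (1 + η * ζ)| := fun z => by
    rw [abs_mul, abs_of_pos (by linarith : 0 < 1 + η * ζ)]
    exact le_mul_of_one_le_right (abs_nonneg _) hd
  constructor
  · refine (mono m).trans ?_
    rw [em]
    refine (abs_sub _ _).trans ?_
    rw [abs_mul, abs_of_nonneg hη]
    have := mul_le_of_le_one_left (abs_nonneg (Y - e * r)) hη'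
    linarith
  · refine (mono n).trans ?_
    rw [en]
    refine (abs_add_le _ _).trans ?_
    rw [abs_mul, abs_of_nonneg hζ]
    have := mul_le_of_le_one_left (abs_nonneg (X - e * x)) hζ'
    linarith

lemma abs_gridY_le {s : GridState} (hs : s ∈ gridBox) {C : ℕ} {p : ℤ × ℤ × ℤ}
    (hp : p ∈ gridPoints C) : |gridY s p| ≤ 1 + 2 * C := by
  obtain ⟨-, h0, h1, h2⟩ := mem_gridPoints.1 hp
  obtain ⟨e, m, n⟩ := p
  obtain ⟨η, x, ζ, r⟩ := s
  obtain ⟨⟨-, -, h3, h4⟩, ⟨-, -, h7, h8⟩⟩ := hs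
  have hζ : |ζ| ≤ 1 := abs_le.2 ⟨by have : 0 ≤ ζ := h3; linarith, h7⟩
  have hr : |(e : ℝ) * r| ≤ 1 := by
    rcases h0 with h0 | h0
    · simp only at h0; simp [h0]
    · simp only at h0; simpa [h0] using abs_le.2 ⟨h4, h8⟩
  have hm : |(m : ℝ)| ≤ C := by exact_mod_cast h1
  have hn : |(n : ℝ)| ≤ C := by exact_mod_cast h2
  have : |(m : ℝ) * ζ| ≤ C := by
    rw [abs_mul]
    exact (mul_le_of_le_one_right (abs_nonneg _) hζ).trans hm
  simp only [gridY]
  have := (abs_sub (e * r + n : ℝ) (m * ζ)).trans (add_le_add_left (abs_add_le _ _) _)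
  linarith

lemma Finset.exists_pos_le {ι : Type*} (S : Finset ι) (f : ι → ℝ) (hf : ∀ i ∈ S, 0 < f i) :
    ∃ δ > 0, ∀ i ∈ S, δ ≤ f i := by
  rcases S.eq_empty_or_nonempty with rfl | hS
  · exact ⟨1, one_pos, by simp⟩
  · obtain ⟨i, hi, h⟩ := S.exists_min_image f hS
    exact ⟨f i, hf i hi, h⟩

namespace CodedGrid

variable (G : CodedGrid)

lemma gridNorm_unit (k : ℕ) :
    gridNorm (G.state k) (0, 1, 0) = G.ζ k / (1 + G.η k * G.ζ k) := by
  simp [gridNorm, gridX, gridY, state, abs_of_pos (G.ζ_pos k)]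

lemma gridNorm_unit_le (k : ℕ) : gridNorm (G.state k) (0, 1, 0) ≤ G.ζ k := by
  rw [gridNorm_unit]
  have := mul_nonneg (G.η_nonneg k) (G.ζ_nonneg k)
  exact div_le_self (G.ζ_nonneg k) (by linarith)

lemma unit_mem {C : ℕ} (hC : 1 ≤ C) : ((0, 1, 0) : ℤ × ℤ × ℤ) ∈ gridPoints C := by
  simp [mem_gridPoints]; exact_mod_cast hC

lemma gridMin_le_ζ {C : ℕ} (hC : 1 ≤ C) (k : ℕ) : gridMin C (G.state k) ≤ G.ζ k :=
  (gridMin_le (unit_mem hC)).trans (G.gridNorm_unit_le k)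

lemma ζ_mul_a_le (k : ℕ) : G.ζ k * G.a k ≤ 1 := by
  have h1 := G.ζ_eq k
  have h2 := mul_nonneg (G.ζ_nonneg k) (G.ζ_nonneg (k + 1))
  linarith

lemma a_lt_of_ζ_gt {k : ℕ} {c : ℝ} (hc : 0 < c) (h : c < G.ζ k) : (G.a k : ℝ) < 1 / c := by
  rw [lt_div_iff₀ hc]
  have h1 := G.ζ_mul_a_le k
  have h2 := G.one_le_a' k
  nlinarith

lemma abs_gridX_zero (p : ℤ × ℤ × ℤ) (k : ℕ) :
    |gridX (G.state k) (G.coeff p k)| = G.prodη k * |gridX (G.state 0) p| := by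
  rw [gridX_coeff, abs_mul, abs_of_pos (G.prodη_pos k)]

/-- Every far grid point with a small product has, at some time, a canonical position, and then
its coefficients are bounded. -/
lemma exists_canonical {M : ℕ} (hM : ∀ k, G.a k ≤ M) {p : ℤ × ℤ × ℤ} (hp : p.1 = 0 ∨ p.1 = 1)
    (hN : gridNorm (G.state 0) p ≤ 1) (hX : 1 ≤ |gridX (G.state 0) p|) :
    ∃ k, G.coeff p k ∈ gridPoints (M + 6) ∧ 1 ≤ |gridX (G.state k) (G.coeff p k)| ∧
      |gridX (G.state k) (G.coeff p k)| < G.a k + G.η k := by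
  have hex : ∃ k, |gridX (G.state k) (G.coeff p k)| < 1 := by
    have := G.tendsto_prodη.mul_const |gridX (G.state 0) p|
    rw [zero_mul] at this
    obtain ⟨k, hk⟩ := (this.eventually_lt_const one_pos).exists
    exact ⟨k, by rwa [abs_gridX_zero]⟩
  classical
  obtain ⟨k, hk⟩ : ∃ k, Nat.find hex = k + 1 := by
    refine Nat.exists_eq_succ_of_ne_zero fun h0 => ?_
    have := Nat.find_spec hex
    rw [h0] at this
    exact absurd hX (not_le.2 this)
  have h1 : 1 ≤ |gridX (G.state k) (G.coeff p k)| :=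
    not_lt.1 (Nat.find_min hex (by omega))
  have h2 : |gridX (G.state (k + 1)) (G.coeff p (k + 1))| < 1 := hk ▸ Nat.find_spec hex
  rw [coeff, gridX_next, abs_mul, abs_of_pos (G.η_pos k)] at h2
  have h3 : |gridX (G.state k) (G.coeff p k)| < G.a k + G.η k := by
    have := G.η_succ k
    by_contra! hcon
    have := mul_le_mul_of_nonneg_left hcon (G.η_pos k).le
    linarith
  refine ⟨k, ?_, h1, h3⟩
  -- The product is at most the covolume 1 + ηζ ≤ 2 and |X| ≥ 1. With |X| ≤ M + 1 the coefficients
  -- are then at most (M + 1) + 2 + 3 = M + 6.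
  have hY : |gridY (G.state k) (G.coeff p k)| ≤ 2 := by
    have hd : 0 < 1 + (G.state k).1 * (G.state k).2.2.1 := G.one_add_pos k
    rw [← G.gridNorm_coeff p k, gridNorm, div_le_one hd, abs_mul] at hN
    have t1 : G.η k * G.ζ k ≤ 1 := mul_le_one₀ (G.η_le k) (G.ζ_nonneg k) (G.ζ_le k)
    have t2 := le_mul_of_one_le_left (abs_nonneg (gridY (G.state k) (G.coeff p k))) h1
    exact t2.trans (hN.trans (by simp only [state]; linarith))
  have hX' : |gridX (G.state k) (G.coeff p k)| ≤ M + 1 := by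
    have t1 : (G.a k : ℝ) ≤ M := by exact_mod_cast hM k
    have t2 := G.η_le k
    linarith
  have hf := G.coeff_fst p k
  obtain ⟨b1, b2⟩ := coeff_abs_le_of_coordinates (G.state_mem k) (by rw [hf]; exact hp) hX' hY
  have hM6 : (M : ℝ) + 1 + 2 + 3 = ((M + 6 : ℕ) : ℝ) := by push_cast; ring
  rw [hM6] at b1 b2
  rw [mem_gridPoints]
  refine ⟨?_, by rw [hf]; exact hp, by exact_mod_cast b1, by exact_mod_cast b2⟩
  intro h0
  rw [h0] at h1
  norm_num [gridX] at h1

/-- Before time K the first coordinate has shrunk at most by the factor η₁⋯η_K, so a very far point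
still violates |X| < a + η; far points thus have late canonical times. -/
lemma canonical_time_ge {M : ℕ} (hM : ∀ k, G.a k ≤ M) (K : ℕ) :
    ∃ J : ℝ, 1 ≤ J ∧ ∀ p k, J ≤ |gridX (G.state 0) p| →
      |gridX (G.state k) (G.coeff p k)| < G.a k + G.η k → K ≤ k := by
  refine ⟨max 1 ((M + 1) / G.prodη K), le_max_left _ _, fun p k hJ hk => ?_⟩
  by_contra! hlt
  rw [abs_gridX_zero] at hk
  have h1 : (M + 1) / G.prodη K ≤ |gridX (G.state 0) p| := (le_max_right _ _).trans hJ
  rw [div_le_iff₀ (G.prodη_pos K)] at h1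
  have h2 : G.prodη K ≤ G.prodη k := G.prodη_anti hlt.le
  have h3 : (G.a k : ℝ) ≤ M := by exact_mod_cast hM k
  have h4 := G.η_le k
  have := mul_le_mul_of_nonneg_left h2 (abs_nonneg (gridX (G.state 0) p))
  linarith

/-- Grid points with bounded coefficients at late times are far away at time `0`. -/
lemma far_of_late (h : GridNondegenerate (G.state 0)) (C : ℕ) (J : ℝ) : ∃ k₀, ∀ k ≥ k₀, ∀ p,
    G.coeff p k ∈ gridPoints C → J ≤ |gridX (G.state 0) p| := by
  obtain ⟨D, hD⟩ := exists_nat_ge (J + (1 + 2 * C) + 3)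
  -- Only finitely many points have |X| < J and bounded Y, and none lies on the horizontal axis;
  -- bounded coefficients at a late time force Y at time 0 below their minimum height.
  obtain ⟨δ, hδ, H⟩ := Finset.exists_pos_le (gridPoints D) (fun p => |gridY (G.state 0) p|)
    fun p hp => abs_pos.2 (h p (mem_gridPoints.1 hp).2.1 (mem_gridPoints.1 hp).1)
  have := G.tendsto_prodζ.mul_const ((1 + 2 * C : ℝ))
  rw [zero_mul] at this
  obtain ⟨k₀, hk₀⟩ := eventually_atTop.1 (this.eventually_lt_const hδ)
  refine ⟨k₀, fun k hk p hp => ?_⟩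
  by_contra! hlt
  have hY1 := abs_gridY_le (G.state_mem k) hp
  have hY : |gridY (G.state 0) p| ≤ G.prodζ k * (1 + 2 * C) := by
    rw [G.abs_gridY_coeff p k]
    exact mul_le_mul_of_nonneg_left hY1 (G.prodζ_pos k).le
  have hk1 : G.prodζ k ≤ 1 := by simpa [prodζ] using G.prodζ_anti (Nat.zero_le k)
  have hY' : |gridY (G.state 0) p| ≤ 1 + 2 * C :=
    hY.trans (mul_le_of_le_one_left (by positivity) hk1)
  obtain ⟨m1, m2, m3, m4⟩ := mem_gridPoints.1 hp
  rw [coeff_fst] at m2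
  obtain ⟨b1, b2⟩ := coeff_abs_le_of_coordinates (G.state_mem 0) m2 hlt.le hY'
  have hpD : p ∈ gridPoints D := by
    rw [mem_gridPoints]
    refine ⟨fun h0 => m1 ?_, m2, by exact_mod_cast b1.trans hD, by exact_mod_cast b2.trans hD⟩
    rw [h0, coeff_zero]
  have := H p hpD
  have := hk₀ k hk
  linarith

lemma liminf_le_one {C : ℕ} (hC : 1 ≤ C) {c : ℝ}
    (h : IsLiminf (fun k => gridMin C (G.state k)) c) : c ≤ 1 := by
  refine le_of_forall_pos_lt_add fun ε hε => ?_
  obtain ⟨k, hk⟩ := (h.1 ε hε).exists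
  have := (G.gridMin_le_ζ hC k).trans (G.ζ_le k)
  linarith

/-- Far points and late times correspond: a point realizing the minimum at a late time is far at
time 0, and a far point with product at most 1 enters the minimum at its canonical time. -/
lemma isLiminf_of_isGridLiminf {M C : ℕ} (hM : ∀ k, G.a k ≤ M) (hC : M + 6 ≤ C) {c : ℝ}
    (h : IsGridLiminf (G.state 0) c) (hn : GridNondegenerate (G.state 0)) :
    IsLiminf (fun k => gridMin C (G.state k)) c := by
  constructor
  · intro ε hε
    obtain ⟨J, hJ⟩ := h.1 ε hε
    obtain ⟨k₀, hk₀⟩ := G.far_of_late hn C J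
    filter_upwards [eventually_ge_atTop k₀] with k hk
    obtain ⟨q, hq, e⟩ := exists_gridMin_eq C (G.state k)
    obtain ⟨p, rfl⟩ := G.coeff_surjective k q
    rw [e, gridNorm_coeff]
    refine hJ p ?_ (hk₀ k hk p hq)
    have := (mem_gridPoints.1 hq).2.1
    rwa [coeff_fst] at this
  · intro ε hε
    rw [frequently_atTop]
    intro K
    by_cases hc : 1 < c + ε
    · exact ⟨K, le_rfl, ((G.gridMin_le_ζ (by omega) K).trans (G.ζ_le K)).trans_lt hc⟩
    · obtain ⟨J, hJ1, hJ⟩ := G.canonical_time_ge hM K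
      obtain ⟨p, hp, hX, hN⟩ := h.2 ε hε J
      obtain ⟨k, hk, -, hk2⟩ := G.exists_canonical hM hp (by linarith) (hJ1.trans hX)
      refine ⟨k, hJ p k hX hk2, ?_⟩
      have hk' : G.coeff p k ∈ gridPoints C := by
        obtain ⟨m1, m2, m3, m4⟩ := mem_gridPoints.1 hk
        have : ((M + 6 : ℕ) : ℤ) ≤ C := by exact_mod_cast hC
        exact mem_gridPoints.2 ⟨m1, m2, m3.trans this, m4.trans this⟩
      refine (gridMin_le hk').trans_lt ?_
      rwa [gridNorm_coeff]

/-- A point on the axis stays on it, and its first coordinate tends to 0. Its coefficients then are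
at most 1 + 0 + 3 = 4, and it makes the minimum vanish at all late times. -/
lemma nondegenerate_of_frequently {C : ℕ} (hC : 4 ≤ C)
    (h : ∃ᶠ k in atTop, 0 < gridMin C (G.state k)) : GridNondegenerate (G.state 0) := by
  intro p hp hp0 hY
  have h1 : ∀ᶠ k in atTop, |gridX (G.state k) (G.coeff p k)| < 1 := by
    have := G.tendsto_prodη.mul_const |gridX (G.state 0) p|
    rw [zero_mul] at this
    filter_upwards [this.eventually_lt_const one_pos] with k hk
    rwa [abs_gridX_zero]
  obtain ⟨k, h3, h2⟩ := (h.and_eventually h1).exists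
  have h4 : gridY (G.state k) (G.coeff p k) = 0 := by
    have := G.abs_gridY_coeff p k
    rw [hY, abs_zero, eq_comm, mul_eq_zero] at this
    exact abs_eq_zero.1 (this.resolve_left (G.prodζ_pos k).ne')
  obtain ⟨b1, b2⟩ := coeff_abs_le_of_coordinates (G.state_mem k)
    (by rw [coeff_fst]; exact hp) h2.le (by rw [h4, abs_zero])
  have e : (1 : ℝ) + 0 + 3 ≤ C := by norm_num; exact_mod_cast hC
  have hm : G.coeff p k ∈ gridPoints C := mem_gridPoints.2 ⟨G.coeff_ne_zero hp0 k,
    by rw [coeff_fst]; exact hp, by exact_mod_cast b1.trans e, by exact_mod_cast b2.trans e⟩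
  have := gridMin_le (s := G.state k) hm
  rw [gridNorm, h4, mul_zero, abs_zero, zero_div] at this
  linarith

lemma nondegenerate_of_isLiminf {C : ℕ} (hC : 4 ≤ C) {c : ℝ} (hc : 0 < c)
    (h : IsLiminf (fun k => gridMin C (G.state k)) c) : GridNondegenerate (G.state 0) :=
  G.nondegenerate_of_frequently hC ((h.1 c hc).mono fun k hk => by linarith).frequently

lemma isGridLiminf_of_nondegenerate {M C : ℕ} (hM : ∀ k, G.a k ≤ M) (hC : M + 6 ≤ C) {c : ℝ}
    (hn : GridNondegenerate (G.state 0)) (h : IsLiminf (fun k => gridMin C (G.state k)) c) :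
    IsGridLiminf (G.state 0) c := by
  have hc1 := G.liminf_le_one (by omega) h
  constructor
  · intro ε hε
    obtain ⟨K, hK⟩ := eventually_atTop.1 (h.1 ε hε)
    obtain ⟨J, hJ1, hJ⟩ := G.canonical_time_ge hM K
    refine ⟨J, fun p hp hX => ?_⟩
    by_cases hN : gridNorm (G.state 0) p ≤ 1
    · obtain ⟨k, hk, -, hk2⟩ := G.exists_canonical hM hp hN (hJ1.trans hX)
      have hk' : G.coeff p k ∈ gridPoints C := by
        obtain ⟨m1, m2, m3, m4⟩ := mem_gridPoints.1 hk
        have : ((M + 6 : ℕ) : ℤ) ≤ C := by exact_mod_cast hC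
        exact mem_gridPoints.2 ⟨m1, m2, m3.trans this, m4.trans this⟩
      have := gridMin_le (s := G.state k) hk'
      rw [gridNorm_coeff] at this
      exact (hK k (hJ p k hX hk2)).trans_le this
    · linarith
  · intro ε hε J
    obtain ⟨k₀, hk₀⟩ := G.far_of_late hn C J
    obtain ⟨k, hk, hkε⟩ := frequently_atTop.1 (h.2 ε hε) k₀
    obtain ⟨q, hq, e⟩ := exists_gridMin_eq C (G.state k)
    obtain ⟨p, rfl⟩ := G.coeff_surjective k q
    refine ⟨p, ?_, hk₀ k hk p hq, ?_⟩
    · have := (mem_gridPoints.1 hq).2.1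
      rwa [coeff_fst] at this
    · rw [← G.gridNorm_coeff p k, ← e]
      exact hkε

lemma isGridLiminf_of_isLiminf {M C : ℕ} (hM : ∀ k, G.a k ≤ M) (hC : M + 6 ≤ C) {c : ℝ}
    (hc : 0 < c) (h : IsLiminf (fun k => gridMin C (G.state k)) c) :
    IsGridLiminf (G.state 0) c :=
  G.isGridLiminf_of_nondegenerate hM hC (G.nondegenerate_of_isLiminf (by omega) hc h) h

/-- A lower bound of the lower limit, from the points at their canonical times. -/
lemma le_liminf_of_canonical {M C : ℕ} (hM : ∀ k, G.a k ≤ M) (hC : M + 6 ≤ C) {c d : ℝ} {K : ℕ}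
    (hn : GridNondegenerate (G.state 0)) (h : IsLiminf (fun k => gridMin C (G.state k)) c)
    (hd1 : d ≤ 1) (hd : ∀ k ≥ K, ∀ p ∈ gridPoints (M + 6), 1 ≤ |gridX (G.state k) p| →
      |gridX (G.state k) p| < G.a k + G.η k → d ≤ gridNorm (G.state k) p) : d ≤ c := by
  have hG := G.isGridLiminf_of_nondegenerate hM hC hn h
  refine le_of_forall_pos_lt_add fun ε hε => ?_
  obtain ⟨J, hJ1, hJ⟩ := G.canonical_time_ge hM K
  obtain ⟨p, hp, hX, hN⟩ := hG.2 ε hε J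
  by_cases h1 : gridNorm (G.state 0) p ≤ 1
  · obtain ⟨k, hk, hk1, hk2⟩ := G.exists_canonical hM hp h1 (hJ1.trans hX)
    have := hd k (hJ p k hX hk2) _ hk hk1 hk2
    rw [gridNorm_coeff] at this
    linarith
  · linarith

lemma exists_letter_bound_of_eventually {a : ℕ → ℕ} {B : ℝ} (h : ∀ᶠ k in atTop, (a k : ℝ) < B) :
    ∃ M, ∀ k, a k ≤ M := by
  obtain ⟨N, hN⟩ := eventually_atTop.1 h
  obtain ⟨D, hD⟩ := exists_nat_ge B
  refine ⟨max D ((Finset.range N).sup a), fun k => ?_⟩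
  rcases le_or_gt N k with hk | hk
  · refine le_max_of_le_left ?_
    exact_mod_cast (hN k hk).le.trans hD
  · exact le_max_of_le_right (Finset.le_sup (Finset.mem_range.2 hk))

/-- The basis vector (0,1,0) at time k has product at most ζ_k ≤ 1/a_k, and seen from time 0 it goes
to infinity with k. A large letter would therefore give a small product at a far point. -/
lemma exists_letter_bound_of_isGridLiminf {c : ℝ} (hc : 0 < c)
    (h : IsGridLiminf (G.state 0) c) : ∃ M, ∀ k, G.a k ≤ M := by
  obtain ⟨J, hJ⟩ := h.1 (c / 2) (by linarith)
  refine exists_letter_bound_of_eventually (B := 1 / (c / 2)) ?_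
  have := G.tendsto_prodη.mul_const J
  rw [zero_mul] at this
  filter_upwards [this.eventually_lt_const one_pos] with k hk
  refine G.a_lt_of_ζ_gt (by linarith) (lt_of_lt_of_le ?_ (G.gridNorm_unit_le k))
  obtain ⟨p, hp⟩ := G.coeff_surjective k (0, 1, 0)
  have hX := G.abs_gridX_zero p k
  rw [hp] at hX
  have e1 : gridX (G.state k) (0, 1, 0) = 1 := by simp [gridX]
  rw [e1, abs_one] at hX
  have := hJ p (by rw [← G.coeff_fst p k, hp]; simp) (by
    by_contra! hlt
    have := mul_lt_mul_of_pos_left hlt (G.prodη_pos k)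
    linarith)
  rw [← G.gridNorm_coeff p k, hp] at this
  linarith

lemma eventually_a_lt_of_isLiminf {C : ℕ} (hC : 1 ≤ C) {c d : ℝ} (hd : 0 < d) (hdc : d < c)
    (h : IsLiminf (fun k => gridMin C (G.state k)) c) : ∀ᶠ k in atTop, (G.a k : ℝ) < 1 / d := by
  filter_upwards [h.1 (c - d) (by linarith)] with k hk
  have := G.gridMin_le_ζ hC k
  exact G.a_lt_of_ζ_gt hd (by linarith)

end CodedGrid

/-! ### Existence of coded grids with given letters -/

lemma future_step {a b : ℕ} (ha : 1 ≤ a) (hb : b ≤ a) {ζ r : ℝ} (hζ : 0 ≤ ζ) (hr : -1 ≤ r ∧ -ζ ≤ r)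
    (hr' : r ≤ 1) : 0 < 1 / (a + ζ) ∧ 1 / (a + ζ) ≤ 1 ∧ 1 / (a + ζ) * (a + ζ) = 1 ∧
      -(1 / (a + ζ)) ≤ 1 / (a + ζ) * (b - r) ∧ 1 / (a + ζ) * (b - r) ≤ 1 := by
  have h1 : (1 : ℝ) ≤ a := by exact_mod_cast ha
  have h2 : (b : ℝ) ≤ a := by exact_mod_cast hb
  have h3 : (0 : ℝ) ≤ b := by positivity
  have h4 : (0 : ℝ) < a + ζ := by linarith
  have h5 : 0 < 1 / (a + ζ) := by positivity
  refine ⟨h5, ?_, by field_simp, ?_, ?_⟩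
  · rw [div_le_one h4]; linarith
  · nlinarith
  · rw [one_div, ← div_eq_inv_mul, div_le_one h4]; linarith [hr.2]

namespace CodedGrid

/-- The forward recursion for `η` and `x`, from `0`. -/
noncomputable def pastFrom (a b : ℕ → ℕ) : ℕ → ℝ × ℝ
  | 0 => (0, 0)
  | k + 1 => (1 / (a k + (pastFrom a b k).1),
      1 / (a k + (pastFrom a b k).1) * (b k + (pastFrom a b k).2))

lemma pastFrom_mem {a b : ℕ → ℕ} (ha : ∀ k, 1 ≤ a k) (hb : ∀ k, b k ≤ a k) (k : ℕ) :
    0 ≤ (pastFrom a b k).1 ∧ (pastFrom a b k).1 ≤ 1 ∧ 0 ≤ (pastFrom a b k).2 ∧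
      (pastFrom a b k).2 ≤ 1 + (pastFrom a b k).1 := by
  induction k with
  | zero => simp [pastFrom]
  | succ k ih =>
    obtain ⟨i1, i2, i3, i4⟩ := ih
    have h1 : (1 : ℝ) ≤ a k := by exact_mod_cast ha k
    have h2 : (b k : ℝ) ≤ a k := by exact_mod_cast hb k
    have h4 : (0 : ℝ) < a k + (pastFrom a b k).1 := by linarith
    simp only [pastFrom]
    refine ⟨by positivity, ?_, by positivity, ?_⟩
    · rw [div_le_one h4]; linarith
    · rw [one_div, ← div_eq_inv_mul, ← one_div, div_le_iff₀ h4, add_mul, one_div,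
        inv_mul_cancel₀ h4.ne']
      linarith

/-- The coded grid with given letters and given future coordinates, whose past coordinates
vanish at time `0`. -/
noncomputable def ofFuture (a b : ℕ → ℕ) (ζ r : ℕ → ℝ) (ha : ∀ k, 1 ≤ a k) (hb : ∀ k, b k ≤ a k)
    (hζ : ∀ k, 0 ≤ ζ k) (hζ' : ∀ k, ζ k ≤ 1) (hr : ∀ k, -ζ k ≤ r k) (hr' : ∀ k, r k ≤ 1)
    (eζ : ∀ k, ζ k * (a k + ζ (k + 1)) = 1) (er : ∀ k, r k = ζ k * (b k - r (k + 1))) :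
    CodedGrid where
  a := a
  b := b
  η k := (pastFrom a b k).1
  x k := (pastFrom a b k).2
  ζ := ζ
  r := r
  one_le_a := ha
  b_le_a := hb
  η_nonneg k := (pastFrom_mem ha hb k).1
  η_le k := (pastFrom_mem ha hb k).2.1
  x_nonneg k := (pastFrom_mem ha hb k).2.2.1
  x_le k := (pastFrom_mem ha hb k).2.2.2
  ζ_nonneg := hζ
  ζ_le := hζ'
  r_ge := hr
  r_le := hr'
  η_succ k := by
    have h1 : (1 : ℝ) ≤ a k := by exact_mod_cast ha k
    have h2 := (pastFrom_mem ha hb k).1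
    have h4 : (0 : ℝ) < a k + (pastFrom a b k).1 := by linarith
    simp only [pastFrom]
    field_simp
  x_succ k := rfl
  ζ_eq := eζ
  r_eq := er

variable (G : CodedGrid)

/-- The coded grid with one more letter in front, whose past coordinates vanish at time `0`. -/
noncomputable def cons (a b : ℕ) (ha : 1 ≤ a) (hb : b ≤ a) : CodedGrid :=
  have h := future_step ha hb (G.ζ_nonneg 0)
    ⟨by have := G.r_ge 0; have := G.ζ_le 0; linarith, G.r_ge 0⟩ (G.r_le 0)
  ofFuture (fun k => k.casesOn a G.a) (fun k => k.casesOn b G.b)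
    (fun k => k.casesOn (1 / (a + G.ζ 0)) G.ζ)
    (fun k => k.casesOn (1 / (a + G.ζ 0) * (b - G.r 0)) G.r)
    (fun k => by cases k with | zero => exact ha | succ k => exact G.one_le_a k)
    (fun k => by cases k with | zero => exact hb | succ k => exact G.b_le_a k)
    (fun k => by cases k with | zero => exact h.1.le | succ k => exact G.ζ_nonneg k)
    (fun k => by cases k with | zero => exact h.2.1 | succ k => exact G.ζ_le k)
    (fun k => by cases k with | zero => exact h.2.2.2.1 | succ k => exact G.r_ge k)
    (fun k => by cases k with | zero => exact h.2.2.2.2 | succ k => exact G.r_le k)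
    (fun k => by cases k with | zero => exact h.2.2.1 | succ k => exact G.ζ_eq k)
    (fun k => by cases k with | zero => rfl | succ k => exact G.r_eq k)

lemma cons_ζ_zero (a b : ℕ) (ha : 1 ≤ a) (hb : b ≤ a) :
    (G.cons a b ha hb).ζ 0 * (a + G.ζ 0) = 1 := (G.cons a b ha hb).ζ_eq 0

lemma cons_r_zero (a b : ℕ) (ha : 1 ≤ a) (hb : b ≤ a) :
    (G.cons a b ha hb).r 0 = (G.cons a b ha hb).ζ 0 * (b - G.r 0) := (G.cons a b ha hb).r_eq 0

/-- Every sequence of letters is that of some coded grid. -/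
theorem exists_of_letters (a b : ℕ → ℕ) (ha : ∀ k, 1 ≤ a k) (hb : ∀ k, b k ≤ a k) :
    ∃ G : CodedGrid, G.a = a ∧ G.b = b := by
  -- The future coordinates at time k depend on those at time k+1, so there is no initial value to
  -- iterate from. The solutions of the first K equations form nested nonempty compact sets; a
  -- common point solves all of them.
  let box : Set (ℕ → ℝ × ℝ) := Set.pi Set.univ fun _ => Set.Icc (0, -1) (1, 1)
  let F : ℕ → Set (ℕ → ℝ × ℝ) := fun K => box ∩ ⋂ k ∈ Set.Iio K,
    {f | -(f k).1 ≤ (f k).2 ∧ (f k).1 * (a k + (f (k + 1)).1) = 1 ∧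
      (f k).2 = (f k).1 * (b k - (f (k + 1)).2)}
  have hbox : IsCompact box := isCompact_univ_pi fun _ => isCompact_Icc
  have hclosed : ∀ K, IsClosed (F K) := by
    intro K
    refine hbox.isClosed.inter (isClosed_biInter fun k _ => ?_)
    have c1 : ∀ k, Continuous fun f : ℕ → ℝ × ℝ => (f k).1 := fun k => by fun_prop
    have c2 : ∀ k, Continuous fun f : ℕ → ℝ × ℝ => (f k).2 := fun k => by fun_prop
    exact (isClosed_le (c1 k).neg (c2 k)).inter
      ((isClosed_eq ((c1 k).mul (continuous_const.add (c1 (k + 1)))) continuous_const).inter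
        (isClosed_eq (c2 k) ((c1 k).mul (continuous_const.sub (c2 (k + 1))))))
  have hne : ∀ K, (F K).Nonempty := by
    have : ∀ K (a b : ℕ → ℕ), (∀ k, 1 ≤ a k) → (∀ k, b k ≤ a k) → ∃ f ∈ box, ∀ k,
        -(f k).1 ≤ (f k).2 ∧ (k < K → (f k).1 * (a k + (f (k + 1)).1) = 1 ∧
        (f k).2 = (f k).1 * (b k - (f (k + 1)).2)) := by
      intro K
      induction K with
      | zero =>
        intro a b _ _
        exact ⟨fun _ => (0, 0), fun k _ => ⟨⟨by simp, by simp⟩, ⟨by simp, by simp⟩⟩, by simp⟩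
      | succ K ih =>
        intro a b ha hb
        obtain ⟨f, hf, h⟩ := ih (fun k => a (k + 1)) (fun k => b (k + 1)) (fun k => ha _)
          (fun k => hb _)
        obtain ⟨⟨m1, m2⟩, ⟨m3, m4⟩⟩ := hf 0 trivial
        obtain ⟨s1, s2, s3, s4, s5⟩ := future_step (ha 0) (hb 0) m1 ⟨m2, (h 0).1⟩ m4
        refine ⟨fun k => k.casesOn (1 / (a 0 + (f 0).1), 1 / (a 0 + (f 0).1) * (b 0 - (f 0).2)) f,
          fun k _ => ?_, fun k => ?_⟩
        · cases k with
          | zero => exact ⟨⟨s1.le, (show (-1 : ℝ) ≤ _ by linarith).trans s4⟩, ⟨s2, s5⟩⟩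
          | succ k => exact hf k trivial
        · cases k with
          | zero => exact ⟨s4, fun _ => ⟨s3, rfl⟩⟩
          | succ k => exact ⟨(h k).1, fun hk => (h k).2 (by omega)⟩
    intro K
    obtain ⟨f, hf, h⟩ := this K a b ha hb
    exact ⟨f, hf, Set.mem_iInter₂.2 fun k hk => ⟨(h k).1, (h k).2 hk⟩⟩
  obtain ⟨f, hf⟩ := IsCompact.nonempty_iInter_of_sequence_nonempty_isCompact_isClosed F
    (fun K => Set.inter_subset_inter_right _
      (Set.biInter_subset_biInter_left (Set.Iio_subset_Iio (Nat.le_succ K)))) hne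
    (hbox.of_isClosed_subset (hclosed 0) Set.inter_subset_left) hclosed
  rw [Set.mem_iInter] at hf
  have hm : ∀ k, f k ∈ Set.Icc ((0, -1) : ℝ × ℝ) (1, 1) := fun k => (hf 0).1 k trivial
  have hk : ∀ k, -(f k).1 ≤ (f k).2 ∧ (f k).1 * (a k + (f (k + 1)).1) = 1 ∧
      (f k).2 = (f k).1 * (b k - (f (k + 1)).2) :=
    fun k => Set.mem_iInter₂.1 (hf (k + 1)).2 k (Set.mem_Iio.2 (Nat.lt_succ_self k))
  exact ⟨ofFuture a b (fun k => (f k).1) (fun k => (f k).2) ha hb (fun k => (hm k).1.1)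
    (fun k => (hm k).2.1) (fun k => (hk k).1) (fun k => (hm k).2.2) (fun k => (hk k).2.1)
    (fun k => (hk k).2.2), rfl, rfl⟩

/-! #### The numeration algorithm -/

/-- The first partial quotient. -/
noncomputable def digitA (s : ℝ × ℝ) : ℕ := ⌊1 / s.1⌋₊

/-- The first digit of the shift. -/
noncomputable def digitB (s : ℝ × ℝ) : ℕ := min (digitA s) (⌊s.2 / s.1⌋ + 1).toNat

/-- One step of the numeration algorithm. -/
noncomputable def digitStep (s : ℝ × ℝ) : ℝ × ℝ :=
  (1 / s.1 - digitA s, digitB s - s.2 / s.1)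

/-- The digit b is the least integer above r/ζ, cut off at a. Without the cut-off the new r lies in
(0,1], so a negative r can only follow a digit b = a; and b = 0 only occurs for r < 0. These two
facts give the admissibility rule for consecutive letters. -/
lemma digitStep_spec {s : ℝ × ℝ} (h1 : Irrational s.1) (h2 : 0 < s.1) (h3 : s.1 < 1)
    (h4 : -s.1 ≤ s.2) (h5 : s.2 ≤ 1) :
    Irrational (digitStep s).1 ∧ 0 < (digitStep s).1 ∧ (digitStep s).1 < 1 ∧
      -(digitStep s).1 ≤ (digitStep s).2 ∧ (digitStep s).2 ≤ 1 ∧ 1 ≤ digitA s ∧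
      digitB s ≤ digitA s ∧ (digitB s = 0 → s.2 < 0) ∧
      ((digitStep s).2 < 0 → digitB s = digitA s) := by
  obtain ⟨ζ, r⟩ := s
  simp only at h1 h2 h3 h4 h5
  have hA1 : 1 ≤ digitA (ζ, r) := by
    refine (Nat.one_le_floor_iff _).2 ?_
    rw [le_div_iff₀ h2]; linarith
  have hA2 : (digitA (ζ, r) : ℝ) ≤ 1 / ζ := Nat.floor_le (by positivity)
  have hA3 : 1 / ζ < digitA (ζ, r) + 1 := Nat.lt_floor_add_one _
  have hirr : Irrational (1 / ζ - digitA (ζ, r)) := by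
    rw [one_div]; exact h1.inv.sub_natCast _
  have hpos : 0 < 1 / ζ - digitA (ζ, r) :=
    lt_of_le_of_ne (by linarith) hirr.ne_zero.symm
  have hy1 : -1 ≤ r / ζ := by rw [le_div_iff₀ h2]; linarith
  have hy2 : r / ζ ≤ 1 / ζ := by gcongr
  have hfl : 0 ≤ ⌊r / ζ⌋ + 1 := by
    have : -1 ≤ ⌊r / ζ⌋ := Int.le_floor.2 (by simpa using hy1)
    omega
  have hBle : digitB (ζ, r) ≤ digitA (ζ, r) := min_le_left _ _
  have hf1 := Int.floor_le (r / ζ)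
  have hf2 := Int.lt_floor_add_one (r / ζ)
  have hcast : (((⌊r / ζ⌋ + 1).toNat : ℕ) : ℝ) = (⌊r / ζ⌋ : ℝ) + 1 := by
    have : (((⌊r / ζ⌋ + 1).toNat : ℤ)) = ⌊r / ζ⌋ + 1 := Int.toNat_of_nonneg hfl
    exact_mod_cast this
  refine ⟨hirr, hpos, by simp only [digitStep]; linarith, ?_, ?_, hA1, hBle, ?_, ?_⟩
  · simp only [digitStep]
    rcases le_total (digitA (ζ, r)) (⌊r / ζ⌋ + 1).toNat with h | h
    · rw [show digitB (ζ, r) = digitA (ζ, r) from min_eq_left h]; linarith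
    · rw [show digitB (ζ, r) = (⌊r / ζ⌋ + 1).toNat from min_eq_right h, hcast]; linarith
  · simp only [digitStep]
    have : (digitB (ζ, r) : ℝ) ≤ (⌊r / ζ⌋ : ℝ) + 1 := by
      rw [← hcast]; exact_mod_cast min_le_right _ _
    linarith
  · intro h0
    have : (⌊r / ζ⌋ + 1).toNat = 0 := by
      rcases min_choice (digitA (ζ, r)) (⌊r / ζ⌋ + 1).toNat with h | h
      · have : digitB (ζ, r) = digitA (ζ, r) := h
        omega
      · exact h ▸ h0
    rw [this] at hcast
    have : r / ζ < 0 := by push_cast at hcast; linarith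
    by_contra! hr
    exact absurd (div_nonneg hr h2.le) (not_le.2 this)
  · intro hneg
    rcases min_choice (digitA (ζ, r)) (⌊r / ζ⌋ + 1).toNat with h | h
    · exact h
    · exfalso
      have e : digitB (ζ, r) = (⌊r / ζ⌋ + 1).toNat := h
      simp only [digitStep] at hneg
      rw [e, hcast] at hneg
      linarith

/-- Every pair `(ζ, r)` with irrational `ζ` is the origin of a coded grid with admissible
digits. -/
theorem exists_of_start {ζ r : ℝ} (h1 : Irrational ζ) (h2 : 0 < ζ) (h3 : ζ < 1) (h4 : -ζ ≤ r)
    (h5 : r ≤ 1) : ∃ G : CodedGrid, G.state 0 = (0, 0, ζ, r) ∧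
      (∀ k, G.b (k + 1) = 0 → G.b k = G.a k) ∧ ∀ k, G.b k = 0 → G.r k < 0 := by
  let s : ℕ → ℝ × ℝ := fun k => digitStep^[k] (ζ, r)
  have hs : ∀ k, s (k + 1) = digitStep (s k) := fun k => Function.iterate_succ_apply' _ _ _
  have inv : ∀ k, Irrational (s k).1 ∧ 0 < (s k).1 ∧ (s k).1 < 1 ∧ -(s k).1 ≤ (s k).2 ∧
      (s k).2 ≤ 1 := by
    intro k
    induction k with
    | zero => exact ⟨h1, h2, h3, h4, h5⟩
    | succ k ih =>
      obtain ⟨i1, i2, i3, i4, i5⟩ := ih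
      obtain ⟨j1, j2, j3, j4, j5, -⟩ := digitStep_spec i1 i2 i3 i4 i5
      rw [hs]; exact ⟨j1, j2, j3, j4, j5⟩
  have spec := fun k => digitStep_spec (inv k).1 (inv k).2.1 (inv k).2.2.1 (inv k).2.2.2.1
    (inv k).2.2.2.2
  refine ⟨ofFuture (fun k => digitA (s k)) (fun k => digitB (s k)) (fun k => (s k).1)
    (fun k => (s k).2) (fun k => (spec k).2.2.2.2.2.1) (fun k => (spec k).2.2.2.2.2.2.1)
    (fun k => (inv k).2.1.le) (fun k => (inv k).2.2.1.le) (fun k => (inv k).2.2.2.1)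
    (fun k => (inv k).2.2.2.2) (fun k => ?_) (fun k => ?_), rfl, fun k hk => ?_,
    fun k => (spec k).2.2.2.2.2.2.2.1⟩
  · have := (inv k).2.1
    rw [hs]; simp only [digitStep]; field_simp; ring
  · have := (inv k).2.1
    rw [hs]; simp only [digitStep]; field_simp; ring
  · have h6 := (spec (k + 1)).2.2.2.2.2.2.2.1 hk
    rw [hs] at h6
    exact (spec k).2.2.2.2.2.2.2.2 h6

end CodedGrid

/-! ### The spectrum of coded grids and its normalized representatives -/

/-- The lower limits `c > 0` of the coded grids with bounded letters. -/
def gridSpectrum : Set ℝ :=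
  {c | 0 < c ∧ ∃ (M : ℕ) (G : CodedGrid), (∀ k, G.a k ≤ M) ∧
    IsLiminf (fun k => gridMin (M + 6) (G.state k)) c}

/-- Elements of the spectrum come from grids in a prescribed region. -/
theorem exists_start_of_mem_gridSpectrum {c : ℝ} (h : c ∈ gridSpectrum) : ∃ ζ r : ℝ,
    0 < ζ ∧ ζ < 1 / 2 ∧ 1 - ζ < r ∧ r < 2 * ζ ∧ IsGridLiminf (0, 0, ζ, r) c ∧
      GridNondegenerate (0, 0, ζ, r) := by
  obtain ⟨hc, M, G, hM, hG⟩ := h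
  -- The prefix (2,2)(3,1)(3,1) leaves the lower limit unchanged. The first (3,1) forces r₁ < 1, the
  -- second 0 < r₂ < 1 - ζ₂, and then (2,2) puts (ζ, r) in the required triangle.
  let G₁ := G.cons 3 1 (by norm_num) (by norm_num)
  let G₂ := G₁.cons 3 1 (by norm_num) (by norm_num)
  let G₃ := G₂.cons 2 2 (by norm_num) (by norm_num)
  let M' := max M 3
  have hM3 : ∀ k, G₃.a k ≤ M'
    | 0 => le_max_of_le_right (by norm_num : 2 ≤ 3)
    | 1 => le_max_right M 3
    | 2 => le_max_right M 3
    | k + 3 => le_max_of_le_left (hM k)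
  have hM' : ∀ k, G.a k ≤ M' := fun k => le_max_of_le_left (hM k)
  have hG' : IsLiminf (fun k => gridMin (M' + 6) (G.state k)) c :=
    G.isLiminf_of_isGridLiminf hM' le_rfl (G.isGridLiminf_of_isLiminf hM le_rfl hc hG)
      (G.nondegenerate_of_isLiminf (by omega) hc hG)
  have hG3 : IsLiminf (fun k => gridMin (M' + 6) (G₃.state k)) c :=
    G.isLiminf_of_letters_eventually_eq G₃ (m := 0) (n := 3) hG' fun k => ⟨rfl, rfl⟩
  have hst : G₃.state 0 = (0, 0, G₃.ζ 0, G₃.r 0) := rfl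
  refine ⟨G₃.ζ 0, G₃.r 0, G₃.ζ_pos 0, ?_, ?_, ?_,
    hst ▸ G₃.isGridLiminf_of_isLiminf hM3 le_rfl hc hG3,
    hst ▸ G₃.nondegenerate_of_isLiminf (by omega) hc hG3⟩
  all_goals
    have a1 : G₁.ζ 0 * (3 + G.ζ 0) = 1 := by exact_mod_cast G.cons_ζ_zero 3 1 (by norm_num) (by norm_num)
    have a2 : G₂.ζ 0 * (3 + G₁.ζ 0) = 1 := by exact_mod_cast G₁.cons_ζ_zero 3 1 (by norm_num) (by norm_num)
    have a3 : G₃.ζ 0 * (2 + G₂.ζ 0) = 1 := by exact_mod_cast G₂.cons_ζ_zero 2 2 (by norm_num) (by norm_num)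
    have b1 : G₁.r 0 = G₁.ζ 0 * (1 - G.r 0) := by
      exact_mod_cast G.cons_r_zero 3 1 (by norm_num) (by norm_num)
    have b2 : G₂.r 0 = G₂.ζ 0 * (1 - G₁.r 0) := by
      exact_mod_cast G₁.cons_r_zero 3 1 (by norm_num) (by norm_num)
    have b3 : G₃.r 0 = G₃.ζ 0 * (2 - G₂.r 0) := by
      exact_mod_cast G₂.cons_r_zero 2 2 (by norm_num) (by norm_num)
    have p0 := G.ζ_pos 0
    have p1 := G₁.ζ_pos 0
    have p2 := G₂.ζ_pos 0
    have p3 := G₃.ζ_pos 0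
    have q0 := abs_le.1 (G.r_abs_le 0)
    have q1 := abs_le.1 (G₁.r_abs_le 0)
    have l1 : G₁.ζ 0 < 1 / 3 := by nlinarith
    have u1 : G₁.r 0 < 1 := by rw [b1]; nlinarith
    have u1' : -G₁.ζ 0 ≤ G₁.r 0 := G₁.r_ge 0
    have u2 : 0 < G₂.r 0 := by rw [b2]; exact mul_pos p2 (by linarith)
    have u3 : G₂.r 0 < 1 - G₂.ζ 0 := by rw [b2]; nlinarith
  · nlinarith
  · rw [b3]; nlinarith
  · rw [b3]; nlinarith

/-! ### Windows, gluing and closedness -/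

namespace CodedGrid

/-- The letter at time `k`. -/
def letter (G : CodedGrid) (k : ℕ) : ℕ × ℕ := (G.a k, G.b k)

/-- The letters of `G` around time `k` agree with those of `ω` around `0`, up to distance `K`. -/
def WindowAt (G : CodedGrid) (k K : ℕ) (ω : ℤ → ℕ × ℕ) : Prop :=
  K ≤ k ∧ ∀ r : ℤ, -K ≤ r → r < K → G.letter (k + r).toNat = ω r

variable (G : CodedGrid)

lemma WindowAt.congr {G : CodedGrid} {k K K' : ℕ} {ω ω' : ℤ → ℕ × ℕ} (h : G.WindowAt k K ω)
    (hK : K' ≤ K) (hω : ∀ r : ℤ, -K' ≤ r → r < K' → ω r = ω' r) : G.WindowAt k K' ω' :=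
  ⟨hK.trans h.1, fun r h1 h2 => by rw [h.2 r (by omega) (by omega), hω r h1 h2]⟩

/-- The bi-infinite sequences of letters bounded by `M`. -/
def boundedLetters (M : ℕ) : Set (ℤ → ℕ × ℕ) :=
  Set.pi Set.univ fun _ => {l | l.1 ≤ M ∧ l.2 ≤ M}

lemma isCompact_boundedLetters (M : ℕ) : IsCompact (boundedLetters M) := by
  refine isCompact_univ_pi fun _ => Set.Finite.isCompact ?_
  refine ((Set.finite_Iic M).prod (Set.finite_Iic M)).subset ?_
  rintro ⟨a, b⟩ ⟨h1, h2⟩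
  exact ⟨h1, h2⟩

lemma eventually_eq_of_tendsto {z : ℕ → ℤ → ℕ × ℕ} {ω : ℤ → ℕ × ℕ}
    (h : Tendsto z atTop (𝓝 ω)) (K : ℕ) :
    ∀ᶠ j in atTop, ∀ r : ℤ, -K ≤ r → r < K → z j r = ω r := by
  rw [tendsto_pi_nhds] at h
  have h2 : ∀ r : ℤ, ∀ᶠ j in atTop, z j r = ω r := fun r => by
    have := h r
    rw [nhds_discrete, tendsto_pure] at this
    exact this
  have h3 := (Filter.eventually_all_finset (l := atTop) (p := fun r j => z j r = ω r)
    (Finset.Ico (-K : ℤ) K)).2 fun r _ => h2 r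
  filter_upwards [h3] with j hj r h4 h5
  exact hj r (Finset.mem_Ico.2 ⟨h4, h5⟩)

/-- A property that holds frequently holds frequently with a common window. -/
lemma exists_recurrent_window {M : ℕ} (hM : ∀ k, G.a k ≤ M) {P : ℕ → Prop}
    (hP : ∃ᶠ k in atTop, P k) : ∃ ω ∈ boundedLetters M, ∀ K N : ℕ, ∃ k ≥ N,
      G.WindowAt k K ω ∧ P k := by
  choose k hk hPk using frequently_atTop.1 hP
  -- The sequences recentred at the given times have an accumulation point ω; in a product of
  -- discrete spaces, convergence is eventual equality on every window.
  obtain ⟨ω, hω, ψ, hψ, hlim⟩ := (isCompact_boundedLetters M).tendsto_subseq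
    (x := fun j (r : ℤ) => G.letter ((k j : ℤ) + r).toNat)
    (fun j r _ => ⟨hM _, (G.b_le_a _).trans (hM _)⟩)
  refine ⟨ω, hω, fun K N => ?_⟩
  obtain ⟨j, h1, h2⟩ := ((eventually_eq_of_tendsto hlim K).and
    (eventually_ge_atTop (max K N))).exists
  have h3 : max K N ≤ k (ψ j) := h2.trans ((hψ.id_le j).trans (hk _))
  exact ⟨k (ψ j), (le_max_right _ _).trans h3, ⟨(le_max_left _ _).trans h3, h1⟩, hPk _⟩

lemma drop_isLiminf {C : ℕ} {c : ℝ} (h : IsLiminf (fun k => gridMin C (G.state k)) c) (k₀ : ℕ) :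
    IsLiminf (fun k => gridMin C ((G.drop k₀).state k)) c :=
  h.congr k₀ 0 fun ε hε => Eventually.of_forall fun k => by
    simp [drop_state, add_comm k₀ k, hε]

end CodedGrid

/-- Index of the block that contains the position `n`, for blocks that begin at `t 0 = 0`,
`t 1`, …. -/
lemma exists_block {t : ℕ → ℕ} (ht : StrictMono t) (h0 : t 0 = 0) (n : ℕ) :
    ∃ i, t i ≤ n ∧ n < t (i + 1) := by
  classical
  have hex : ∃ i, n < t (i + 1) := ⟨n, (Nat.lt_succ_self n).trans_le (ht.id_le _)⟩
  refine ⟨Nat.find hex, ?_, Nat.find_spec hex⟩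
  rcases h : Nat.find hex with _ | i
  · omega
  · exact not_lt.1 (Nat.find_min hex (by omega))

lemma block_unique {t : ℕ → ℕ} (ht : StrictMono t) {n i j : ℕ} (h1 : t i ≤ n) (h2 : n < t (i + 1))
    (h3 : t j ≤ n) (h4 : n < t (j + 1)) : i = j := by
  by_contra h
  rcases lt_or_gt_of_ne h with h | h
  · have := ht.monotone (show i + 1 ≤ j from h); omega
  · have := ht.monotone (show j + 1 ≤ i from h); omega

/-- Pieces of coded grids that begin and end with the same windows can be glued. -/
theorem exists_glued (H : ℕ → CodedGrid) (ω : ℤ → ℕ × ℕ) (s e : ℕ → ℕ)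
    (hs : ∀ i, (H i).WindowAt (s i) i ω) (he : ∀ i, (H i).WindowAt (e i) i ω)
    (hse : ∀ i, s i + i + 1 ≤ e i) :
    ∃ (G : CodedGrid) (t : ℕ → ℕ), StrictMono t ∧ t 0 = 0 ∧
      (∀ i, t (i + 1) = t i + (e i - s i)) ∧
      (∀ k, ∃ i j, G.letter k = (H i).letter j) ∧
      ∀ i k, t (i + 1) ≤ k → k < t (i + 2) → i ≤ k ∧ ∀ r < 2 * i,
        G.letter (k - i + r) = (H (i + 1)).letter (s (i + 1) + (k - t (i + 1)) - i + r) := by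
  let t : ℕ → ℕ := fun i => ∑ j ∈ Finset.range i, (e j - s j)
  have htS : ∀ i, t (i + 1) = t i + (e i - s i) := fun i => Finset.sum_range_succ _ _
  have ht : StrictMono t := strictMono_nat_of_lt_succ fun i => by
    rw [htS]; have := hse i; omega
  have h0 : t 0 = 0 := rfl
  choose blk hb1 hb2 using exists_block ht h0
  let L : ℕ → ℕ × ℕ := fun n => (H (blk n)).letter (s (blk n) + (n - t (blk n)))
  obtain ⟨G, hGa, hGb⟩ := CodedGrid.exists_of_letters (fun n => (L n).1) (fun n => (L n).2)
    (fun n => (H _).one_le_a _) (fun n => (H _).b_le_a _)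
  have hG : ∀ n, G.letter n = L n := fun n => by
    simp only [CodedGrid.letter, hGa, hGb]
  have hA : ∀ i r, r < e i - s i → G.letter (t i + r) = (H i).letter (s i + r) := by
    intro i r hr
    have : blk (t i + r) = i :=
      block_unique ht (hb1 _) (hb2 _) (by omega) (by rw [htS]; omega)
    rw [hG]
    simp only [L, this]
    congr 2
    omega
  -- Past the end of block i the glued sequence reads the start of block i+1, which follows ω; so
  -- does `H i` after `e i`. Agreement thus extends i letters beyond the block, and these letters
  -- still lie in block i+1 because it is long enough.
  have hB : ∀ i r, r < e i - s i + i → G.letter (t i + r) = (H i).letter (s i + r) := by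
    intro i r hr
    rcases lt_or_ge r (e i - s i) with h | h
    · exact hA i r h
    · have h1 := hse i; have h2 := hse (i + 1)
      obtain ⟨q, rfl⟩ := Nat.exists_eq_add_of_le h
      have e1 : t i + (e i - s i + q) = t (i + 1) + q := by rw [htS]; omega
      rw [e1, hA (i + 1) q (by omega)]
      have w1 := (hs (i + 1)).2 q (by omega) (by push_cast; omega)
      have w2 := (he i).2 q (by omega) (by omega)
      rw [show ((s (i + 1) : ℤ) + q).toNat = s (i + 1) + q by omega] at w1
      rw [show ((e i : ℤ) + q).toNat = s i + (e i - s i + q) by omega] at w2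
      rw [w1, w2]
  refine ⟨G, t, ht, h0, htS, fun k => ⟨_, _, hG k⟩, fun i k h1 h2 => ?_⟩
  have l1 := hse i; have l2 := hse (i + 1); have l3 := htS i; have l4 := htS (i + 1)
  have l5 := (hs (i + 1)).1
  refine ⟨by omega, fun r hr => ?_⟩
  rcases le_or_gt (t (i + 1)) (k - i + r) with h | h
  · obtain ⟨q, hq⟩ := Nat.exists_eq_add_of_le h
    rw [hq, hB (i + 1) q (by rw [show i + 1 + 1 = i + 2 from rfl] at *; omega)]
    congr 1; omega
  -- Symmetric case: letters just before block i+1 end block i, and both sides read the negative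
  -- half of ω.
  · obtain ⟨q, hq⟩ := Nat.exists_eq_add_of_lt h
    have hqi : q + 1 ≤ i := by omega
    have e1 : k - i + r = t i + (e i - s i - (q + 1)) := by omega
    rw [e1, hA i _ (by omega)]
    have w1 := (hs (i + 1)).2 (-(q + 1)) (by push_cast; omega) (by omega)
    have w2 := (he i).2 (-(q + 1)) (by omega) (by omega)
    rw [show ((s (i + 1) : ℤ) + -(q + 1)).toNat = s (i + 1) + (k - t (i + 1)) - i + r by omega]
      at w1
    rw [show ((e i : ℤ) + -(q + 1)).toNat = s i + (e i - s i - (q + 1)) by omega] at w2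
    rw [w1, w2]

/-- The spectrum is closed in the positive half-line. -/
theorem mem_gridSpectrum_of_tendsto {c : ℕ → ℝ} {d : ℝ} (hc : ∀ i, c i ∈ gridSpectrum)
    (hlim : Tendsto c atTop (𝓝 d)) (hd : 0 < d) : d ∈ gridSpectrum := by
  obtain ⟨M, hMd⟩ := exists_nat_ge (1 / (d / 2))
  -- grids with a common bound for the letters
  have step1 : ∀ i, d / 2 < c i → ∃ G : CodedGrid, (∀ k, G.a k ≤ M) ∧
      IsLiminf (fun k => gridMin (M + 6) (G.state k)) (c i) := by
    intro i hi
    obtain ⟨hci, M', G, hM', hG⟩ := hc i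
    obtain ⟨k₀, hk₀⟩ := eventually_atTop.1
      (G.eventually_a_lt_of_isLiminf (by omega) (by linarith : 0 < d / 2) hi hG)
    have h1 : ∀ k, (G.drop k₀).a k ≤ M := fun k => by
      exact_mod_cast (hk₀ (k₀ + k) (by omega)).le.trans hMd
    have h2 := G.drop_isLiminf hG k₀
    exact ⟨G.drop k₀, h1, (G.drop k₀).isLiminf_of_isGridLiminf h1 le_rfl
      ((G.drop k₀).isGridLiminf_of_isLiminf (fun k => hM' _) le_rfl hci h2)
      ((G.drop k₀).nondegenerate_of_isLiminf (by omega) hci h2)⟩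
  obtain ⟨i₀, hi₀⟩ := eventually_atTop.1 (hlim.eventually_const_lt (by linarith : d / 2 < d))
  have : Nonempty CodedGrid :=
    let ⟨G, _⟩ := CodedGrid.exists_of_letters (fun _ => 1) (fun _ => 1) (by simp) (by simp)
    ⟨G⟩
  choose! G hGM hGc using step1
  -- recurrent windows
  have step2 : ∀ i, ∃ ω ∈ CodedGrid.boundedLetters M, i₀ ≤ i → ∀ K N : ℕ, ∃ k ≥ N,
      (G i).WindowAt k K ω ∧ gridMin (M + 6) ((G i).state k) < c i + 1 / (i + 1) := by
    intro i
    by_cases h : i₀ ≤ i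
    · obtain ⟨ω, h1, h2⟩ := (G i).exists_recurrent_window (hGM i (hi₀ i h))
        ((hGc i (hi₀ i h)).2 (1 / (i + 1)) (by positivity))
      exact ⟨ω, h1, fun _ => h2⟩
    · exact ⟨fun _ => (0, 0), fun _ _ => ⟨Nat.zero_le _, Nat.zero_le _⟩, fun h' => absurd h' h⟩
  choose W hW hWr using step2
  -- Second compactness argument: the recurrent windows belong to different grids, and a limit ω
  -- serves as the common joint for all of them.
  obtain ⟨ω, -, φ, hφ, hφlim⟩ := (CodedGrid.isCompact_boundedLetters M).tendsto_subseq hW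
  have step3 : ∀ i : ℕ, ∃ j, i₀ ≤ j ∧ i ≤ j ∧ ∀ r : ℤ, -i ≤ r → r < i → W j r = ω r := by
    intro i
    obtain ⟨l, h1, h2⟩ := ((CodedGrid.eventually_eq_of_tendsto hφlim i).and
      (eventually_ge_atTop (max i₀ i))).exists
    have := hφ.id_le l
    exact ⟨φ l, by simp only [id] at this; omega, by simp only [id] at this; omega, h1⟩
  choose j hj1 hj2 hj3 using step3
  have step4 : ∀ i, ∃ k₀, ∀ k ≥ k₀,
      c (j i) - 1 / (i + 1) < gridMin (M + 6) ((G (j i)).state k) := fun i =>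
    eventually_atTop.1 ((hGc (j i) (hi₀ _ (hj1 i))).1 (1 / (i + 1)) (by positivity))
  choose k₀ hk₀ using step4
  have step5 : ∀ i N, ∃ k ≥ N, (G (j i)).WindowAt k i ω ∧
      gridMin (M + 6) ((G (j i)).state k) < c (j i) + 1 / (i + 1) := by
    intro i N
    obtain ⟨k, h1, h2, h3⟩ := hWr (j i) (hj1 i) i N
    refine ⟨k, h1, h2.congr le_rfl (hj3 i), h3.trans_le ?_⟩
    have : (1 : ℝ) / (j i + 1) ≤ 1 / (i + 1) := by
      apply one_div_le_one_div_of_le (by positivity)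
      have : (i : ℝ) ≤ j i := by exact_mod_cast hj2 i
      linarith
    linarith
  -- A block starts at an almost optimal time, which gives the upper bound of the lower limit, and
  -- after `k₀ i`, where all minima are almost at least `c (j i)`, which gives the lower bound.
  choose s hs1 hs2 hs3 using fun i => step5 i (k₀ i)
  choose e he1 he2 he3 using fun i => step5 i (s i + i + 1)
  obtain ⟨F, t, ht, ht0, htS, hFl, hF⟩ := exists_glued (fun i => G (j i)) ω s e hs2 he2 he1
  have hFM : ∀ k, F.a k ≤ M := by
    intro k
    obtain ⟨i, l, h⟩ := hFl k
    rw [show F.a k = (G (j i)).a l from congrArg Prod.fst h]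
    exact hGM _ (hi₀ _ (hj1 i)) _
  have hcj : Tendsto (fun i => c (j i)) atTop (𝓝 d) :=
    hlim.comp (tendsto_atTop_mono hj2 tendsto_id)
  have h1i : Tendsto (fun i : ℕ => 1 / ((i + 1 : ℕ) + 1 : ℝ)) atTop (𝓝 0) := by
    have := (tendsto_one_div_add_atTop_nhds_zero_nat (𝕜 := ℝ)).comp (tendsto_add_atTop_nat 1)
    exact this
  have hcj' : Tendsto (fun i => c (j (i + 1))) atTop (𝓝 d) := hcj.comp (tendsto_add_atTop_nat 1)
  have close : ∀ ε > 0, ∃ I, ∀ i ≥ I, ∀ k, t (i + 1) ≤ k → k < t (i + 2) →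
      |gridMin (M + 6) (F.state k) -
        gridMin (M + 6) ((G (j (i + 1))).state (s (i + 1) + (k - t (i + 1))))| < ε := by
    intro ε hε
    obtain ⟨K, hK⟩ := CodedGrid.exists_window (C := M + 6) hε
    refine ⟨K, fun i hi k h1 h2 => ?_⟩
    obtain ⟨hik, h3⟩ := hF i k h1 h2
    have hsi := (hs2 (i + 1)).1
    refine hK F _ k _ (by omega) (by omega) fun r hr => ?_
    have := h3 (i - K + r) (by omega)
    rw [show k - i + (i - K + r) = k - K + r by omega,
      show s (i + 1) + (k - t (i + 1)) - i + (i - K + r) =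
        s (i + 1) + (k - t (i + 1)) - K + r by omega] at this
    exact ⟨congrArg Prod.fst this, congrArg Prod.snd this⟩
  refine ⟨hd, M, F, hFM, fun ε hε => ?_, fun ε hε => ?_⟩
  · obtain ⟨I, hI⟩ := close (ε / 3) (by linarith)
    obtain ⟨I', hI'⟩ := eventually_atTop.1
      ((hcj'.eventually_const_lt (by linarith : d - ε / 3 < d)).and
        (h1i.eventually_lt_const (by linarith : 0 < ε / 3)))
    filter_upwards [eventually_ge_atTop (t (max I I' + 1))] with k hk
    obtain ⟨i, hi1, hi2⟩ := exists_block ht ht0 k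
    have hlt : max I I' + 1 < i + 1 := ht.lt_iff_lt.1 (hk.trans_lt hi2)
    obtain ⟨i, rfl⟩ : ∃ i', i = i' + 1 := ⟨i - 1, by omega⟩
    have h1 := abs_lt.1 (hI i (by omega) k hi1 hi2)
    obtain ⟨h2, h3⟩ := hI' i (by omega)
    have h4 := hk₀ (i + 1) (s (i + 1) + (k - t (i + 1))) (by have := hs1 (i + 1); omega)
    linarith
  · rw [frequently_atTop]
    intro N
    obtain ⟨I, hI⟩ := close (ε / 3) (by linarith)
    obtain ⟨I', hI'⟩ := eventually_atTop.1
      ((hcj'.eventually_lt_const (by linarith : d < d + ε / 3)).and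
        (h1i.eventually_lt_const (by linarith : 0 < ε / 3)))
    set i := max N (max I I')
    refine ⟨t (i + 1), ?_, ?_⟩
    · have := ht.id_le (i + 1)
      simp only [id] at this
      omega
    · have h1 := abs_lt.1 (hI i (by omega) (t (i + 1)) le_rfl (ht (Nat.lt_succ_self _)))
      obtain ⟨h2, h3⟩ := hI' i (by omega)
      have h4 := hs3 (i + 1)
      rw [Nat.sub_self, add_zero] at h1
      linarith

/-! ### Isolation of the largest lower limit: a verified interval search -/

section Search

-- The computation is evaluated by reduction, hence the raw operations on ℕ in place of the
-- overloaded ones.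
local infixl:65 " +ₙ " => Nat.add
local infixl:65 " -ₙ " => Nat.sub
local infixl:70 " *ₙ " => Nat.mul
local infixl:70 " /ₙ " => Nat.div
local infixl:70 " %ₙ " => Nat.mod

/-- Two intervals, in units of `1 / 65536`. -/
structure ItvPair where
  ul : ℕ
  uh : ℕ
  vl : ℕ
  vh : ℕ

/-- The unit of fixed-point numbers. -/
def fixUnit : ℕ := 65536

/-- The minimum, by truncated subtraction. -/
def subMin (a b : ℕ) : ℕ := a -ₙ (a -ₙ b)

/-- Interval version of the recursion for `(η, x)`; the letter `(a, b)` is coded by `5 a + b`. -/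
def pastStep (c : ℕ) (s : ItvPair) : ItvPair :=
  let nl := fixUnit *ₙ fixUnit /ₙ (c /ₙ 5 *ₙ fixUnit +ₙ s.uh)
  let nh := fixUnit *ₙ fixUnit /ₙ (c /ₙ 5 *ₙ fixUnit +ₙ s.ul) +ₙ 1
  ⟨nl, nh, nl *ₙ (c %ₙ 5 *ₙ fixUnit +ₙ s.vl) /ₙ fixUnit,
    subMin (nh *ₙ (c %ₙ 5 *ₙ fixUnit +ₙ s.vh) /ₙ fixUnit +ₙ 1) (fixUnit +ₙ nh)⟩

/-- Interval version of the recursion for `(ζ, r + 1)`. -/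
def futureStep (c : ℕ) (s : ItvPair) : ItvPair :=
  let nl := fixUnit *ₙ fixUnit /ₙ (c /ₙ 5 *ₙ fixUnit +ₙ s.uh)
  let nh := fixUnit *ₙ fixUnit /ₙ (c /ₙ 5 *ₙ fixUnit +ₙ s.ul) +ₙ 1
  -- For b = 0 the new r is -ζr' and not positive, so r + 1 has to be written as a truncated
  -- difference from the unit. This uses r' ≥ 0. For b ≥ 1 everything is added to the unit.
  bif Nat.beq (c %ₙ 5) 0 then
    ⟨nl, nh, fixUnit -ₙ subMin nh (nh *ₙ (s.vh -ₙ fixUnit) /ₙ fixUnit +ₙ 1),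
      fixUnit -ₙ nl *ₙ (s.vl -ₙ fixUnit) /ₙ fixUnit⟩
  else
    ⟨nl, nh, fixUnit +ₙ nl *ₙ ((c %ₙ 5 +ₙ 1) *ₙ fixUnit -ₙ s.vh) /ₙ fixUnit,
      subMin (fixUnit +ₙ nh *ₙ ((c %ₙ 5 +ₙ 1) *ₙ fixUnit -ₙ s.vl) /ₙ fixUnit +ₙ 1)
        (2 *ₙ fixUnit)⟩

/-- The intervals of `(η, x)` after a word of length `i`. -/
def pastItv : ℕ → ℕ → ItvPair
  -- Rounded bounds 1/5 ≤ η ≤ 5/6 and 0 ≤ x ≤ 1 + η ≤ 11/6, valid for letters with a ≤ 4.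
  | 0, _ => ⟨13107, 54614, 0, 120150⟩
  | i + 1, p => pastStep (p %ₙ 32) (pastItv i (p /ₙ 32))

/-- The intervals of `(ζ, r + 1)` before a word of length `j`. -/
def futureItv : ℕ → ℕ → ItvPair
  -- Rounded bounds 1/5 ≤ ζ ≤ 5/6 and 1/6 ≤ 1 - ζ ≤ r + 1 ≤ 2.
  | 0, _ => ⟨13107, 54614, 10922, 131072⟩
  | j + 1, f => futureStep (f /ₙ Nat.pow 32 j) (futureItv j (f %ₙ Nat.pow 32 j))

/-- An upper bound of `|A - B|` for `A ∈ [pl, ph]`, `B ∈ [ql, qh]`. -/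
def absBound (pl ph ql qh : ℕ) : ℕ := (ph -ₙ ql) +ₙ (qh -ₙ pl -ₙ (ph -ₙ ql))

/-- The product at the point `(1, mp - mn, np - nn)` is certainly below `1000 / 4787`. -/
def smallAt (p f : ItvPair) (mp mn np nn : ℕ) : Bool :=
  Nat.blt (4787 *ₙ (absBound (p.vl +ₙ mp *ₙ fixUnit +ₙ np *ₙ p.ul)
      (p.vh +ₙ mp *ₙ fixUnit +ₙ np *ₙ p.uh)
      (mn *ₙ fixUnit +ₙ nn *ₙ p.ul) (mn *ₙ fixUnit +ₙ nn *ₙ p.uh) *ₙ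
    absBound (f.vl +ₙ np *ₙ fixUnit +ₙ mn *ₙ f.ul) (f.vh +ₙ np *ₙ fixUnit +ₙ mn *ₙ f.uh)
      (fixUnit +ₙ nn *ₙ fixUnit +ₙ mp *ₙ f.ul) (fixUnit +ₙ nn *ₙ fixUnit +ₙ mp *ₙ f.uh)))
    (1000 *ₙ (fixUnit *ₙ fixUnit +ₙ p.ul *ₙ f.ul))

/-- The product at one of nine points is certainly below `1000 / 4787`. -/
def excluded (p f : ItvPair) : Bool :=
  -- Eight of the tests concern the translated lattice; the sixth, with product ζ/(1 + ηζ), is the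
  -- lattice vector (0,1,0).
  smallAt p f 0 1 0 1 || smallAt p f 0 0 0 1 || smallAt p f 0 1 0 0 || smallAt p f 0 0 0 0 ||
  smallAt p f 0 2 0 1 ||
  Nat.blt (4787 *ₙ (fixUnit *ₙ f.uh)) (1000 *ₙ (fixUnit *ₙ fixUnit +ₙ p.ul *ₙ f.ul)) ||
  smallAt p f 1 0 0 0 || smallAt p f 0 3 0 1 || smallAt p f 2 0 0 0

/-- Application to an evaluated number. -/
def bindNat {β : Type} (n : ℕ) (f : ℕ → β) : β := Nat.rec (f 0) (fun m _ => f (m +ₙ 1)) n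

/-- The word `w` of length `L`, cut after `i` letters, is excluded. -/
def excludedAt (L i w : ℕ) : Bool :=
  bindNat (w /ₙ Nat.pow 32 (L -ₙ i)) fun p => bindNat (w %ₙ Nat.pow 32 (L -ₙ i)) fun f =>
    excluded (pastItv i p) (futureItv (L -ₙ i) f)

/-- The letters with `1 ≤ a ≤ 4`. -/
def letterCodes : List ℕ := [5, 6, 10, 11, 12, 15, 16, 17, 18, 20, 21, 22, 23, 24]

/-- A bit set that contains the hash values of the elements of a list. -/
def bitsOf (S : List ℕ) : ℕ := S.foldl (fun B w => Nat.lor B (Nat.pow 2 (w %ₙ 262147))) 0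

/-- Admissible pairs of letters. -/
def admissiblePair (c d : ℕ) : Bool := !(Nat.beq (d %ₙ 5) 0) || Nat.beq (c /ₙ 5) (c %ₙ 5)

/-- The words of length `L + 1` that extend the words of length `L` in `S`. -/
def extendWords (L : ℕ) (S : List ℕ) (B : ℕ) : List ℕ :=
  S.flatMap fun w => (letterCodes.map fun l => w *ₙ 32 +ₙ l).filter fun u =>
    admissiblePair (w %ₙ 32) (u %ₙ 32) && Nat.testBit B (u %ₙ Nat.pow 32 L %ₙ 262147) &&
      !excludedAt (L +ₙ 1) ((L +ₙ 1) /ₙ 2) u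

/-- The words of length `L` that can be continued on both sides. -/
def pruneWords (L : ℕ) (S : List ℕ) (B : ℕ) : List ℕ :=
  S.filter fun u =>
    letterCodes.any (fun l => Nat.testBit B ((l *ₙ Nat.pow 32 (L -ₙ 1) +ₙ u /ₙ 32) %ₙ 262147)) &&
    letterCodes.any (fun l => Nat.testBit B ((u %ₙ Nat.pow 32 (L -ₙ 1) *ₙ 32 +ₙ l) %ₙ 262147))

/-- The step from length `L` to length `L + 1`. -/
def levelStep (L : ℕ) (S : List ℕ) : List ℕ :=
  let T := extendWords L S (bitsOf S)
  let T' := pruneWords (L +ₙ 1) T (bitsOf T)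
  pruneWords (L +ₙ 1) T' (bitsOf T')

/-- Several steps. -/
def runLevels : ℕ → ℕ → List ℕ → List ℕ
  | 0, _, S => S
  | n + 1, L, S => runLevels n (L +ₙ 1) (levelStep L S)

/-- The surviving number is 22·(32⁹ - 1)/31, nine digits 22 in base 32, that is the word (4,2)^9. -/
theorem runLevels_eq : runLevels 8 1 letterCodes = [24969554385622] := by decide +kernel

end Search

/-! ### Soundness of the interval arithmetic -/

lemma bindNat_eq {β : Type} (n : ℕ) (f : ℕ → β) : bindNat n f = f n := by
  cases n <;> rfl

lemma subMin_eq (a b : ℕ) : subMin a b = min a b := by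
  simp only [subMin, Nat.sub_eq]; omega

/-- The intervals contain the two numbers. -/
def ItvPair.Contains (s : ItvPair) (u v : ℝ) : Prop :=
  s.ul ≤ 65536 * u ∧ 65536 * u ≤ s.uh ∧ s.vl ≤ 65536 * v ∧ 65536 * v ≤ s.vh

lemma natDiv_le {m n : ℕ} {y : ℝ} (hn : 0 < n) (h : (m : ℝ) ≤ y * n) : ((m / n : ℕ) : ℝ) ≤ y := by
  have : ((m / n : ℕ) : ℝ) ≤ m / n := Nat.cast_div_le
  refine this.trans ?_
  rwa [div_le_iff₀ (by exact_mod_cast hn)]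

lemma le_natDiv_succ {m n : ℕ} {y : ℝ} (hn : 0 < n) (h : y * n ≤ m) :
    y ≤ ((m / n + 1 : ℕ) : ℝ) := by
  have h1 : m < n * (m / n + 1) := Nat.lt_mul_div_succ m hn
  have h2 : (m : ℝ) < n * ((m / n + 1 : ℕ) : ℝ) := by exact_mod_cast h1
  have h3 : (0 : ℝ) < n := by exact_mod_cast hn
  nlinarith

lemma natSub_le {m n : ℕ} {y : ℝ} (h0 : 0 ≤ y) (h : (m : ℝ) ≤ y + n) : ((m - n : ℕ) : ℝ) ≤ y := by
  rcases le_total n m with h1 | h1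
  · rw [Nat.cast_sub h1]; linarith
  · rw [Nat.sub_eq_zero_of_le h1]; simpa using h0

lemma le_natSub {m n : ℕ} {y : ℝ} (h : y + n ≤ m) : y ≤ ((m - n : ℕ) : ℝ) := by
  have h1 : m ≤ m - n + n := by omega
  have : (m : ℝ) ≤ ((m - n : ℕ) : ℝ) + n := by exact_mod_cast h1
  linarith

lemma inv_bounds {s : ItvPair} {a : ℕ} {u v u' : ℝ} (h : s.Contains u v) (ha : 1 ≤ a)
    (hu' : 0 ≤ u') (hu : u' * (a + u) = 1) :
    ((65536 * 65536 / (a * 65536 + s.uh) : ℕ) : ℝ) ≤ 65536 * u' ∧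
      65536 * u' ≤ ((65536 * 65536 / (a * 65536 + s.ul) + 1 : ℕ) : ℝ) := by
  obtain ⟨h1, h2, -, -⟩ := h
  constructor
  · refine natDiv_le (by omega) ?_
    push_cast
    nlinarith
  · refine le_natDiv_succ (by omega) ?_
    push_cast
    nlinarith

lemma pastStep_eq (c : ℕ) (s : ItvPair) : pastStep c s =
    ⟨fixUnit * fixUnit / (c / 5 * fixUnit + s.uh), fixUnit * fixUnit / (c / 5 * fixUnit + s.ul) + 1,
      fixUnit * fixUnit / (c / 5 * fixUnit + s.uh) * (c % 5 * fixUnit + s.vl) / fixUnit,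
      subMin ((fixUnit * fixUnit / (c / 5 * fixUnit + s.ul) + 1) * (c % 5 * fixUnit + s.vh) /
        fixUnit + 1) (fixUnit + (fixUnit * fixUnit / (c / 5 * fixUnit + s.ul) + 1))⟩ := rfl

lemma futureStep_eq_of_eq (c : ℕ) (s : ItvPair) (h : c % 5 = 0) : futureStep c s =
    ⟨fixUnit * fixUnit / (c / 5 * fixUnit + s.uh), fixUnit * fixUnit / (c / 5 * fixUnit + s.ul) + 1,
      fixUnit - subMin (fixUnit * fixUnit / (c / 5 * fixUnit + s.ul) + 1)
        ((fixUnit * fixUnit / (c / 5 * fixUnit + s.ul) + 1) * (s.vh - fixUnit) / fixUnit + 1),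
      fixUnit - fixUnit * fixUnit / (c / 5 * fixUnit + s.uh) * (s.vl - fixUnit) / fixUnit⟩ := by
  have : Nat.beq (Nat.mod c 5) 0 = true := by
    rw [show Nat.mod c 5 = 0 from h]; rfl
  rw [futureStep, this]
  rfl

lemma futureStep_eq_of_ne (c : ℕ) (s : ItvPair) (h : c % 5 ≠ 0) : futureStep c s =
    ⟨fixUnit * fixUnit / (c / 5 * fixUnit + s.uh), fixUnit * fixUnit / (c / 5 * fixUnit + s.ul) + 1,
      fixUnit + fixUnit * fixUnit / (c / 5 * fixUnit + s.uh) *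
        ((c % 5 + 1) * fixUnit - s.vh) / fixUnit,
      subMin (fixUnit + (fixUnit * fixUnit / (c / 5 * fixUnit + s.ul) + 1) *
        ((c % 5 + 1) * fixUnit - s.vl) / fixUnit + 1) (2 * fixUnit)⟩ := by
  have : Nat.beq (Nat.mod c 5) 0 = false := by
    rw [Bool.eq_false_iff]
    exact fun h' => h (Nat.eq_of_beq_eq_true h')
  rw [futureStep, this]
  rfl

lemma pastStep_contains {s : ItvPair} {a b : ℕ} {η x η' x' : ℝ} (h : s.Contains η x) (ha : 1 ≤ a)
    (hb : b < 5) (hx : 0 ≤ x) (hη' : 0 ≤ η') (e1 : η' * (a + η) = 1) (e2 : x' = η' * (b + x))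
    (hx' : x' ≤ 1 + η') : (pastStep (5 * a + b) s).Contains η' x' := by
  have hi := inv_bounds h ha hη' e1
  obtain ⟨h1, h2, h3, h4⟩ := h
  have d1 : (5 * a + b) / 5 = a := by omega
  have d2 : (5 * a + b) % 5 = b := by omega
  have e : pastStep (5 * a + b) s = ⟨65536 * 65536 / (a * 65536 + s.uh),
      65536 * 65536 / (a * 65536 + s.ul) + 1,
      65536 * 65536 / (a * 65536 + s.uh) * (b * 65536 + s.vl) / 65536,
      min ((65536 * 65536 / (a * 65536 + s.ul) + 1) * (b * 65536 + s.vh) / 65536 + 1)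
        (65536 + (65536 * 65536 / (a * 65536 + s.ul) + 1))⟩ := by
    rw [pastStep_eq, d1, d2, subMin_eq, fixUnit]
  rw [e]
  refine ⟨hi.1, hi.2, natDiv_le (by norm_num) ?_, ?_⟩
  · push_cast
    have : (0 : ℝ) ≤ b * 65536 + s.vl := by positivity
    calc _ ≤ 65536 * η' * (b * 65536 + s.vl) := mul_le_mul_of_nonneg_right hi.1 this
      _ ≤ _ := by rw [e2]; nlinarith
  · rw [Nat.cast_min]
    refine le_min (le_natDiv_succ (by norm_num) ?_) ?_
    · push_cast
      have h5 := hi.2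
      push_cast at h5
      calc _ = 65536 * η' * (b * 65536 + 65536 * x) := by rw [e2]; ring
        _ ≤ _ := mul_le_mul h5 (by linarith) (by positivity) (by positivity)
    · have h5 := hi.2
      push_cast at h5 ⊢
      linarith

/-- The last hypothesis is where admissibility enters: a digit 0 is only produced when r < 0, and
then r = -ζr' forces r' > 0. -/
lemma futureStep_contains {s : ItvPair} {a b : ℕ} {ζ r ζ' r' : ℝ} (h : s.Contains ζ' (r' + 1))
    (ha : 1 ≤ a) (hb : b < 5) (hζ : 0 ≤ ζ) (hζ1 : ζ ≤ 1) (e1 : ζ * (a + ζ') = 1)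
    (e2 : r = ζ * (b - r')) (hr' : r' ≤ 1) (hr : r ≤ 1) (h0 : b = 0 → 0 ≤ r') :
    (futureStep (5 * a + b) s).Contains ζ (r + 1) := by
  have hi := inv_bounds h ha hζ e1
  obtain ⟨h1, h2, h3, h4⟩ := h
  have d1 : (5 * a + b) / 5 = a := by omega
  have d2 : (5 * a + b) % 5 = b := by omega
  have hi2 := hi.2
  push_cast at hi2
  rcases Nat.eq_zero_or_pos b with hb0 | hb0
  · subst hb0
    have hr0 := h0 rfl
    have e : futureStep (5 * a + 0) s = ⟨65536 * 65536 / (a * 65536 + s.uh),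
        65536 * 65536 / (a * 65536 + s.ul) + 1,
        65536 - min (65536 * 65536 / (a * 65536 + s.ul) + 1)
          ((65536 * 65536 / (a * 65536 + s.ul) + 1) * (s.vh - 65536) / 65536 + 1),
        65536 - 65536 * 65536 / (a * 65536 + s.uh) * (s.vl - 65536) / 65536⟩ := by
      rw [futureStep_eq_of_eq _ _ d2, d1, subMin_eq, fixUnit]
    rw [e]
    refine ⟨hi.1, hi.2, natSub_le ?_ ?_, le_natSub ?_⟩
    · rw [e2]; push_cast; nlinarith
    · have : 65536 * (ζ * r') ≤ ((min (65536 * 65536 / (a * 65536 + s.ul) + 1)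
          ((65536 * 65536 / (a * 65536 + s.ul) + 1) * (s.vh - 65536) / 65536 + 1) : ℕ) : ℝ) := by
        rw [Nat.cast_min]
        refine le_min ?_ (le_natDiv_succ (by norm_num) ?_)
        · push_cast; nlinarith
        · have h5 : 65536 * r' ≤ ((s.vh - 65536 : ℕ) : ℝ) := le_natSub (by push_cast; linarith)
          push_cast
          calc _ = 65536 * ζ * (65536 * r') := by ring
            _ ≤ _ := mul_le_mul hi2 h5 (by linarith) (by linarith)
      rw [e2]; push_cast at this ⊢; linarith
    · have : ((65536 * 65536 / (a * 65536 + s.uh) * (s.vl - 65536) / 65536 : ℕ) : ℝ) ≤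
          65536 * (ζ * r') := by
        refine natDiv_le (by norm_num) ?_
        have h5 : ((s.vl - 65536 : ℕ) : ℝ) ≤ 65536 * r' :=
          natSub_le (by positivity) (by push_cast; linarith)
        rw [Nat.cast_mul]
        calc _ ≤ 65536 * ζ * (65536 * r') := mul_le_mul hi.1 h5 (Nat.cast_nonneg _) (by positivity)
          _ = _ := by push_cast; ring
      rw [e2]; push_cast at this ⊢; linarith
  · have e : futureStep (5 * a + b) s = ⟨65536 * 65536 / (a * 65536 + s.uh),
        65536 * 65536 / (a * 65536 + s.ul) + 1,
        65536 + 65536 * 65536 / (a * 65536 + s.uh) * ((b + 1) * 65536 - s.vh) / 65536,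
        min (65536 + (65536 * 65536 / (a * 65536 + s.ul) + 1) *
          ((b + 1) * 65536 - s.vl) / 65536 + 1) (2 * 65536)⟩ := by
      rw [futureStep_eq_of_ne _ _ (by omega), d1, d2, subMin_eq, fixUnit]
    have hb1 : (1 : ℝ) ≤ b := by exact_mod_cast hb0
    rw [e]
    refine ⟨hi.1, hi.2, ?_, ?_⟩
    · have : ((65536 * 65536 / (a * 65536 + s.uh) * ((b + 1) * 65536 - s.vh) / 65536 : ℕ) : ℝ) ≤
          65536 * (ζ * (b - r')) := by
        refine natDiv_le (by norm_num) ?_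
        have h5 : (((b + 1) * 65536 - s.vh : ℕ) : ℝ) ≤ 65536 * (b - r') :=
          natSub_le (by linarith) (by push_cast; linarith)
        rw [Nat.cast_mul]
        calc _ ≤ 65536 * ζ * (65536 * (b - r')) :=
              mul_le_mul hi.1 h5 (Nat.cast_nonneg _) (by positivity)
          _ = _ := by push_cast; ring
      rw [e2, Nat.cast_add]; push_cast at this ⊢; linarith
    · rw [Nat.cast_min]
      refine le_min ?_ ?_
      · have : 65536 * (ζ * (b - r')) ≤ (((65536 * 65536 / (a * 65536 + s.ul) + 1) *
            ((b + 1) * 65536 - s.vl) / 65536 + 1 : ℕ) : ℝ) := by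
          refine le_natDiv_succ (by norm_num) ?_
          have h5 : 65536 * (b - r') ≤ (((b + 1) * 65536 - s.vl : ℕ) : ℝ) :=
            le_natSub (by push_cast; linarith)
          rw [Nat.cast_mul]
          calc _ = 65536 * ζ * (65536 * (b - r')) := by push_cast; ring
            _ ≤ _ := mul_le_mul hi.2 h5 (by linarith) (by positivity)
        rw [e2, add_assoc, Nat.cast_add]; push_cast at this ⊢; linarith
      · push_cast; linarith

lemma absBound_spec {pl ph ql qh : ℕ} {A B : ℝ} (h1 : pl ≤ A) (h2 : A ≤ ph) (h3 : ql ≤ B)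
    (h4 : B ≤ qh) : |A - B| ≤ absBound pl ph ql qh := by
  have e : absBound pl ph ql qh = (ph - ql) + (qh - pl - (ph - ql)) := rfl
  have h5 : (ph : ℝ) ≤ absBound pl ph ql qh + ql := by
    rw [e]; exact_mod_cast (by omega)
  have h6 : (qh : ℝ) ≤ absBound pl ph ql qh + pl := by
    rw [e]; exact_mod_cast (by omega)
  rw [abs_le]
  constructor <;> linarith

lemma gridNorm_lt_iff {s : GridState} (hs : 0 < 1 + s.1 * s.2.2.1) (p : ℤ × ℤ × ℤ) (d : ℝ) :
    gridNorm s p < d ↔ |gridX s p| * |gridY s p| < d * (1 + s.1 * s.2.2.1) := by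
  rw [gridNorm, div_lt_iff₀ hs, abs_mul]

lemma gridNorm_lt_of_smallAt {p f : ItvPair} {η x ζ r : ℝ} (hp : p.Contains η x)
    (hf : f.Contains ζ (r + 1)) (hη : 0 ≤ η) (hζ : 0 ≤ ζ) {mp mn np nn : ℕ}
    (h : smallAt p f mp mn np nn = true) :
    gridNorm (η, x, ζ, r) (1, (mp : ℤ) - mn, (np : ℤ) - nn) < 1000 / 4787 := by
  obtain ⟨p1, p2, p3, p4⟩ := hp
  obtain ⟨f1, f2, f3, f4⟩ := hf
  have h' : 4787 * (absBound (p.vl + mp * 65536 + np * p.ul) (p.vh + mp * 65536 + np * p.uh)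
      (mn * 65536 + nn * p.ul) (mn * 65536 + nn * p.uh) *
    absBound (f.vl + np * 65536 + mn * f.ul) (f.vh + np * 65536 + mn * f.uh)
      (65536 + nn * 65536 + mp * f.ul) (65536 + nn * 65536 + mp * f.uh)) <
    1000 * (65536 * 65536 + p.ul * f.ul) := by
    exact Nat.le_of_ble_eq_true h
  have h1 : |(65536 * x + mp * 65536 + np * (65536 * η)) - (mn * 65536 + nn * (65536 * η))| ≤
      absBound (p.vl + mp * 65536 + np * p.ul) (p.vh + mp * 65536 + np * p.uh)
      (mn * 65536 + nn * p.ul) (mn * 65536 + nn * p.uh) := by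
    apply absBound_spec <;> push_cast <;> gcongr
  have h2 : |(65536 * (r + 1) + np * 65536 + mn * (65536 * ζ)) -
      (65536 + nn * 65536 + mp * (65536 * ζ))| ≤
      absBound (f.vl + np * 65536 + mn * f.ul) (f.vh + np * 65536 + mn * f.uh)
      (65536 + nn * 65536 + mp * f.ul) (65536 + nn * 65536 + mp * f.uh) := by
    apply absBound_spec <;> push_cast <;> gcongr
  have e1 : (65536 * x + mp * 65536 + np * (65536 * η)) - (mn * 65536 + nn * (65536 * η)) =
      65536 * gridX (η, x, ζ, r) (1, (mp : ℤ) - mn, (np : ℤ) - nn) := by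
    simp only [gridX]; push_cast; ring
  have e2 : (65536 * (r + 1) + np * 65536 + mn * (65536 * ζ)) -
      (65536 + nn * 65536 + mp * (65536 * ζ)) =
      65536 * gridY (η, x, ζ, r) (1, (mp : ℤ) - mn, (np : ℤ) - nn) := by
    simp only [gridY]; push_cast; ring
  rw [e1, abs_mul, abs_of_pos (by norm_num : (0 : ℝ) < 65536)] at h1
  rw [e2, abs_mul, abs_of_pos (by norm_num : (0 : ℝ) < 65536)] at h2
  have h3 := mul_le_mul h1 h2 (by positivity) (by positivity)
  have h4 : (p.ul : ℝ) * f.ul ≤ 65536 * η * (65536 * ζ) :=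
    mul_le_mul p1 f1 (by positivity) (by positivity)
  have h5 : (4787 : ℝ) * ((absBound (p.vl + mp * 65536 + np * p.ul) (p.vh + mp * 65536 + np * p.uh)
      (mn * 65536 + nn * p.ul) (mn * 65536 + nn * p.uh) : ℝ) *
    absBound (f.vl + np * 65536 + mn * f.ul) (f.vh + np * 65536 + mn * f.uh)
      (65536 + nn * 65536 + mp * f.ul) (65536 + nn * 65536 + mp * f.uh)) <
    1000 * (65536 * 65536 + p.ul * f.ul) := by exact_mod_cast h'
  have : 0 < 1 + η * ζ := by positivity
  rw [gridNorm_lt_iff this]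
  simp only
  nlinarith

lemma exists_lt_of_excluded {p f : ItvPair} {η x ζ r : ℝ} (hp : p.Contains η x)
    (hf : f.Contains ζ (r + 1)) (hη : 0 ≤ η) (hζ : 0 ≤ ζ) (h : excluded p f = true) :
    ∃ q ∈ gridPoints 3, gridNorm (η, x, ζ, r) q < 1000 / 4787 := by
  simp only [excluded, Bool.or_eq_true] at h
  have key : ∀ mp mn np nn : ℕ, smallAt p f mp mn np nn = true → mp ≤ 3 → mn ≤ 3 → np ≤ 3 →
      nn ≤ 3 → ∃ q ∈ gridPoints 3, gridNorm (η, x, ζ, r) q < 1000 / 4787 := by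
    intro mp mn np nn h h1 h2 h3 h4
    refine ⟨_, ?_, gridNorm_lt_of_smallAt hp hf hη hζ h⟩
    rw [mem_gridPoints]
    refine ⟨by simp, Or.inr rfl, ?_, ?_⟩ <;> simp only [abs_le] <;> omega
  rcases h with (((((((h | h) | h) | h) | h) | h) | h) | h) | h
  on_goal 6 =>
    refine ⟨(0, 1, 0), by simp [mem_gridPoints], ?_⟩
    have h' : 4787 * (65536 * f.uh) < 1000 * (65536 * 65536 + p.ul * f.ul) :=
      Nat.le_of_ble_eq_true h
    have h'' : (4787 : ℝ) * (65536 * f.uh) < 1000 * (65536 * 65536 + p.ul * f.ul) := by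
      exact_mod_cast h'
    have h4 : (p.ul : ℝ) * f.ul ≤ 65536 * η * (65536 * ζ) :=
      mul_le_mul hp.1 hf.1 (by positivity) (by positivity)
    have h5 := hf.2.1
    have : 0 < 1 + η * ζ := by positivity
    rw [gridNorm_lt_iff this]
    simp only [gridX, gridY]
    norm_num
    rw [abs_of_nonneg hζ]
    linarith
  all_goals exact key _ _ _ _ h (by norm_num) (by norm_num) (by norm_num) (by norm_num)

/-! #### Codes of words -/

/-- The code in base `32` of the word `c_k ⋯ c_{k+L-1}`. -/
def wordCode (c : ℕ → ℕ) (k : ℕ) : ℕ → ℕ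
  | 0 => 0
  | L + 1 => wordCode c k L * 32 + c (k + L)

section
variable {c : ℕ → ℕ} (hc : ∀ k, c k < 32)
include hc

lemma wordCode_lt (k L : ℕ) : wordCode c k L < 32 ^ L := by
  induction L with
  | zero => simp [wordCode]
  | succ L ih => have := hc (k + L); rw [wordCode, pow_succ]; omega

omit hc in
lemma wordCode_add (k i j : ℕ) :
    wordCode c k (i + j) = wordCode c k i * 32 ^ j + wordCode c (k + i) j := by
  induction j with
  | zero => simp [wordCode]
  | succ j ih => rw [← add_assoc, wordCode, ih, wordCode, pow_succ, ← add_assoc]; ring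

lemma wordCode_div (k i j : ℕ) : wordCode c k (i + j) / 32 ^ j = wordCode c k i := by
  rw [wordCode_add, Nat.add_comm, Nat.add_mul_div_right _ _ (by positivity),
    Nat.div_eq_of_lt (wordCode_lt hc _ _), zero_add]

lemma wordCode_mod (k i j : ℕ) : wordCode c k (i + j) % 32 ^ j = wordCode c (k + i) j := by
  rw [wordCode_add, Nat.add_comm, Nat.add_mul_mod_self_right, Nat.mod_eq_of_lt (wordCode_lt hc _ _)]

end

lemma foldl_testBit (S : List ℕ) (B i : ℕ) (h : Nat.testBit B i = true ∨ ∃ w ∈ S, w % 262147 = i) :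
    Nat.testBit (S.foldl (fun B w => Nat.lor B (Nat.pow 2 (Nat.mod w 262147))) B) i = true := by
  induction S generalizing B with
  | nil => simpa using h
  | cons v S ih =>
    rw [List.foldl_cons]
    apply ih
    have e : Nat.testBit (Nat.lor B (Nat.pow 2 (Nat.mod v 262147))) i =
        (Nat.testBit B i || Nat.testBit (2 ^ (v % 262147)) i) := Nat.testBit_or ..
    rw [e]
    rcases h with h | ⟨w, hw, h⟩
    · simp [h]
    · rcases List.mem_cons.1 hw with rfl | hw
      · left; rw [h, Nat.testBit_two_pow_self, Bool.or_true]
      · exact Or.inr ⟨w, hw, h⟩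

/-- Only this implication is needed: a collision of hash values can keep a superfluous word but
never discards a valid one. -/
lemma testBit_bitsOf {S : List ℕ} {w : ℕ} (h : w ∈ S) :
    Nat.testBit (bitsOf S) (w % 262147) = true := foldl_testBit S 0 _ (Or.inr ⟨w, h, rfl⟩)

section
variable {c : ℕ → ℕ} (hl : ∀ k, c k ∈ letterCodes)
include hl

omit hl in
lemma letterCodes_lt {l : ℕ} (h : l ∈ letterCodes) : l < 32 := by
  simp only [letterCodes, List.mem_cons, List.not_mem_nil, or_false] at h
  omega

/-- Every factor of the actual sequence has both neighbours among the factors, except possibly the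
first one; hence the loss of one unit in the starting time. -/
lemma wordCode_mem_prune {L K : ℕ} (hL : 1 ≤ L) {S : List ℕ} (h : ∀ k ≥ K, wordCode c k L ∈ S) :
    ∀ k ≥ K + 1, wordCode c k L ∈ pruneWords L S (bitsOf S) := by
  have hc : ∀ k, c k < 32 := fun k => letterCodes_lt (hl k)
  intro k hk
  obtain ⟨L, rfl⟩ : ∃ M, L = M + 1 := ⟨L - 1, by omega⟩
  rw [pruneWords, List.mem_filter]
  refine ⟨h k (by omega), ?_⟩
  rw [Bool.and_eq_true, List.any_eq_true, List.any_eq_true]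
  refine ⟨⟨c (k - 1), hl _, ?_⟩, ⟨c (k + L + 1), hl _, ?_⟩⟩
  · have e : c (k - 1) * 32 ^ L + wordCode c k (L + 1) / 32 = wordCode c (k - 1) (1 + L) := by
      rw [wordCode_add (k - 1), show k - 1 + 1 = k by omega]
      have := wordCode_div hc k L 1
      rw [pow_one] at this
      rw [this]; simp [wordCode]
    have := testBit_bitsOf (h (k - 1) (by omega))
    rw [add_comm, ← e] at this
    exact this
  · have e : wordCode c k (L + 1) % 32 ^ L * 32 + c (k + L + 1) = wordCode c (k + 1) (L + 1) := by
      have := wordCode_mod hc k 1 L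
      rw [add_comm 1 L] at this
      rw [this, wordCode, show k + 1 + L = k + L + 1 by ring]
    have := testBit_bitsOf (h (k + 1) (by omega))
    rw [← e] at this
    exact this

lemma wordCode_mem_extend {L K : ℕ} (hL : 1 ≤ L) {S : List ℕ} (h : ∀ k ≥ K, wordCode c k L ∈ S)
    (hadm : ∀ k ≥ K, admissiblePair (c k) (c (k + 1)) = true)
    (hex : ∀ i j, ∀ k ≥ K, excluded (pastItv i (wordCode c k i))
      (futureItv j (wordCode c (k + i) j)) = false) :
    ∀ k ≥ K, wordCode c k (L + 1) ∈ extendWords L S (bitsOf S) := by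
  have hc : ∀ k, c k < 32 := fun k => letterCodes_lt (hl k)
  intro k hk
  rw [extendWords, List.mem_flatMap]
  refine ⟨wordCode c k L, h k hk, ?_⟩
  rw [List.mem_filter]
  refine ⟨List.mem_map.2 ⟨c (k + L), hl _, rfl⟩, ?_⟩
  obtain ⟨M, rfl⟩ : ∃ M, L = M + 1 := ⟨L - 1, by omega⟩
  have e1 : wordCode c k (M + 1) % 32 = c (k + M) := by
    have := wordCode_mod hc k M 1
    rw [pow_one] at this; rw [this]; simp [wordCode]
  have e2 : wordCode c k (M + 1 + 1) % 32 = c (k + M + 1) := by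
    have := wordCode_mod hc k (M + 1) 1
    rw [pow_one] at this; rw [this]; simp [wordCode, add_assoc]
  have e3 : wordCode c k (M + 1 + 1) % 32 ^ (M + 1) = wordCode c (k + 1) (M + 1) := by
    rw [add_comm (M + 1) 1, wordCode_mod hc]
  rw [Bool.and_eq_true, Bool.and_eq_true]
  refine ⟨⟨?_, ?_⟩, ?_⟩
  · change admissiblePair (wordCode c k (M + 1) % 32) (wordCode c k (M + 1 + 1) % 32) = true
    rw [e1, e2]; exact hadm _ (by omega)
  · change Nat.testBit (bitsOf S) (wordCode c k (M + 1 + 1) % 32 ^ (M + 1) % 262147) = true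
    rw [e3]; exact testBit_bitsOf (h _ (by omega))
  -- The new word is tested at its middle, where past and future intervals are about equally
  -- precise.
  · set i := (M + 1 + 1) / 2 with hi
    set j := M + 1 + 1 - i with hj
    have hij : M + 1 + 1 = i + j := by omega
    have : excludedAt (M + 1 + 1) i (wordCode c k (M + 1 + 1)) = false := by
      rw [excludedAt, bindNat_eq, bindNat_eq]
      change excluded (pastItv i (wordCode c k (M + 1 + 1) / 32 ^ (M + 1 + 1 - i)))
        (futureItv (M + 1 + 1 - i) (wordCode c k (M + 1 + 1) % 32 ^ (M + 1 + 1 - i))) = false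
      rw [← hj, hij, wordCode_div hc, wordCode_mod hc]
      exact hex _ _ _ hk
    change (!excludedAt (M + 1 + 1) i (wordCode c k (M + 1 + 1))) = true
    rw [this]; rfl

theorem wordCode_mem_runLevels (n : ℕ) {L K : ℕ} (hL : 1 ≤ L) {S : List ℕ}
    (h : ∀ k ≥ K, wordCode c k L ∈ S)
    (hadm : ∀ k ≥ K, admissiblePair (c k) (c (k + 1)) = true)
    (hex : ∀ i j, ∀ k ≥ K, excluded (pastItv i (wordCode c k i))
      (futureItv j (wordCode c (k + i) j)) = false) :
    ∃ K', ∀ k ≥ K', wordCode c k (L + n) ∈ runLevels n L S := by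
  induction n generalizing L K S with
  | zero => exact ⟨K, h⟩
  | succ n ih =>
    have h1 := wordCode_mem_extend hl hL h hadm hex
    have h2 := wordCode_mem_prune hl (by omega) h1
    have h3 := wordCode_mem_prune hl (by omega) h2
    have := ih (L := L + 1) (K := K + 2) (by omega) h3 (fun k hk => hadm k (by omega))
      (fun i j k hk => hex i j k (by omega))
    rw [show L + 1 + n = L + (n + 1) by ring] at this
    exact this

end

/-! ### Large lower limits force the letters (4,2) -/

namespace CodedGrid

variable (G : CodedGrid)

/-- The upper bound uses the lower bound one step earlier, which is only available from time 1 on.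
This is the reason for the shift of all letters by 2 in the search. -/
lemma η_mem_of_le_four (ha : ∀ k, G.a k ≤ 4) (k : ℕ) :
    1 / 5 ≤ G.η (k + 2) ∧ G.η (k + 2) ≤ 5 / 6 := by
  have h1 : ∀ k, 1 / 5 ≤ G.η (k + 1) := by
    intro k
    have e := G.η_succ k
    have h1 : (G.a k : ℝ) ≤ 4 := by exact_mod_cast ha k
    have := G.η_le k
    have := G.η_pos k
    nlinarith
  refine ⟨h1 _, ?_⟩
  have e : G.η (k + 2) * _ = 1 := G.η_succ (k + 1)
  have := G.one_le_a' (k + 1)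
  have := h1 k
  have := G.η_nonneg (k + 2)
  nlinarith

lemma ζ_mem_of_le_four (ha : ∀ k, G.a k ≤ 4) (k : ℕ) : 1 / 5 ≤ G.ζ k ∧ G.ζ k ≤ 5 / 6 := by
  have h1 : ∀ k, 1 / 5 ≤ G.ζ k := by
    intro k
    have e := G.ζ_eq k
    have h1 : (G.a k : ℝ) ≤ 4 := by exact_mod_cast ha k
    have := G.ζ_le (k + 1)
    have := G.ζ_pos k
    nlinarith
  refine ⟨h1 _, ?_⟩
  have e := G.ζ_eq k
  have := G.one_le_a' k
  have := h1 (k + 1)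
  have := G.ζ_nonneg k
  nlinarith

/-- The code of a letter. -/
def letterCode (k : ℕ) : ℕ := 5 * G.a k + G.b k

lemma letterCode_mem (ha : ∀ k, G.a k ≤ 4) (k : ℕ) : G.letterCode k ∈ letterCodes := by
  have h1 := ha k
  have h2 := G.one_le_a k
  have h3 := G.b_le_a k
  simp only [letterCodes, letterCode, List.mem_cons, List.not_mem_nil, or_false]
  generalize G.a k = a at *
  generalize G.b k = b at *
  omega

lemma pastItv_contains (ha : ∀ k, G.a k ≤ 4) (k i : ℕ) :
    (pastItv i (wordCode (fun j => G.letterCode (j + 2)) k i)).Contains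
      (G.η (k + i + 2)) (G.x (k + i + 2)) := by
  have hl : ∀ j, G.letterCode (j + 2) < 32 := fun j => letterCodes_lt (G.letterCode_mem ha _)
  induction i with
  | zero =>
    obtain ⟨h1, h2⟩ := G.η_mem_of_le_four ha k
    have h3 := G.x_nonneg (k + 2)
    have h4 := G.x_le (k + 2)
    simp only [pastItv, ItvPair.Contains, add_zero]
    refine ⟨?_, ?_, ?_, ?_⟩ <;> norm_num <;> linarith
  | succ i ih =>
    have e1 : wordCode (fun j => G.letterCode (j + 2)) k (i + 1) / 32 =
        wordCode (fun j => G.letterCode (j + 2)) k i := by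
      simpa using wordCode_div hl k i 1
    have e2 : wordCode (fun j => G.letterCode (j + 2)) k (i + 1) % 32 =
        5 * G.a (k + i + 2) + G.b (k + i + 2) := by
      have h := hl (k + i)
      rw [wordCode, Nat.mul_comm, Nat.mul_add_mod, Nat.mod_eq_of_lt h]
      rfl
    change (pastStep (wordCode (fun j => G.letterCode (j + 2)) k (i + 1) % 32)
      (pastItv i (wordCode (fun j => G.letterCode (j + 2)) k (i + 1) / 32))).Contains _ _
    rw [e1, e2]
    have hb := (G.b_le_a (k + i + 2)).trans (ha _)
    exact pastStep_contains ih (G.one_le_a _) (by omega) (G.x_nonneg _) (G.η_nonneg _)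
      (G.η_succ (k + i + 2)) (G.x_succ (k + i + 2)) (G.x_le _)

lemma futureItv_contains (ha : ∀ k, G.a k ≤ 4) (hr : ∀ k, G.b k = 0 → G.r k < 0) (k j : ℕ) :
    (futureItv j (wordCode (fun j => G.letterCode (j + 2)) k j)).Contains
      (G.ζ (k + 2)) (G.r (k + 2) + 1) := by
  have hl : ∀ j, G.letterCode (j + 2) < 32 := fun j => letterCodes_lt (G.letterCode_mem ha _)
  induction j generalizing k with
  | zero =>
    obtain ⟨h1, h2⟩ := G.ζ_mem_of_le_four ha (k + 2)
    have h3 := G.r_ge (k + 2)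
    have h4 := G.r_le (k + 2)
    simp only [futureItv, ItvPair.Contains]
    refine ⟨?_, ?_, ?_, ?_⟩ <;> norm_num <;> linarith
  | succ j ih =>
    have e1 : wordCode (fun j => G.letterCode (j + 2)) k (j + 1) / 32 ^ j =
        5 * G.a (k + 2) + G.b (k + 2) := by
      have h := wordCode_div hl k 1 j
      rw [add_comm 1 j] at h
      rw [h]
      simp [wordCode, letterCode]
    have e2 : wordCode (fun j => G.letterCode (j + 2)) k (j + 1) % 32 ^ j =
        wordCode (fun j => G.letterCode (j + 2)) (k + 1) j := by
      simpa [add_comm 1 j] using wordCode_mod hl k 1 j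
    change (futureStep (wordCode (fun j => G.letterCode (j + 2)) k (j + 1) / 32 ^ j)
      (futureItv j (wordCode (fun j => G.letterCode (j + 2)) k (j + 1) % 32 ^ j))).Contains _ _
    rw [e1, e2]
    have hb := (G.b_le_a (k + 2)).trans (ha _)
    have ih' := ih (k + 1)
    rw [show k + 1 + 2 = k + 2 + 1 by ring] at ih'
    refine futureStep_contains ih' (G.one_le_a _) (by omega) (G.ζ_nonneg _) (G.ζ_le _)
      (G.ζ_eq _) (G.r_eq _) (G.r_le _) (G.r_le _) fun h0 => ?_
    have h1 := hr _ h0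
    rw [G.r_eq, h0] at h1
    have := G.ζ_pos (k + 2)
    by_contra! h2
    push_cast at h1
    nlinarith

/-- Coded grids with admissible letters whose products are large eventually have letters
`(4, 2)`. -/
theorem eventually_letters_eq (hadm : ∀ k, G.b (k + 1) = 0 → G.b k = G.a k)
    (hr : ∀ k, G.b k = 0 → G.r k < 0) {C : ℕ} (hC : 3 ≤ C) {c : ℝ} (hc : 1000 / 4787 < c)
    (h : IsLiminf (fun k => gridMin C (G.state k)) c) :
    ∃ K, ∀ k ≥ K, G.a k = 4 ∧ G.b k = 2 := by
  have h1 : ∀ᶠ k in atTop, (1000 / 4787 : ℝ) < gridMin C (G.state k) := by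
    filter_upwards [h.1 (c - 1000 / 4787) (by linarith)] with k hk
    linarith
  have h2 := G.eventually_a_lt_of_isLiminf (by omega) (by norm_num : (0 : ℝ) < 1000 / 4787) hc h
  obtain ⟨K, hK⟩ := eventually_atTop.1 (h1.and h2)
  let H := G.drop K
  have ha : ∀ k, H.a k ≤ 4 := by
    intro k
    have h3 : (G.a (K + k) : ℝ) < 5 := (hK (K + k) (by omega)).2.trans (by norm_num)
    have : G.a (K + k) < 5 := by exact_mod_cast h3
    exact Nat.lt_succ_iff.1 this
  have hl : ∀ k, H.letterCode (k + 2) ∈ letterCodes := fun k => H.letterCode_mem ha _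
  have hadm' : ∀ k ≥ 0, admissiblePair (H.letterCode (k + 2)) (H.letterCode (k + 1 + 2)) = true := by
    intro k _
    have hb := (H.b_le_a (k + 2)).trans (ha _)
    have hb' := (H.b_le_a (k + 3)).trans (ha _)
    have e1 : H.letterCode (k + 2) / 5 = H.a (k + 2) := by unfold letterCode; omega
    have e2 : H.letterCode (k + 2) % 5 = H.b (k + 2) := by unfold letterCode; omega
    have e3 : H.letterCode (k + 3) % 5 = H.b (k + 3) := by unfold letterCode; omega
    change (!(Nat.beq (H.letterCode (k + 3) % 5) 0) ||
      Nat.beq (H.letterCode (k + 2) / 5) (H.letterCode (k + 2) % 5)) = true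
    rw [e1, e2, e3]
    by_cases h0 : H.b (k + 3) = 0
    · have : H.b (k + 2) = H.a (k + 2) := hadm (K + (k + 2)) h0
      rw [this]; simp
    · have : Nat.beq (H.b (k + 3)) 0 = false := by
        rw [Bool.eq_false_iff]
        exact fun h' => h0 (Nat.eq_of_beq_eq_true h')
      rw [this]; rfl
  have hex : ∀ i j, ∀ k ≥ 0, excluded (pastItv i (wordCode (fun k => H.letterCode (k + 2)) k i))
      (futureItv j (wordCode (fun k => H.letterCode (k + 2)) (k + i) j)) = false := by
    intro i j k _
    rw [Bool.eq_false_iff]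
    intro hex
    obtain ⟨q, hq, hlt⟩ := exists_lt_of_excluded (H.pastItv_contains ha k i)
      (H.futureItv_contains ha (fun k => hr (K + k)) (k + i) j) (H.η_nonneg _) (H.ζ_nonneg _) hex
    have h3 := (hK (K + (k + i + 2)) (by omega)).1
    have hq' : q ∈ gridPoints C := by
      rw [mem_gridPoints] at hq ⊢
      have : ((3 : ℕ) : ℤ) ≤ C := by exact_mod_cast hC
      exact ⟨hq.1, hq.2.1, hq.2.2.1.trans this, hq.2.2.2.trans this⟩
    have h4 := gridMin_le (s := G.state (K + (k + i + 2))) hq'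
    have h5 : gridNorm (G.state (K + (k + i + 2))) q < 1000 / 4787 := hlt
    linarith
  obtain ⟨K', hK'⟩ := wordCode_mem_runLevels (c := fun k => H.letterCode (k + 2)) hl 8
    (L := 1) (K := 0) le_rfl (S := letterCodes) (fun k _ => by simpa [wordCode] using hl k) hadm' hex
  -- 10 is 8, the position of the last letter in a word of length 9, plus the shift 2.
  refine ⟨K + K' + 10, fun k hk => ?_⟩
  have h3 := hK' (k - K - 10) (by omega)
  rw [runLevels_eq, List.mem_singleton] at h3
  have h4 := wordCode_mod (fun k => letterCodes_lt (hl k)) (k - K - 10) 8 1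
  simp only [wordCode] at h4 h3
  have h5 : H.letterCode (k - K) = 22 := by
    have e : k - K - 10 + 8 + 2 = k - K := by omega
    rw [← e]
    have := letterCodes_lt (hl (k - K - 10 + 8))
    simp only [add_zero] at h3
    omega
  have h6 : 5 * H.a (k - K) + H.b (k - K) = 22 := h5
  have h7 := ha (k - K)
  have h8 := H.b_le_a (k - K)
  have e : K + (k - K) = k := by omega
  have h9 : H.a (k - K) = G.a k := by change G.a (K + (k - K)) = _; rw [e]
  have h10 : H.b (k - K) = G.b k := by change G.b (K + (k - K)) = _; rw [e]
  omega

/-- The coded grid with constant letters `(4, 2)`. -/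
noncomputable def golden : CodedGrid :=
  have h5 : √5 * √5 = 5 := Real.mul_self_sqrt (by norm_num)
  have h1 : 2 ≤ √5 := Real.le_sqrt_of_sq_le (by norm_num)
  have h2 : √5 ≤ 9 / 4 := Real.sqrt_le_iff.2 (by norm_num)
  { a := fun _ => 4
    b := fun _ => 2
    η := fun _ => √5 - 2
    x := fun _ => (√5 - 1) / 2
    ζ := fun _ => √5 - 2
    r := fun _ => (3 - √5) / 2
    one_le_a := fun _ => by norm_num
    b_le_a := fun _ => by norm_num
    η_nonneg := fun _ => by linarith
    η_le := fun _ => by linarith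
    x_nonneg := fun _ => by linarith
    x_le := fun _ => by linarith
    ζ_nonneg := fun _ => by linarith
    ζ_le := fun _ => by linarith
    r_ge := fun _ => by linarith
    r_le := fun _ => by linarith
    η_succ := fun _ => by push_cast; linarith
    x_succ := fun _ => by push_cast; linarith
    ζ_eq := fun _ => by push_cast; linarith
    r_eq := fun _ => by push_cast; linarith }

/-- The form is (n + 2m)² - 5m², anisotropic because √5 is irrational. -/
lemma golden_form_ne_zero {m n : ℤ} (h : ¬ (m = 0 ∧ n = 0)) : n ^ 2 + 4 * m * n - m ^ 2 ≠ 0 := by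
  intro h0
  have h1 : (n + 2 * m) ^ 2 = 5 * m ^ 2 := by linarith
  have h2 : ((n + 2 * m : ℤ) : ℝ) ^ 2 = 5 * (m : ℝ) ^ 2 := by exact_mod_cast h1
  have hirr : Irrational √(5 : ℝ) := by
    have := Nat.Prime.irrational_sqrt (p := 5) (by norm_num)
    exact_mod_cast this
  by_cases hm : m = 0
  · subst hm
    apply h
    refine ⟨rfl, ?_⟩
    simpa using h0
  · apply hirr
    have hm' : (0 : ℝ) < |(m : ℝ)| := abs_pos.2 (by exact_mod_cast hm)
    refine ⟨|(n + 2 * m : ℤ)| / |m|, ?_⟩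
    push_cast
    rw [div_eq_iff hm'.ne', ← abs_of_nonneg (Real.sqrt_nonneg 5), ← abs_mul, ← sq_eq_sq_iff_abs_eq_abs,
      mul_pow, Real.sq_sqrt (by norm_num)]
    push_cast at h2
    exact h2

/-- The product of coordinates is √5 - 2 times a nonzero integer, and the covolume is 2√5(√5 - 2).
-/
lemma golden_gridNorm {k : ℕ} {p : ℤ × ℤ × ℤ} (hp : p ≠ (0, 0, 0)) (he : p.1 = 0 ∨ p.1 = 1) :
    1 / (2 * √5) ≤ gridNorm (golden.state k) p := by
  have h5 : √5 * √5 = 5 := Real.mul_self_sqrt (by norm_num)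
  have h1 : 2 < √5 := Real.lt_sqrt_of_sq_lt (by norm_num)
  obtain ⟨e, m, n⟩ := p
  have key : ∃ q : ℤ, q ≠ 0 ∧ gridX (golden.state k) (e, m, n) * gridY (golden.state k) (e, m, n) =
      (√5 - 2) * q := by
    rcases he with rfl | rfl
    · refine ⟨n ^ 2 + 4 * m * n - m ^ 2, golden_form_ne_zero ?_, ?_⟩
      · rintro ⟨rfl, rfl⟩; exact hp rfl
      · simp only [gridX, gridY, state, golden]
        push_cast
        linear_combination (-m * n : ℝ) * h5
    -- This integer is odd: n² + 3n, m² - m and 4mn are even.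
    · refine ⟨n ^ 2 + 4 * m * n - m ^ 2 + 3 * n + m + 1, ?_, ?_⟩
      · intro h0
        have h2 : Even (n * (n + 3)) := by
          rcases Int.even_or_odd n with h | h
          · exact h.mul_right _
          · exact (h.add_odd (by decide)).mul_left _
        have h3 : Even (m * (m - 1)) := Int.even_mul_pred_self m
        obtain ⟨u, hu⟩ := h2
        obtain ⟨v, hv⟩ := h3
        have : 2 * (u - v + 2 * m * n) + 1 = 0 := by linarith
        omega
      · simp only [gridX, gridY, state, golden]
        push_cast
        linear_combination ((-(2 * m + 1) * (2 * n + 1) / 4 : ℝ)) * h5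
  obtain ⟨q, hq, e1⟩ := key
  rw [gridNorm, e1]
  have e2 : 1 + (golden.state k).1 * (golden.state k).2.2.1 = 2 * √5 * (√5 - 2) := by
    simp only [state, golden]; linarith
  have hq' : (1 : ℝ) ≤ |(q : ℝ)| := by exact_mod_cast Int.one_le_abs hq
  rw [e2, abs_mul, abs_of_pos (by linarith), div_le_div_iff₀ (by positivity)
    (mul_pos (by positivity) (by linarith))]
  have : 0 < (√5 - 2) * (2 * √5) := mul_pos (by linarith) (by positivity)
  nlinarith

lemma golden_gridMin {C : ℕ} (hC : 1 ≤ C) (k : ℕ) : gridMin C (golden.state k) = 1 / (2 * √5) := by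
  have h5 : √5 * √5 = 5 := Real.mul_self_sqrt (by norm_num)
  have h1 : 2 < √5 := Real.lt_sqrt_of_sq_lt (by norm_num)
  refine le_antisymm ?_ (le_gridMin_iff.2 fun p hp => ?_)
  · refine (gridMin_le (p := (0, 1, 0)) (by simp [mem_gridPoints]; omega)).trans ?_
    rw [gridNorm_unit]
    simp only [golden]
    rw [div_le_div_iff₀ (by nlinarith) (by positivity)]
    linarith
  · rw [mem_gridPoints] at hp
    exact golden_gridNorm hp.1 hp.2.1

lemma isLiminf_golden {C : ℕ} (hC : 1 ≤ C) :
    IsLiminf (fun k => gridMin C (golden.state k)) (1 / (2 * √5)) := by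
  simp only [golden_gridMin hC]
  exact ⟨fun ε hε => Eventually.of_forall fun _ => by linarith,
    fun ε hε => Frequently.of_forall fun _ => by linarith⟩

end CodedGrid

open CodedGrid in
theorem inv_two_mul_sqrt_five_mem_gridSpectrum : 1 / (2 * √5) ∈ gridSpectrum :=
  ⟨by positivity, 4, golden, fun _ => le_rfl, isLiminf_golden (by norm_num)⟩

open CodedGrid in
/-- Lower limits above `1000 / 4787` of coded grids with admissible letters. -/
theorem CodedGrid.isLiminf_eq_of_lt (G : CodedGrid) (hadm : ∀ k, G.b (k + 1) = 0 → G.b k = G.a k)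
    (hr : ∀ k, G.b k = 0 → G.r k < 0) {C : ℕ} (hC : 3 ≤ C) {c : ℝ} (hc : 1000 / 4787 < c)
    (h : IsLiminf (fun k => gridMin C (G.state k)) c) : c = 1 / (2 * √5) := by
  obtain ⟨K, hK⟩ := G.eventually_letters_eq hadm hr hC hc h
  refine h.unique (golden.isLiminf_of_letters_eventually_eq G (m := 0) (n := K)
    (isLiminf_golden (by omega)) fun k => ?_)
  obtain ⟨h1, h2⟩ := hK (k + K) (by omega)
  exact ⟨h1.symm, h2.symm⟩

/-! ### A sequence of lower limits that increases to `1 / 6` -/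

/-- The intervals of `(η, x)` after a word. -/
def pastOfWord (l : List ℕ) : ItvPair := l.foldl (fun s c => pastStep c s) ⟨0, 65536, 0, 131072⟩

/-- The intervals of `(ζ, r + 1)` before a word. -/
def futureOfWord (l : List ℕ) : ItvPair := l.foldr futureStep ⟨0, 65536, 0, 131072⟩

/-- A lower bound of `|A - B|` for `A ∈ [pl, ph]`, `B ∈ [ql, qh]`. -/
def absLower (pl ph ql qh : ℕ) : ℕ := (pl - qh) + (ql - ph)

/-- The first coordinate of the point `(1, m - 11, n - 11)` is not in `[1, a + η)`, or the product
at this point is above `10 / 59`. -/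
def settledAt (p f : ItvPair) (a m n : ℕ) : Bool :=
  Nat.blt (absBound (p.vl + m * 65536 + n * p.ul) (p.vh + m * 65536 + n * p.uh)
    (11 * 65536 + 11 * p.ul) (11 * 65536 + 11 * p.uh)) 65536 ||
  Nat.ble (a * 65536 + p.uh) (absLower (p.vl + m * 65536 + n * p.ul)
    (p.vh + m * 65536 + n * p.uh) (11 * 65536 + 11 * p.ul) (11 * 65536 + 11 * p.uh)) ||
  Nat.blt (10 * (65536 * 65536 + p.uh * f.uh)) (59 * (absLower (p.vl + m * 65536 + n * p.ul)
    (p.vh + m * 65536 + n * p.uh) (11 * 65536 + 11 * p.ul) (11 * 65536 + 11 * p.uh) *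
    absLower (f.vl + n * 65536 + 11 * f.ul) (f.vh + n * 65536 + 11 * f.uh)
      (65536 + 11 * 65536 + m * f.ul) (65536 + 11 * 65536 + m * f.uh)))

/-- All points with coefficients at most `11` are settled, with exceptions given by codes. -/
def settled (p f : ItvPair) (a : ℕ) (exc : List ℕ) : Bool :=
  (List.range 23).all fun m => (List.range 23).all fun n =>
    (settledAt ⟨p.ul, p.uh, 0, 0⟩ ⟨f.ul, f.uh, 65536, 65536⟩ a m n ||
      exc.any (Nat.beq (23 * m + n))) &&
    (settledAt p f a m n || exc.any (Nat.beq (23 * (23 + m) + n)))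

lemma absLower_spec {pl ph ql qh : ℕ} {A B : ℝ} (h1 : pl ≤ A) (h2 : A ≤ ph) (h3 : ql ≤ B)
    (h4 : B ≤ qh) : absLower pl ph ql qh ≤ |A - B| := by
  rw [absLower]
  rcases Nat.eq_zero_or_pos (pl - qh) with h | h
  · rw [h, zero_add]
    refine natSub_le (abs_nonneg _) ?_
    have := neg_abs_le (A - B)
    linarith
  · have h5 : ql - ph = 0 := by
      have h6 : (qh : ℝ) < pl := by exact_mod_cast (Nat.sub_pos_iff_lt.1 h)
      have h7 : (ql : ℝ) ≤ ph := by linarith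
      exact Nat.sub_eq_zero_of_le (by exact_mod_cast h7)
    rw [h5, add_zero]
    refine natSub_le (abs_nonneg _) ?_
    have := le_abs_self (A - B)
    linarith

lemma lt_gridNorm_of_settledAt {p f : ItvPair} {η x ζ r : ℝ} (hp : p.Contains η x)
    (hf : f.Contains ζ (r + 1)) (hη : 0 ≤ η) (hζ : 0 ≤ ζ) {a m n : ℕ}
    (h : settledAt p f a m n = true)
    (h1 : 1 ≤ |gridX (η, x, ζ, r) (1, (m : ℤ) - 11, (n : ℤ) - 11)|)
    (h2 : |gridX (η, x, ζ, r) (1, (m : ℤ) - 11, (n : ℤ) - 11)| < a + η) :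
    10 / 59 < gridNorm (η, x, ζ, r) (1, (m : ℤ) - 11, (n : ℤ) - 11) := by
  obtain ⟨p1, p2, p3, p4⟩ := hp
  obtain ⟨f1, f2, f3, f4⟩ := hf
  have e1 : (65536 * x + m * 65536 + n * (65536 * η)) - (11 * 65536 + 11 * (65536 * η)) =
      65536 * gridX (η, x, ζ, r) (1, (m : ℤ) - 11, (n : ℤ) - 11) := by
    simp only [gridX]; push_cast; ring
  have e2 : (65536 * (r + 1) + n * 65536 + 11 * (65536 * ζ)) -
      (65536 + 11 * 65536 + m * (65536 * ζ)) =
      65536 * gridY (η, x, ζ, r) (1, (m : ℤ) - 11, (n : ℤ) - 11) := by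
    simp only [gridY]; push_cast; ring
  have b1 : |(65536 * x + m * 65536 + n * (65536 * η)) - (11 * 65536 + 11 * (65536 * η))| ≤
      absBound (p.vl + m * 65536 + n * p.ul) (p.vh + m * 65536 + n * p.uh)
      (11 * 65536 + 11 * p.ul) (11 * 65536 + 11 * p.uh) := by
    apply absBound_spec <;> push_cast <;> gcongr <;> norm_num
  have b2 : (absLower (p.vl + m * 65536 + n * p.ul) (p.vh + m * 65536 + n * p.uh)
      (11 * 65536 + 11 * p.ul) (11 * 65536 + 11 * p.uh) : ℝ) ≤
      |(65536 * x + m * 65536 + n * (65536 * η)) - (11 * 65536 + 11 * (65536 * η))| := by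
    apply absLower_spec <;> push_cast <;> gcongr <;> norm_num
  have b3 : (absLower (f.vl + n * 65536 + 11 * f.ul) (f.vh + n * 65536 + 11 * f.uh)
      (65536 + 11 * 65536 + m * f.ul) (65536 + 11 * 65536 + m * f.uh) : ℝ) ≤
      |(65536 * (r + 1) + n * 65536 + 11 * (65536 * ζ)) -
        (65536 + 11 * 65536 + m * (65536 * ζ))| := by
    apply absLower_spec <;> push_cast <;> gcongr <;> norm_num
  rw [e1, abs_mul, abs_of_pos (by norm_num : (0 : ℝ) < 65536)] at b1 b2
  rw [e2, abs_mul, abs_of_pos (by norm_num : (0 : ℝ) < 65536)] at b3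
  simp only [settledAt, Bool.or_eq_true] at h
  rcases h with (h | h) | h
  · have h' : ((absBound (p.vl + m * 65536 + n * p.ul) (p.vh + m * 65536 + n * p.uh)
      (11 * 65536 + 11 * p.ul) (11 * 65536 + 11 * p.uh) : ℕ) : ℝ) < 65536 := by
      exact_mod_cast Nat.le_of_ble_eq_true h
    linarith
  · have h' : (a * 65536 + p.uh : ℝ) ≤ (absLower (p.vl + m * 65536 + n * p.ul)
        (p.vh + m * 65536 + n * p.uh) (11 * 65536 + 11 * p.ul) (11 * 65536 + 11 * p.uh) : ℕ) := by
      exact_mod_cast Nat.le_of_ble_eq_true h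
    linarith
  · have h' : (10 * (65536 * 65536 + p.uh * f.uh) : ℝ) <
        59 * ((absLower (p.vl + m * 65536 + n * p.ul) (p.vh + m * 65536 + n * p.uh)
        (11 * 65536 + 11 * p.ul) (11 * 65536 + 11 * p.uh) : ℕ) *
        (absLower (f.vl + n * 65536 + 11 * f.ul) (f.vh + n * 65536 + 11 * f.uh)
        (65536 + 11 * 65536 + m * f.ul) (65536 + 11 * 65536 + m * f.uh) : ℕ)) := by
      exact_mod_cast Nat.le_of_ble_eq_true h
    have h3 := mul_le_mul b2 b3 (by positivity) (by positivity)
    have h4 : 65536 * η * (65536 * ζ) ≤ (p.uh : ℝ) * f.uh :=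
      mul_le_mul p2 f2 (by positivity) (by positivity)
    have h5 : 0 < 1 + η * ζ := by positivity
    rw [gridNorm, lt_div_iff₀ h5, abs_mul]
    nlinarith

lemma lt_gridNorm_of_settled {p f : ItvPair} {η x ζ r : ℝ} (hp : p.Contains η x)
    (hf : f.Contains ζ (r + 1)) (hη : 0 ≤ η) (hζ : 0 ≤ ζ) {a : ℕ} {exc : List ℕ}
    (h : settled p f a exc = true) {e m n : ℤ} (hq : (e, m, n) ∈ gridPoints 11)
    (h1 : 1 ≤ |gridX (η, x, ζ, r) (e, m, n)|)
    (h2 : |gridX (η, x, ζ, r) (e, m, n)| < a + η) :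
    10 / 59 < gridNorm (η, x, ζ, r) (e, m, n) ∨
      ∃ c ∈ exc, (c : ℤ) = 23 * (23 * e + (m + 11)) + (n + 11) := by
  obtain ⟨-, he, hm, hn⟩ := mem_gridPoints.1 hq
  simp only [abs_le] at hm hn
  push_cast at hm hn
  obtain ⟨m', rfl⟩ : ∃ m' : ℕ, m = (m' : ℤ) - 11 := ⟨(m + 11).toNat, by omega⟩
  obtain ⟨n', rfl⟩ : ∃ n' : ℕ, n = (n' : ℤ) - 11 := ⟨(n + 11).toNat, by omega⟩
  simp only [settled, List.all_eq_true, List.mem_range, Bool.and_eq_true, Bool.or_eq_true,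
    List.any_eq_true] at h
  obtain ⟨g1, g2⟩ := h m' (by omega) n' (by omega)
  rcases he with rfl | rfl
  · rcases g1 with g1 | ⟨c, hc, g1⟩
    · left
      -- Lattice points are treated as points of the translate with translation vector 0, so one
      -- test covers both cases.
      have e1 : gridX (η, x, ζ, r) (0, (m' : ℤ) - 11, (n' : ℤ) - 11) =
          gridX (η, 0, ζ, 0) (1, (m' : ℤ) - 11, (n' : ℤ) - 11) := by simp [gridX]
      have e2 : gridNorm (η, x, ζ, r) (0, (m' : ℤ) - 11, (n' : ℤ) - 11) =
          gridNorm (η, 0, ζ, 0) (1, (m' : ℤ) - 11, (n' : ℤ) - 11) := by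
        simp [gridNorm, gridX, gridY]
      rw [e1] at h1 h2
      rw [e2]
      exact lt_gridNorm_of_settledAt (p := ⟨p.ul, p.uh, 0, 0⟩) (f := ⟨f.ul, f.uh, 65536, 65536⟩)
        ⟨hp.1, hp.2.1, by simp, by simp⟩ ⟨hf.1, hf.2.1, by simp, by simp⟩ hη hζ g1 h1 h2
    · right
      refine ⟨c, hc, ?_⟩
      rw [← Nat.eq_of_beq_eq_true g1]
      push_cast; ring
  · rcases g2 with g2 | ⟨c, hc, g2⟩
    · exact Or.inl (lt_gridNorm_of_settledAt hp hf hη hζ g2 h1 h2)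
    · right
      refine ⟨c, hc, ?_⟩
      rw [← Nat.eq_of_beq_eq_true g2]
      push_cast; ring

namespace CodedGrid

variable (G : CodedGrid)

lemma pastOfWord_contains (hb : ∀ k, G.b k < 5) (k i : ℕ) :
    (pastOfWord ((List.range' k i).map G.letterCode)).Contains (G.η (k + i)) (G.x (k + i)) := by
  induction i with
  | zero =>
    have h1 := G.η_nonneg k; have h2 := G.η_le k; have h3 := G.x_nonneg k; have h4 := G.x_le k
    simp only [List.range'_zero, List.map_nil, pastOfWord, List.foldl_nil, ItvPair.Contains, add_zero]
    refine ⟨?_, ?_, ?_, ?_⟩ <;> norm_num <;> linarith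
  | succ i ih =>
    rw [List.range'_concat, List.map_append, pastOfWord, List.foldl_append]
    simp only [one_mul, List.map_cons, List.map_nil, List.foldl_cons, List.foldl_nil]
    exact pastStep_contains ih (G.one_le_a _) (hb _) (G.x_nonneg _) (G.η_nonneg _)
      (G.η_succ (k + i)) (G.x_succ (k + i)) (G.x_le _)

lemma futureOfWord_contains (hb : ∀ k, G.b k < 5) (hr : ∀ k, G.b k = 0 → 0 ≤ G.r (k + 1))
    (k j : ℕ) : (futureOfWord ((List.range' k j).map G.letterCode)).Contains (G.ζ k)
      (G.r k + 1) := by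
  induction j generalizing k with
  | zero =>
    have h1 := G.ζ_nonneg k; have h2 := G.ζ_le k; have h3 := abs_le.1 (G.r_abs_le k)
    simp only [List.range'_zero, List.map_nil, futureOfWord, List.foldr_nil, ItvPair.Contains]
    refine ⟨?_, ?_, ?_, ?_⟩ <;> norm_num <;> linarith
  | succ j ih =>
    rw [List.range'_succ, List.map_cons, futureOfWord, List.foldr_cons]
    exact futureStep_contains (ih (k + 1)) (G.one_le_a _) (hb _) (G.ζ_nonneg _) (G.ζ_le _)
      (G.ζ_eq _) (G.r_eq _) (G.r_le _) (G.r_le _) (hr k)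

end CodedGrid

/-! ### Periodic words with lower limits just below 1/6 -/

/-- The letters `(3, 1)`, `(1, 0)`, `(5, 3)` at times `7`, `8`, `9`, surrounded by `(4, 2)`. -/
def coreLetter (t : ℕ) : ℕ :=
  bif Nat.beq t 7 then 16 else bif Nat.beq t 8 then 5 else bif Nat.beq t 9 then 28 else 22

/-- The codes of the points at which the product may tend to `1 / 6`. -/
def coreExceptions (i : ℕ) : List ℕ :=
  bif Nat.beq i 7 then [23 * (23 + 12) + 11, 23 * (23 + 9) + 10]
  else bif Nat.beq i 8 then [23 * 12 + 12, 23 * 10 + 10]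
  else bif Nat.beq i 9 then
    [23 * 12 + 11, 23 * 10 + 11, 23 * (23 + 11) + 11, 23 * (23 + 11) + 10]
  else []

/-- Only products at the exceptional points can come below 10/59 at canonical times near the core.
The bound 11 on coefficients is M + 6 for M = 5. -/
lemma settled_core : (List.range' 4 10).all (fun i =>
    settled (pastOfWord ((List.range' 0 i).map coreLetter))
      (futureOfWord ((List.range' i (17 - i)).map coreLetter)) (coreLetter i / 5)
      (coreExceptions i)) = true := by
  decide +kernel

lemma settled_far : settled (pastOfWord ((List.range' 0 4).map fun _ => 22))
    (futureOfWord ((List.range' 4 4).map fun _ => 22)) 4 [] = true := by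
  decide +kernel

/-- The periodic word with period `(3, 1) (1, 0) (5, 3) (4, 2)ⁿ`. -/
def periodicCode (n k : ℕ) : ℕ :=
  if k % (n + 3) = 0 then 16 else if k % (n + 3) = 1 then 5 else if k % (n + 3) = 2 then 28 else 22

lemma periodicCode_mul_add {n u j : ℕ} (hj : j < n + 3) : periodicCode n ((n + 3) * u + j) =
    if j = 0 then 16 else if j = 1 then 5 else if j = 2 then 28 else 22 := by
  simp only [periodicCode, Nat.mul_add_mod, Nat.mod_eq_of_lt hj]

lemma periodicCode_mem (n k : ℕ) : periodicCode n k = 16 ∨ periodicCode n k = 5 ∨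
    periodicCode n k = 28 ∨ periodicCode n k = 22 := by
  unfold periodicCode
  split_ifs <;> simp

lemma periodicCode_before {n u t : ℕ} (ht : t < n) :
    periodicCode n ((n + 3) * (u + 1) - n + t) = 22 := by
  have : (n + 3) * (u + 1) - n + t = (n + 3) * u + (3 + t) := by
    rw [mul_add, mul_one]; omega
  rw [this, periodicCode_mul_add (by omega), if_neg (by omega), if_neg (by omega),
    if_neg (by omega)]

lemma periodicCode_after {n u t : ℕ} (ht : t < n) :
    periodicCode n ((n + 3) * u + 3 + t) = 22 := by
  rw [add_assoc, periodicCode_mul_add (by omega), if_neg (by omega), if_neg (by omega),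
    if_neg (by omega)]

lemma periodicCode_core {n u t : ℕ} (hn : 7 ≤ n) (ht : t < 17) :
    periodicCode n ((n + 3) * (u + 1) - 7 + t) = coreLetter t := by
  rcases lt_or_ge t 7 with h | h
  · have e : (n + 3) * (u + 1) - 7 + t = (n + 3) * (u + 1) - n + (n - 7 + t) := by
      rw [mul_add, mul_one]; omega
    rw [e, periodicCode_before (by omega)]
    interval_cases t <;> rfl
  · have e : (n + 3) * (u + 1) - 7 + t = (n + 3) * (u + 1) + (t - 7) := by
      rw [mul_add, mul_one]; omega
    rw [e, periodicCode_mul_add (by omega)]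
    interval_cases t <;> rfl

lemma map_range'_eq {c d : ℕ → ℕ} {k m N : ℕ} (h : ∀ t < N, c (k + t) = d (m + t)) {i : ℕ}
    (hi : i ≤ N) : (List.range' k i).map c = (List.range' m i).map d := by
  rw [List.range'_eq_map_range, List.range'_eq_map_range, List.map_map, List.map_map]
  refine List.map_congr_left fun t ht => ?_
  exact h t (lt_of_lt_of_le (List.mem_range.1 ht) hi)

namespace CodedGrid

variable {G : CodedGrid}

lemma lt_gridNorm_of_window (hb : ∀ k, G.b k < 5) (hr : ∀ k, G.b k = 0 → 0 ≤ G.r (k + 1))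
    {c : ℕ → ℕ} {k i j : ℕ} {exc : List ℕ} (hw : ∀ t < i + j, G.letterCode (k + t) = c t)
    (hj : 1 ≤ j) (h : settled (pastOfWord ((List.range' 0 i).map c))
      (futureOfWord ((List.range' i j).map c)) (c i / 5) exc = true) {p : ℤ × ℤ × ℤ}
    (hp : p ∈ gridPoints 11) (h1 : 1 ≤ |gridX (G.state (k + i)) p|)
    (h2 : |gridX (G.state (k + i)) p| < G.a (k + i) + G.η (k + i)) :
    10 / 59 < gridNorm (G.state (k + i)) p ∨
      ∃ c ∈ exc, (c : ℤ) = 23 * (23 * p.1 + (p.2.1 + 11)) + (p.2.2 + 11) := by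
  have hP := G.pastOfWord_contains hb k i
  have hF := G.futureOfWord_contains hb hr (k + i) j
  rw [map_range'_eq (d := c) (m := 0) (N := i) (fun t ht => by rw [zero_add]; exact hw t (by omega))
    le_rfl] at hP
  rw [map_range'_eq (d := c) (m := i) (N := j)
    (fun t ht => by rw [add_assoc]; exact hw (i + t) (by omega)) le_rfl] at hF
  have ha : c i / 5 = G.a (k + i) := by
    rw [← hw i (by omega)]
    have := hb (k + i)
    unfold letterCode; omega
  rw [ha] at h
  exact lt_gridNorm_of_settled hP hF (G.η_nonneg _) (G.ζ_nonneg _) h hp h1 h2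

end CodedGrid

/-- The state before `(5, 3)`, from the past coordinates before `(3, 1) (1, 0)` and the future
coordinates after `(5, 3)`. -/
noncomputable def coreState (s : GridState) : GridState :=
  (1 / (1 + 1 / (3 + s.1)), 1 / (1 + 1 / (3 + s.1)) * (1 / (3 + s.1) * (1 + s.2.1)),
    1 / (5 + s.2.2.1), 1 / (5 + s.2.2.1) * (3 - s.2.2.2))

lemma coreState_golden : coreState (CodedGrid.golden.state 0) =
    (3 - √5, (3 - √5) / 2, (3 - √5) / 4, 1 / 2) := by
  have h5 : √5 * √5 = 5 := Real.mul_self_sqrt (by norm_num)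
  have h0 : 0 ≤ √5 := Real.sqrt_nonneg 5
  have e1 : 1 / (3 + (√5 - 2)) = (√5 - 1) / 4 := by
    rw [div_eq_div_iff (by linarith) (by norm_num)]; linarith
  have e2 : 1 / (1 + (√5 - 1) / 4) = 3 - √5 := by
    rw [div_eq_iff (by linarith)]; linarith
  have e3 : 1 / (5 + (√5 - 2)) = (3 - √5) / 4 := by
    rw [div_eq_div_iff (by linarith) (by norm_num)]; linarith
  simp only [coreState, CodedGrid.golden, CodedGrid.state, e1, e2, e3, Prod.mk.injEq, true_and]
  exact ⟨by linear_combination (3 - √5) / 8 * h5, by linear_combination (-1 / 8) * h5⟩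

/-- In the limit n → ∞ the core (3,1)(1,0)(5,3) is surrounded by (4,2) on both sides, and its three
critical points have the same product 1/6. -/
lemma gridNorm_coreState_golden {p : ℤ × ℤ × ℤ} (hp : p = (0, 1, 0) ∨ p = (1, 0, 0) ∨
    p = (1, 0, -1)) : gridNorm (coreState (CodedGrid.golden.state 0)) p = 1 / 6 := by
  have h5 : √5 * √5 = 5 := Real.mul_self_sqrt (by norm_num)
  have h3 : √5 < 3 := Real.sqrt_lt' (by norm_num) |>.2 (by norm_num)
  rw [coreState_golden]
  have e : 1 + (3 - √5) * ((3 - √5) / 4) = 3 / 2 * (3 - √5) := by linarith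
  have e' : |(3 - √5) / 4| = (3 - √5) / 4 := abs_of_pos (by linarith)
  rcases hp with rfl | rfl | rfl
  · simp only [gridNorm, gridX, gridY]
    rw [e, div_eq_div_iff (by linarith) (by norm_num)]
    push_cast
    rw [show (0 * ((3 - √5) / 2) + 1 + 0 * (3 - √5)) * (0 * (1 / 2) + 0 - 1 * ((3 - √5) / 4)) =
      -((3 - √5) / 4) by ring, abs_neg, e']
    ring
  · simp only [gridNorm, gridX, gridY]
    rw [e, div_eq_div_iff (by linarith) (by norm_num)]
    push_cast
    rw [show (1 * ((3 - √5) / 2) + 0 + 0 * (3 - √5)) * (1 * (1 / 2) + 0 - 0 * ((3 - √5) / 4)) =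
      (3 - √5) / 4 by ring, e']
    ring
  · simp only [gridNorm, gridX, gridY]
    rw [e, div_eq_div_iff (by linarith) (by norm_num)]
    push_cast
    rw [show (1 * ((3 - √5) / 2) + 0 + -1 * (3 - √5)) * (1 * (1 / 2) + -1 - 0 * ((3 - √5) / 4)) =
      (3 - √5) / 4 by ring, e']
    ring

lemma continuousAt_gridNorm_coreState (p : ℤ × ℤ × ℤ) :
    ContinuousAt (fun s => gridNorm (coreState s) p) (CodedGrid.golden.state 0) := by
  have h1 : 2 < √5 := Real.lt_sqrt_of_sq_lt (by norm_num)
  have n1 : 3 + (CodedGrid.golden.state 0).1 ≠ 0 := by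
    simp only [CodedGrid.state, CodedGrid.golden]; linarith
  have n2 : 1 + 1 / (3 + (CodedGrid.golden.state 0).1) ≠ 0 := by
    have : 0 < 3 + (CodedGrid.golden.state 0).1 := by
      simp only [CodedGrid.state, CodedGrid.golden]; linarith
    positivity
  have n3 : 5 + (CodedGrid.golden.state 0).2.2.1 ≠ 0 := by
    simp only [CodedGrid.state, CodedGrid.golden]; linarith
  have hc : ContinuousAt coreState (CodedGrid.golden.state 0) := by
    unfold coreState
    fun_prop (disch := assumption)
  have hd : ContinuousAt (fun s => gridNorm s p) (coreState (CodedGrid.golden.state 0)) := by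
    have h3 : √5 < 3 := Real.sqrt_lt' (by norm_num) |>.2 (by norm_num)
    unfold gridNorm gridX gridY
    refine ContinuousAt.div (by fun_prop) (by fun_prop) ?_
    rw [coreState_golden]
    simp only
    have := mul_pos (show 0 < 3 - √5 by linarith) (show 0 < (3 - √5) / 4 by linarith)
    linarith
  exact ContinuousAt.comp (f := coreState) (g := fun s => gridNorm s p) hd hc

lemma exists_core_close {ε : ℝ} (hε : 0 < ε) : ∃ δ > 0, ∀ s,
    dist s (CodedGrid.golden.state 0) < δ → ∀ p : ℤ × ℤ × ℤ,
      (p = (0, 1, 0) ∨ p = (1, 0, 0) ∨ p = (1, 0, -1)) → 1 / 6 - ε < gridNorm (coreState s) p := by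
  have key : ∀ p : ℤ × ℤ × ℤ, (p = (0, 1, 0) ∨ p = (1, 0, 0) ∨ p = (1, 0, -1)) →
      ∀ᶠ s in 𝓝 (CodedGrid.golden.state 0), 1 / 6 - ε < gridNorm (coreState s) p := by
    intro p hp
    refine (continuousAt_gridNorm_coreState p).eventually (lt_mem_nhds ?_)
    have := gridNorm_coreState_golden hp
    simp only [this]; linarith
  have := ((key (0, 1, 0) (Or.inl rfl)).and (key (1, 0, 0) (Or.inr (Or.inl rfl)))).and
    (key (1, 0, -1) (Or.inr (Or.inr rfl)))
  obtain ⟨δ, hδ, H⟩ := Metric.eventually_nhds_iff.1 this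
  refine ⟨δ, hδ, fun s hs p hp => ?_⟩
  obtain ⟨⟨h1, h2⟩, h3⟩ := H hs
  rcases hp with rfl | rfl | rfl
  · exact h1
  · exact h2
  · exact h3

/-- The map t ↦ 1/(4 + t) reverses order, so two steps preserve the sign of a difference; they
shrink it by a product of four values, each at least 1/5. The quantitative bound is needed to stay
away from 0 uniformly over all periods. -/
lemma sub_ge_of_recursion {v w : ℕ → ℝ} {d : ℝ} (m : ℕ)
    (hv : ∀ i < 2 * m, v (i + 1) * (4 + v i) = 1) (hw : ∀ i < 2 * m, w (i + 1) * (4 + w i) = 1)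
    (v0 : ∀ i, 0 ≤ v i ∧ v i ≤ 1) (w0 : ∀ i, 0 ≤ w i ∧ w i ≤ 1) (hd : 0 ≤ d)
    (h : d ≤ v 0 - w 0) : d / 625 ^ m ≤ v (2 * m) - w (2 * m) := by
  induction m with
  | zero => simpa using h
  | succ m ih =>
    have ih := ih (fun i hi => hv i (by omega)) (fun i hi => hw i (by omega))
    have a1 := hv (2 * m) (by omega)
    have a2 := hv (2 * m + 1) (by omega)
    have b1 := hw (2 * m) (by omega)
    have b2 := hw (2 * m + 1) (by omega)
    rw [show 2 * (m + 1) = 2 * m + 1 + 1 by ring]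
    have low : ∀ {s t : ℝ}, t * (4 + s) = 1 → 0 ≤ t → s ≤ 1 → 1 / 5 ≤ t := by
      intro s t h1 h2 h3; nlinarith
    have p1 := low a1 (v0 _).1 (v0 _).2
    have p2 := low a2 (v0 _).1 (v0 _).2
    have q1 := low b1 (w0 _).1 (w0 _).2
    have q2 := low b2 (w0 _).1 (w0 _).2
    generalize v (2 * m) = x0 at *
    generalize v (2 * m + 1) = x1 at *
    generalize v (2 * m + 1 + 1) = x2 at *
    generalize w (2 * m) = y0 at *
    generalize w (2 * m + 1) = y1 at *
    generalize w (2 * m + 1 + 1) = y2 at *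
    have e : x2 - y2 = (x0 - y0) * (x1 * y1 * (x2 * y2)) := by
      linear_combination y2 * a2 - x2 * b2 - x2 * y2 * y1 * a1 + x2 * y2 * x1 * b1
    have h1 : (1 / 5 : ℝ) * (1 / 5) ≤ x1 * y1 := mul_le_mul p1 q1 (by norm_num) (by linarith)
    have h2 : (1 / 5 : ℝ) * (1 / 5) ≤ x2 * y2 := mul_le_mul p2 q2 (by norm_num) (by linarith)
    have h3 : (1 / 5 : ℝ) * (1 / 5) * ((1 / 5 : ℝ) * (1 / 5)) ≤ x1 * y1 * (x2 * y2) :=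
      mul_le_mul h1 h2 (by norm_num) (by nlinarith)
    have h4 : 0 ≤ d / 625 ^ m := by positivity
    rw [e, pow_succ]
    calc d / (625 ^ m * 625) = d / 625 ^ m * (1 / 5 * (1 / 5) * (1 / 5 * (1 / 5))) := by
          field_simp; norm_num
      _ ≤ _ := mul_le_mul ih h3 (by norm_num) (h4.trans ih)

namespace CodedGrid

variable {G : CodedGrid} {n : ℕ}

lemma letters_of_code (hb : ∀ k, G.b k < 5) {k a b : ℕ} (h : G.letterCode k = 5 * a + b)
    (hb' : b < 5) : G.a k = a ∧ G.b k = b := by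
  have := hb k
  unfold letterCode at h
  omega

section Periodic

variable (hb : ∀ k, G.b k < 5) (hcode : ∀ k, G.letterCode k = periodicCode n k)
include hb hcode

lemma periodic_letters_core (u : ℕ) :
    (G.a ((n + 3) * u) = 3 ∧ G.b ((n + 3) * u) = 1) ∧
    (G.a ((n + 3) * u + 1) = 1 ∧ G.b ((n + 3) * u + 1) = 0) ∧
    (G.a ((n + 3) * u + 2) = 5 ∧ G.b ((n + 3) * u + 2) = 3) := by
  refine ⟨letters_of_code hb ?_ (by norm_num), letters_of_code hb ?_ (by norm_num),
    letters_of_code hb ?_ (by norm_num)⟩ <;> rw [hcode]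
  · have := periodicCode_mul_add (n := n) (u := u) (j := 0) (by omega)
    simpa using this
  · rw [periodicCode_mul_add (by omega)]; simp
  · rw [periodicCode_mul_add (by omega)]; simp

lemma periodic_letters_before (u : ℕ) {t : ℕ} (ht : t < n) :
    G.a ((n + 3) * (u + 1) - n + t) = 4 ∧ G.b ((n + 3) * (u + 1) - n + t) = 2 :=
  letters_of_code hb (by rw [hcode, periodicCode_before ht]) (by norm_num)

lemma periodic_letters_after (u : ℕ) {t : ℕ} (ht : t < n) :
    G.a ((n + 3) * u + 3 + t) = 4 ∧ G.b ((n + 3) * u + 3 + t) = 2 :=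
  letters_of_code hb (by rw [hcode, periodicCode_after ht]) (by norm_num)

lemma periodic_r_nonneg (k : ℕ) (h : G.b k = 0) : 0 ≤ G.r (k + 1) := by
  have h1 := hcode k
  rw [letterCode, h] at h1
  have h2 : k % (n + 3) = 1 := by
    unfold periodicCode at h1
    split_ifs at h1 <;> omega
  have h3 : k + 1 = (n + 3) * (k / (n + 3)) + 2 := by
    have := Nat.div_add_mod k (n + 3)
    omega
  have h4 := (periodic_letters_core hb hcode (k / (n + 3))).2.2.2
  rw [← h3] at h4
  rw [G.r_eq, h4]
  have := G.r_le (k + 1 + 1)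
  exact mul_nonneg (G.ζ_nonneg _) (by push_cast; linarith)

lemma periodic_state (u : ℕ) : G.state ((n + 3) * u + 2) = coreState (G.η ((n + 3) * u),
    G.x ((n + 3) * u), G.ζ ((n + 3) * u + 3), G.r ((n + 3) * u + 3)) := by
  obtain ⟨⟨a1, b1⟩, ⟨a2, b2⟩, ⟨a3, b3⟩⟩ := periodic_letters_core hb hcode u
  set k := (n + 3) * u
  have e1 : G.η (k + 1) = 1 / (3 + G.η k) := by
    have h := G.η_succ k
    rw [a1] at h
    exact eq_one_div_of_mul_eq_one_left (by exact_mod_cast h)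
  have e2 : G.x (k + 1) = 1 / (3 + G.η k) * (1 + G.x k) := by
    rw [G.x_succ, e1, b1]; norm_num
  have e3 : G.η (k + 2) = 1 / (1 + 1 / (3 + G.η k)) := by
    have h : G.η (k + 2) * (G.a (k + 1) + G.η (k + 1)) = 1 := G.η_succ (k + 1)
    rw [a2, e1] at h
    exact eq_one_div_of_mul_eq_one_left (by exact_mod_cast h)
  have e4 : G.x (k + 2) = 1 / (1 + 1 / (3 + G.η k)) * (1 / (3 + G.η k) * (1 + G.x k)) := by
    have h : G.x (k + 2) = G.η (k + 2) * (G.b (k + 1) + G.x (k + 1)) := G.x_succ (k + 1)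
    rw [h, e3, b2, e2]; norm_num
  have e5 : G.ζ (k + 2) = 1 / (5 + G.ζ (k + 3)) := by
    have h := G.ζ_eq (k + 2)
    rw [a3] at h
    exact eq_one_div_of_mul_eq_one_left (by exact_mod_cast h)
  have e6 : G.r (k + 2) = 1 / (5 + G.ζ (k + 3)) * (3 - G.r (k + 3)) := by
    rw [G.r_eq, e5, b3]; norm_num
  simp only [state, coreState, e3, e4, e5, e6]

lemma periodic_dist {m : ℕ} (hm : n = 2 * m) (u : ℕ) :
    dist (G.η ((n + 3) * (u + 1)), G.x ((n + 3) * (u + 1)), G.ζ ((n + 3) * (u + 1) + 3),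
      G.r ((n + 3) * (u + 1) + 3)) (golden.state 0) ≤ 12 * (1 / 2) ^ m := by
  have h1 := past_close (G := G) (G' := golden) (t := (n + 3) * (u + 1) - n) (t' := 0) (K := m)
    fun i hi => periodic_letters_before hb hcode u (by omega)
  have h2 := future_close (G := G) (G' := golden) (t := (n + 3) * (u + 1) + 3) (t' := 0) (K := m)
    fun i hi => periodic_letters_after hb hcode (u + 1) (by omega)
  have e : (n + 3) * (u + 1) - n + 2 * m = (n + 3) * (u + 1) := by
    rw [mul_add, mul_one]; omega
  rw [e] at h1
  simp only [state, Prod.dist_eq, Real.dist_eq, max_le_iff]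
  exact ⟨h1.1, h1.2, h2.1, h2.2⟩

/-- At the core the inverse of this product is 5 + ζ + η with η = 1 - 1/(4 + η'), hence 6 + ζ - 1/(4
+ η'). Both ζ and 1/(4 + η') arise from n iterations of t ↦ 1/(4 + t), starting from values at least
1/4 and at most 6/25; n being even, the difference keeps its sign. -/
lemma periodic_center {m : ℕ} (hm : n = 2 * m) (u : ℕ) :
    gridNorm (G.state ((n + 3) * (u + 1) + 2)) (0, 1, 0) ≤ 1 / (6 + 1 / 100 / 625 ^ m) := by
  have hq : (n + 3) * (u + 1) - n = (n + 3) * u + 2 + 1 := by rw [mul_add, mul_one]; omega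
  have hq' : (n + 3) * (u + 1 + 1) = (n + 3) * (u + 1) + 3 + n := by rw [mul_add _ _ 1, mul_one]; omega
  have h1 := sub_ge_of_recursion (v := fun i => G.ζ ((n + 3) * (u + 1 + 1) - i))
    (w := fun i => 1 / (4 + G.η ((n + 3) * (u + 1) - n + i))) (d := 1 / 100) m ?_ ?_
    (fun i => ⟨G.ζ_nonneg _, G.ζ_le _⟩) ?_ (by norm_num) ?_
  · obtain ⟨⟨a1, b1⟩, ⟨a2, b2⟩, ⟨a3, b3⟩⟩ := periodic_letters_core hb hcode (u + 1)
    rw [show (n + 3) * (u + 1 + 1) - 2 * m = (n + 3) * (u + 1) + 3 by omega,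
      show (n + 3) * (u + 1) - n + 2 * m = (n + 3) * (u + 1) by omega] at h1
    set k := (n + 3) * (u + 1)
    have e1 := G.η_succ k
    have e2 : G.η (k + 2) * _ = 1 := G.η_succ (k + 1)
    have e3 := G.ζ_eq (k + 2)
    rw [a1] at e1
    rw [a2] at e2
    rw [a3] at e3
    push_cast at e1 e2 e3
    have p0 := G.η_nonneg k
    have p1 := G.η_nonneg (k + 1)
    have p2 := G.η_nonneg (k + 2)
    have p3 := G.ζ_nonneg (k + 3)
    have e4 : G.η (k + 2) = 1 - 1 / (4 + G.η k) := by
      have f1 : G.η (k + 1) = 1 / (3 + G.η k) := eq_one_div_of_mul_eq_one_left e1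
      have f2 : G.η (k + 2) = 1 / (1 + G.η (k + 1)) := eq_one_div_of_mul_eq_one_left e2
      rw [f2, f1]; field_simp; ring
    have e5 : G.ζ (k + 2) = 1 / (5 + G.ζ (k + 3)) := eq_one_div_of_mul_eq_one_left e3
    rw [gridNorm_unit, e5]
    have e6 : 1 / (5 + G.ζ (k + 3)) / (1 + G.η (k + 2) * (1 / (5 + G.ζ (k + 3)))) =
        1 / (5 + G.ζ (k + 3) + G.η (k + 2)) := by
      field_simp
    rw [e6]
    refine one_div_le_one_div_of_le (by positivity) ?_
    rw [e4]; linarith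
  · intro i hi
    have ha : G.a ((n + 3) * (u + 1 + 1) - (i + 1)) = 4 := by
      have := (periodic_letters_after hb hcode (u + 1) (t := n - (i + 1)) (by omega)).1
      rw [← this]; congr 1; omega
    have h := G.ζ_eq ((n + 3) * (u + 1 + 1) - (i + 1))
    rw [ha, show (n + 3) * (u + 1 + 1) - (i + 1) + 1 = (n + 3) * (u + 1 + 1) - i by omega] at h
    exact_mod_cast h
  · intro i hi
    have ha := (periodic_letters_before hb hcode u (t := i) (by omega)).1
    have h := G.η_succ ((n + 3) * (u + 1) - n + i)
    rw [ha] at h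
    push_cast at h
    have p0 := G.η_nonneg ((n + 3) * (u + 1) - n + (i + 1))
    have f : 1 / (4 + G.η ((n + 3) * (u + 1) - n + i)) = G.η ((n + 3) * (u + 1) - n + (i + 1)) :=
      (eq_one_div_of_mul_eq_one_left h).symm
    rw [f]
    field_simp
  · intro i
    have p0 := G.η_nonneg ((n + 3) * (u + 1) - n + i)
    exact ⟨by positivity, by rw [div_le_one (by linarith)]; linarith⟩
  · have a1 := (periodic_letters_core hb hcode (u + 1 + 1)).1.1
    have a3 := (periodic_letters_core hb hcode u).2.2.1
    have e1 := G.ζ_eq ((n + 3) * (u + 1 + 1))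
    have e2 := G.η_succ ((n + 3) * u + 2)
    rw [a1] at e1
    rw [a3] at e2
    simp only [Nat.sub_zero, add_zero]
    rw [hq]
    push_cast at e1 e2
    have p1 := G.ζ_le ((n + 3) * (u + 1 + 1) + 1)
    have p2 := G.ζ_nonneg ((n + 3) * (u + 1 + 1))
    have p3 := G.η_le ((n + 3) * u + 2)
    have p4 := G.η_nonneg ((n + 3) * u + 2 + 1)
    have g1 : 1 / 4 ≤ G.ζ ((n + 3) * (u + 1 + 1)) := by nlinarith
    have g2 : 1 / 6 ≤ G.η ((n + 3) * u + 2 + 1) := by nlinarith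
    have g3 : 1 / (4 + G.η ((n + 3) * u + 2 + 1)) ≤ 6 / 25 := by
      rw [div_le_div_iff₀ (by linarith) (by norm_num)]; linarith
    linarith

lemma periodic_canonical (hn : 7 ≤ n) {d : ℝ} (hd : d ≤ 10 / 59)
    (hcore : ∀ u, ∀ p : ℤ × ℤ × ℤ, (p = (0, 1, 0) ∨ p = (1, 0, 0) ∨ p = (1, 0, -1)) →
      d ≤ gridNorm (G.state ((n + 3) * (u + 1) + 2)) p) {k : ℕ} (hk : n + 3 ≤ k)
    {p : ℤ × ℤ × ℤ} (hp : p ∈ gridPoints 11) (h1 : 1 ≤ |gridX (G.state k) p|)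
    (h2 : |gridX (G.state k) p| < G.a k + G.η k) : d ≤ gridNorm (G.state k) p := by
  have hr := periodic_r_nonneg hb hcode
  have hkq : k = (n + 3) * (k / (n + 3) - 1 + 1) + k % (n + 3) := by
    have h3 : 1 ≤ k / (n + 3) := (Nat.one_le_div_iff (by omega)).2 hk
    rw [Nat.sub_add_cancel h3, Nat.div_add_mod]
  have hjq : k % (n + 3) < n + 3 := Nat.mod_lt _ (by omega)
  generalize k / (n + 3) - 1 = u at hkq
  generalize k % (n + 3) = j at hkq hjq
  -- Either the eight letters from k - 4 to k + 3 all are (4,2), or k lies within the window of 17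
  -- letters around a core.
  by_cases hj : 7 ≤ j ∧ j + 4 ≤ n + 3
  · obtain ⟨k', rfl⟩ : ∃ k', k = k' + 4 := ⟨k - 4, by omega⟩
    rcases lt_gridNorm_of_window hb hr (c := fun _ => 22) (k := k') (i := 4) (j := 4)
      (fun t ht => by
        have := periodicCode_after (n := n) (u := u + 1) (t := j - 7 + t) (by omega)
        rw [hcode, ← this]; congr 1; omega) (by norm_num) settled_far hp h1 h2 with h | ⟨c, hc, -⟩
    · linarith
    · exact absurd hc List.not_mem_nil
  · obtain ⟨v, i, hi, hi', hkv⟩ : ∃ v i, 4 ≤ i ∧ i < 14 ∧ k = (n + 3) * (v + 1) - 7 + i := by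
      rcases lt_or_ge j 7 with h | h
      · exact ⟨u, j + 7, by omega, by omega, by rw [hkq, mul_add, mul_one]; omega⟩
      · exact ⟨u + 1, 7 + j - (n + 3), by omega, by omega, by
          rw [hkq, mul_add _ (u + 1) 1, mul_one]; omega⟩
    rw [hkv] at h1 h2 ⊢
    have hs := List.all_eq_true.1 settled_core i (List.mem_range'_1.2 ⟨hi, hi'⟩)
    obtain h | ⟨c, hc, hpc⟩ := lt_gridNorm_of_window hb hr (c := coreLetter)
      (k := (n + 3) * (v + 1) - 7) (i := i) (j := 17 - i)
      (fun t ht => by rw [hcode, periodicCode_core hn (by omega)]) (by omega) hs hp h1 h2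
    · linarith
    · obtain ⟨-, he, hm, hn'⟩ := mem_gridPoints.1 hp
      obtain ⟨e, m, l⟩ := p
      simp only [abs_le] at he hm hn' hpc
      push_cast at hm hn'
      obtain ⟨⟨a1, b1⟩, ⟨a2, b2⟩, ⟨a3, b3⟩⟩ := periodic_letters_core hb hcode (v + 1)
      have hq7 : (n + 3) * (v + 1) - 7 + 7 = (n + 3) * (v + 1) := by rw [mul_add, mul_one]; omega
      have hexc : i = 7 ∨ i = 8 ∨ i = 9 := by
        by_contra hne
        have : coreExceptions i = [] := by interval_cases i <;> first | rfl | omega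
        rw [this] at hc
        exact absurd hc List.not_mem_nil
      rcases hexc with rfl | rfl | rfl
      -- Two renormalization steps carry these exceptions to the critical points before the letter
      -- (5,3).
      · rw [hq7]
        have hc' : c = 816 ∨ c = 746 := by simpa [show coreExceptions 7 = [816, 746] from rfl] using hc
        have hp' : (e = 1 ∧ m = 1 ∧ l = 0) ∨ (e = 1 ∧ m = -2 ∧ l = -1) := by omega
        rw [← G.gridNorm_next, ← G.gridNorm_next]
        rcases hp' with ⟨rfl, rfl, rfl⟩ | ⟨rfl, rfl, rfl⟩
        · simpa [next, a1, b1, a2, b2] using hcore v (1, 0, 0) (by simp)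
        · simpa [next, a1, b1, a2, b2] using hcore v (1, 0, -1) (by simp)
      -- Here |X| = 1 + η = a + η exactly, a boundary case that intervals cannot decide but that the
      -- strict inequality excludes.
      · exfalso
        have hc' : c = 288 ∨ c = 240 := by
          have : coreExceptions 8 = [288, 240] := rfl
          simpa [this] using hc
        have hp' : (e = 0 ∧ m = 1 ∧ l = 1) ∨ (e = 0 ∧ m = -1 ∧ l = -1) := by omega
        rw [show (n + 3) * (v + 1) - 7 + 8 = (n + 3) * (v + 1) + 1 by omega, a2] at h2
        have h0 := G.η_nonneg ((n + 3) * (v + 1) + 1)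
        rcases hp' with ⟨rfl, rfl, rfl⟩ | ⟨rfl, rfl, rfl⟩
        · simp only [gridX, state] at h2
          push_cast at h2
          rw [abs_of_nonneg (by linarith)] at h2
          linarith
        · simp only [gridX, state] at h2
          push_cast at h2
          rw [abs_of_nonpos (by linarith)] at h2
          linarith
      · rw [show (n + 3) * (v + 1) - 7 + 9 = (n + 3) * (v + 1) + 2 by omega]
        have hc' : c = 287 ∨ c = 241 ∨ c = 793 ∨ c = 792 := by
          have : coreExceptions 9 = [287, 241, 793, 792] := rfl
          simpa [this] using hc
        have hp' : (e = 0 ∧ m = 1 ∧ l = 0) ∨ (e = 0 ∧ m = -1 ∧ l = 0) ∨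
            (e = 1 ∧ m = 0 ∧ l = 0) ∨ (e = 1 ∧ m = 0 ∧ l = -1) := by omega
        rcases hp' with ⟨rfl, rfl, rfl⟩ | ⟨rfl, rfl, rfl⟩ | ⟨rfl, rfl, rfl⟩ | ⟨rfl, rfl, rfl⟩
        · exact hcore v _ (by simp)
        · have := hcore v (0, 1, 0) (by simp)
          simpa [gridNorm, gridX, gridY] using this
        · exact hcore v _ (by simp)
        · exact hcore v _ (by simp)

/-- The middle of a long run of (4,2) resembles the golden grid, whose minimum exceeds 1/5. This
recurrent positivity gives nondegeneracy before the lower limit is known to be positive. -/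
lemma periodic_gridMin_pos {m K : ℕ} (hm : n = 2 * m) (hK : K ≤ m)
    (hKw : ∀ G G' : CodedGrid, ∀ k k' : ℕ, K ≤ k → K ≤ k' →
      (∀ i < 2 * K, G.a (k - K + i) = G'.a (k' - K + i) ∧ G.b (k - K + i) = G'.b (k' - K + i)) →
      |gridMin 11 (G.state k) - gridMin 11 (G'.state k')| < 1 / 10) (u : ℕ) :
    0 < gridMin 11 (G.state ((n + 3) * u + 3 + m)) := by
  have h := hKw G golden ((n + 3) * u + 3 + m) K (by omega) le_rfl fun i hi => by
    have := periodic_letters_after hb hcode u (t := m - K + i) (by omega)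
    rw [show (n + 3) * u + 3 + (m - K + i) = (n + 3) * u + 3 + m - K + i by omega] at this
    exact this
  rw [golden_gridMin (by norm_num)] at h
  have h5 : √5 < 5 / 2 := Real.sqrt_lt' (by norm_num) |>.2 (by norm_num)
  have h6 : 0 < √5 := by positivity
  have h7 : 1 / 5 < 1 / (2 * √5) := one_div_lt_one_div_of_lt (by positivity) (by linarith)
  have := (abs_lt.1 h).1
  linarith

end Periodic

end CodedGrid

open CodedGrid in
theorem exists_mem_gridSpectrum_near_one_sixth {ε : ℝ} (hε : 0 < ε) :
    ∃ c ∈ gridSpectrum, 1 / 6 - ε ≤ c ∧ c < 1 / 6 := by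
  -- The cap 1/12 keeps the lower limit positive.
  obtain ⟨δ, hδ, H⟩ := exists_core_close (show 0 < min ε (1 / 12) by positivity)
  obtain ⟨K, hK⟩ := exists_window (C := 11) (show (0 : ℝ) < 1 / 10 by norm_num)
  obtain ⟨m₀, hm₀⟩ := exists_pow_lt_of_lt_one (show 0 < δ / 12 by positivity)
    (by norm_num : (1 / 2 : ℝ) < 1)
  obtain ⟨m, h1, h2, h3⟩ : ∃ m, m₀ ≤ m ∧ K ≤ m ∧ 7 ≤ m :=
    ⟨max m₀ (max K 7), le_max_left _ _, (le_max_left _ _).trans (le_max_right _ _),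
      (le_max_right _ _).trans (le_max_right _ _)⟩
  have hmδ : 12 * (1 / 2 : ℝ) ^ m < δ := by
    have : (1 / 2 : ℝ) ^ m ≤ (1 / 2) ^ m₀ := pow_le_pow_of_le_one (by norm_num) (by norm_num) h1
    linarith
  obtain ⟨n, hn⟩ : ∃ n, n = 2 * m := ⟨_, rfl⟩
  obtain ⟨G, ha, hb⟩ := exists_of_letters (fun k => periodicCode n k / 5)
    (fun k => periodicCode n k % 5)
    (fun k => by rcases periodicCode_mem n k with h | h | h | h <;> simp [h])
    (fun k => by rcases periodicCode_mem n k with h | h | h | h <;> simp [h])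
  have hb5 : ∀ k, G.b k < 5 := fun k => by rw [hb]; exact Nat.mod_lt _ (by norm_num)
  have hcode : ∀ k, G.letterCode k = periodicCode n k := fun k => by
    rw [letterCode, ha, hb]; exact Nat.div_add_mod _ _
  have hM : ∀ k, G.a k ≤ 5 := fun k => by
    rw [ha]; rcases periodicCode_mem n k with h | h | h | h <;> simp [h]
  have hmul : ∀ N u : ℕ, N ≤ u → N ≤ (n + 3) * u := fun N u h =>
    h.trans (Nat.le_mul_of_pos_left _ (by omega))
  have hnd : GridNondegenerate (G.state 0) := by
    refine G.nondegenerate_of_frequently (C := 11) (by norm_num) (frequently_atTop.2 fun N => ?_)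
    exact ⟨_, by have := hmul N N le_rfl; omega, periodic_gridMin_pos hb5 hcode hn h2 hK N⟩
  obtain ⟨c, -, -, hc⟩ := exists_isLiminf (f := fun k => gridMin 11 (G.state k)) (l := 0) (u := 1)
    (Eventually.of_forall fun k => le_gridMin_iff.2 fun p _ => gridNorm_nonneg (G.state_mem k) p)
    (Frequently.of_forall fun k => (G.gridMin_le_ζ (by norm_num) k).trans (G.ζ_le k))
  have hmin1 : min ε (1 / 12 : ℝ) ≤ ε := min_le_left _ _
  have hmin2 : min ε (1 / 12 : ℝ) ≤ 1 / 12 := min_le_right _ _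
  have hmin3 : 0 < min ε (1 / 12 : ℝ) := by positivity
  have hlow : 1 / 6 - min ε (1 / 12) ≤ c := by
    refine G.le_liminf_of_canonical hM (C := 11) le_rfl (K := n + 3) hnd hc (by linarith)
      fun k hk p hp hp1 hp2 => ?_
    refine periodic_canonical hb5 hcode (by omega) (by linarith) (fun u p hp => ?_) hk hp hp1 hp2
    rw [periodic_state hb5 hcode]
    exact (H _ ((periodic_dist hb5 hcode hn u).trans_lt hmδ) p hp).le
  have hup : c ≤ 1 / (6 + 1 / 100 / 625 ^ m) := by
    refine le_of_forall_pos_lt_add fun η hη => ?_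
    obtain ⟨N, hN⟩ := eventually_atTop.1 (hc.1 η hη)
    have h4 := hN ((n + 3) * (N + 1) + 2) (by have := hmul N (N + 1) (by omega); omega)
    have h5 := periodic_center hb5 hcode hn N
    have h6 := gridMin_le (C := 11) (s := G.state ((n + 3) * (N + 1) + 2)) (p := (0, 1, 0))
      (by simp [mem_gridPoints])
    linarith
  have hlt : 1 / (6 + 1 / 100 / 625 ^ m : ℝ) < 1 / 6 :=
    one_div_lt_one_div_of_lt (by norm_num) (lt_add_of_pos_right _ (by positivity))
  exact ⟨c, ⟨by linarith, 5, G, hM, hc⟩, by linarith, hup.trans_lt hlt⟩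

/-- Closedness applied to the lower limits of the periodic words. -/
theorem one_sixth_mem_gridSpectrum : (1 / 6 : ℝ) ∈ gridSpectrum := by
  have : ∀ i : ℕ, ∃ c ∈ gridSpectrum, 1 / 6 - 1 / ((i : ℝ) + 1) ≤ c ∧ c < 1 / 6 := fun i =>
    exists_mem_gridSpectrum_near_one_sixth (by positivity)
  choose c hc h1 h2 using this
  refine mem_gridSpectrum_of_tendsto hc ?_ (by norm_num)
  refine tendsto_of_tendsto_of_tendsto_of_le_of_le (g := fun i : ℕ => 1 / 6 - 1 / ((i : ℝ) + 1))
    ?_ tendsto_const_nhds h1 fun i => (h2 i).le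
  have := (tendsto_one_div_add_atTop_nhds_zero_nat (𝕜 := ℝ)).const_sub (1 / 6)
  rwa [sub_zero] at this

/-! ### Uniform distribution for rotations and three-interval exchanges -/

lemma abs_sum_sub_shift_le (h : ℤ → ℝ) (h0 : ∀ i, 0 ≤ h i) (h1 : ∀ i, h i ≤ 1) (k : ℤ) (N : ℕ) :
    |∑ n ∈ Finset.range N, (h n - h (n - k))| ≤ |(k : ℝ)| := by
  have nat : ∀ (k : ℕ) (h : ℤ → ℝ), (∀ i, 0 ≤ h i) → (∀ i, h i ≤ 1) →
      |∑ n ∈ Finset.range N, (h n - h (n - k))| ≤ k := by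
    intro k
    induction k with
    | zero => intro h _ _; simp
    | succ k ih =>
      intro h h0 h1
      have e : ∑ n ∈ Finset.range N, (h n - h (n - (k + 1 : ℕ))) =
          ∑ n ∈ Finset.range N, (h n - h (n - k)) + (h (N - 1 - k) - h (-1 - k)) := by
        have := Finset.sum_range_sub (fun n : ℕ => h ((n : ℤ) - 1 - k)) N
        simp only [Nat.cast_zero, zero_sub] at this
        rw [← this, ← Finset.sum_add_distrib]
        refine Finset.sum_congr rfl fun n _ => ?_
        push_cast
        rw [show (n : ℤ) - (k + 1) = n - 1 - k by ring, show (n : ℤ) + 1 - 1 - k = n - k by ring]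
        ring
      rw [e]
      refine (abs_add_le _ _).trans ?_
      push_cast
      refine add_le_add (ih h h0 h1) (abs_le.2 ⟨?_, ?_⟩)
      · linarith [h0 (N - 1 - k), h1 (-1 - k)]
      · linarith [h1 (N - 1 - k), h0 (-1 - k)]
  obtain ⟨m, rfl | rfl⟩ := Int.eq_nat_or_neg k
  · simpa using nat m h h0 h1
  · have := nat m (fun i => h (i + m)) (fun i => h0 _) (fun i => h1 _)
    rw [← abs_neg, ← Finset.sum_neg_distrib]
    simpa using this

/-- For s = {kζ}, the function 1_{[0,s)}(x) - s is the coboundary {x - kζ} - {x}, so its orbit sums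
telescope and are bounded independently of N and y. -/
lemma abs_rotation_count_sub_le (ζ y : ℝ) (k : ℤ) (N : ℕ) :
    |∑ n ∈ Finset.range N, (if Int.fract (y + n * ζ) < Int.fract (k * ζ) then (1 : ℝ) else 0) -
      N * Int.fract (k * ζ)| ≤ |(k : ℝ)| := by
  have := abs_sum_sub_shift_le (fun i => Int.fract (y + i * ζ)) (fun _ => Int.fract_nonneg _)
    (fun _ => (Int.fract_lt_one _).le) k N
  rw [← abs_neg] at this
  refine le_of_eq_of_le (congrArg abs ?_) this
  have e : (N : ℝ) * Int.fract (k * ζ) = ∑ n ∈ Finset.range N, Int.fract (k * ζ) := by simp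
  rw [e, ← Finset.sum_sub_distrib, ← Finset.sum_neg_distrib]
  refine Finset.sum_congr rfl fun n _ => ?_
  set s := Int.fract (k * ζ) with hs
  set x := y + n * ζ with hx
  have e2 : y + ((n - k : ℤ) : ℝ) * ζ = x - s - (⌊k * ζ⌋ : ℤ) := by
    rw [hs, Int.fract]; push_cast; ring
  push_cast at e2
  simp only [Int.cast_natCast]
  push_cast
  rw [e2, Int.fract_sub_intCast]
  have f0 := Int.fract_nonneg x
  have f1 := Int.fract_lt_one x
  have s0 : 0 ≤ s := Int.fract_nonneg _
  have s1 : s < 1 := Int.fract_lt_one _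
  split_ifs with h
  · have : Int.fract (x - s) = Int.fract x - s + 1 :=
      Int.fract_eq_iff.2 ⟨by linarith, by linarith, ⌊x⌋ - 1, by rw [Int.fract]; push_cast; ring⟩
    rw [this]; ring
  · have : Int.fract (x - s) = Int.fract x - s :=
      Int.fract_eq_iff.2 ⟨by linarith, by linarith, ⌊x⌋, by rw [Int.fract]; ring⟩
    rw [this]; ring

lemma exists_fract_mem {ζ : ℝ} (hζ : Irrational ζ) {u v : ℝ} (hu : 0 ≤ u) (huv : u < v)
    (hv : v ≤ 1) : ∃ k : ℤ, u < Int.fract (k * ζ) ∧ Int.fract (k * ζ) < v := by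
  have hd : Dense (AddSubgroup.closure {ζ, 1} : Set ℝ) := by
    rw [dense_addSubgroupClosure_pair_iff]
    simpa using hζ
  obtain ⟨z, hz, h1, h2⟩ := hd.exists_between huv
  obtain ⟨k, m, rfl⟩ := AddSubgroup.mem_closure_pair.1 hz
  have e : Int.fract (k * ζ) = k • ζ + m • (1 : ℝ) := by
    refine Int.fract_eq_iff.2 ⟨by linarith, by linarith, -m, ?_⟩
    simp
  exact ⟨k, by rw [e]; exact ⟨h1, h2⟩⟩

/-- The lengths {kζ} are dense, and t is squeezed between two of them, for which the discrepancy is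
bounded; the endpoints t = 0 and t = 1 are direct. -/
lemma rotation_count_prefix {ζ : ℝ} (hζ : Irrational ζ) {t ε : ℝ} (ht0 : 0 ≤ t) (ht1 : t ≤ 1)
    (hε : 0 < ε) : ∃ N₀ : ℕ, ∀ N ≥ N₀, ∀ y : ℝ,
    |∑ n ∈ Finset.range N, (if Int.fract (y + n * ζ) < t then (1 : ℝ) else 0) - N * t| ≤
      ε * N := by
  have mono : ∀ (N : ℕ) (y s t : ℝ), s ≤ t →
      ∑ n ∈ Finset.range N, (if Int.fract (y + n * ζ) < s then (1 : ℝ) else 0) ≤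
      ∑ n ∈ Finset.range N, (if Int.fract (y + n * ζ) < t then (1 : ℝ) else 0) := by
    intro N y s t hst
    refine Finset.sum_le_sum fun n _ => ?_
    split_ifs with h1 h2 <;> linarith
  have upper : ∃ N₀ : ℕ, ∀ N ≥ N₀, ∀ y : ℝ,
      ∑ n ∈ Finset.range N, (if Int.fract (y + n * ζ) < t then (1 : ℝ) else 0) - N * t ≤
      ε * N := by
    rcases ht1.lt_or_eq with h | rfl
    · obtain ⟨k, k1, k2⟩ := exists_fract_mem hζ ht0 (lt_min (by linarith : t < t + ε / 2) h)
        (min_le_right _ _)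
      obtain ⟨N₀, hN₀⟩ := exists_nat_ge (|(k : ℝ)| / (ε / 2))
      refine ⟨N₀, fun N hN y => ?_⟩
      have h1 := (abs_le.1 (abs_rotation_count_sub_le ζ y k N)).2
      have h2 := mono N y _ _ k1.le
      have h3 : |(k : ℝ)| ≤ N * (ε / 2) := by
        rw [← div_le_iff₀ (by linarith)]
        exact hN₀.trans (by exact_mod_cast hN)
      have h4 : (N : ℝ) * Int.fract (k * ζ) ≤ N * (t + ε / 2) :=
        mul_le_mul_of_nonneg_left (k2.le.trans (min_le_left _ _)) (by positivity)
      linarith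
    · refine ⟨0, fun N _ y => ?_⟩
      simp only [Int.fract_lt_one, if_true]
      simp; positivity
  have lower : ∃ N₀ : ℕ, ∀ N ≥ N₀, ∀ y : ℝ, -(ε * N) ≤
      ∑ n ∈ Finset.range N, (if Int.fract (y + n * ζ) < t then (1 : ℝ) else 0) - N * t := by
    rcases ht0.lt_or_eq with h | rfl
    · obtain ⟨k, k1, k2⟩ := exists_fract_mem hζ (le_max_right (t - ε / 2) 0)
        (max_lt (by linarith : t - ε / 2 < t) h) ht1
      obtain ⟨N₀, hN₀⟩ := exists_nat_ge (|(k : ℝ)| / (ε / 2))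
      refine ⟨N₀, fun N hN y => ?_⟩
      have h1 := (abs_le.1 (abs_rotation_count_sub_le ζ y k N)).1
      have h2 := mono N y _ _ k2.le
      have h3 : |(k : ℝ)| ≤ N * (ε / 2) := by
        rw [← div_le_iff₀ (by linarith)]
        exact hN₀.trans (by exact_mod_cast hN)
      have h4 : (N : ℝ) * (t - ε / 2) ≤ N * Int.fract (k * ζ) :=
        mul_le_mul_of_nonneg_left ((le_max_left _ _).trans k1.le) (by positivity)
      linarith
    · refine ⟨0, fun N _ y => ?_⟩
      have : 0 ≤ ∑ n ∈ Finset.range N, (if Int.fract (y + n * ζ) < 0 then (1 : ℝ) else 0) :=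
        Finset.sum_nonneg fun n _ => by split_ifs <;> norm_num
      have : 0 ≤ ε * N := by positivity
      linarith
  obtain ⟨N₁, h1⟩ := upper
  obtain ⟨N₂, h2⟩ := lower
  exact ⟨max N₁ N₂, fun N hN y => abs_le.2
    ⟨h2 N ((le_max_right _ _).trans hN) y, h1 N ((le_max_left _ _).trans hN) y⟩⟩

/-- Irrational rotations are uniformly distributed, uniformly in the starting point. -/
theorem rotation_count_Ico {ζ : ℝ} (hζ : Irrational ζ) {s t ε : ℝ} (hs : 0 ≤ s) (hst : s ≤ t)
    (ht : t ≤ 1) (hε : 0 < ε) : ∃ N₀ : ℕ, ∀ N ≥ N₀, ∀ y : ℝ,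
    |∑ n ∈ Finset.range N, (Set.Ico s t).indicator 1 (Int.fract (y + n * ζ)) - N * (t - s)| ≤
      ε * N := by
  obtain ⟨N₁, h1⟩ := rotation_count_prefix hζ hs (hst.trans ht) (half_pos hε)
  obtain ⟨N₂, h2⟩ := rotation_count_prefix hζ (hs.trans hst) ht (half_pos hε)
  refine ⟨max N₁ N₂, fun N hN y => ?_⟩
  have g1 := abs_le.1 (h1 N ((le_max_left _ _).trans hN) y)
  have g2 := abs_le.1 (h2 N ((le_max_right _ _).trans hN) y)
  have e : ∑ n ∈ Finset.range N, (Set.Ico s t).indicator 1 (Int.fract (y + n * ζ)) =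
      ∑ n ∈ Finset.range N, (if Int.fract (y + n * ζ) < t then (1 : ℝ) else 0) -
      ∑ n ∈ Finset.range N, (if Int.fract (y + n * ζ) < s then (1 : ℝ) else 0) := by
    rw [← Finset.sum_sub_distrib]
    refine Finset.sum_congr rfl fun n _ => ?_
    simp only [Set.indicator, Set.mem_Ico, Pi.one_apply]
    rcases lt_or_ge (Int.fract (y + n * ζ)) s with h | h
    · simp [not_le.2 h, h, h.trans_le hst]
    · simp [h, not_lt.2 h]
  rw [e, abs_le]
  constructor <;> linarith [g1.1, g1.2, g2.1, g2.2]

/-- The time of the visits of the orbit of `x` under the rotation of which the three-interval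
exchange is the first return map. -/
noncomputable def returnTime (α β x : ℝ) : ℕ → ℕ
  | 0 => 0
  | k + 1 => returnTime α β x k + if (threeIET α β)^[k] x ∈ Set.Ico α (α + β) then 2 else 1

/-- The number of visits of an orbit to a set. -/
noncomputable def visits (f : ℝ → ℝ) (S : Set ℝ) (N : ℕ) (x : ℝ) : ℝ :=
  ∑ k ∈ Finset.range N, S.indicator 1 (f^[k] x)

lemma returnTime_eq (α β x : ℝ) (N : ℕ) :
    (returnTime α β x N : ℝ) = N + visits (threeIET α β) (Set.Ico α (α + β)) N x := by
  induction N with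
  | zero => simp [returnTime, visits]
  | succ N ih =>
    rw [returnTime, visits, Finset.sum_range_succ, ← visits]
    push_cast
    rw [ih]
    by_cases h : (threeIET α β)^[N] x ∈ Set.Ico α (α + β)
    · rw [if_pos h, Set.indicator_of_mem h, Pi.one_apply]; ring
    · rw [if_neg h, Set.indicator_of_notMem h]; ring

lemma visits_nonneg (f : ℝ → ℝ) (S : Set ℝ) (N : ℕ) (x : ℝ) : 0 ≤ visits f S N x :=
  Finset.sum_nonneg fun _ _ => Set.indicator_nonneg (fun _ _ => zero_le_one) _

lemma visits_le (f : ℝ → ℝ) (S : Set ℝ) (N : ℕ) (x : ℝ) : visits f S N x ≤ N := by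
  calc visits f S N x ≤ ∑ k ∈ Finset.range N, (1 : ℝ) :=
        Finset.sum_le_sum fun _ _ => Set.indicator_le' (fun _ _ => le_rfl) (fun _ _ => zero_le_one) _
    _ = N := by simp

section IET

variable {α β : ℝ} (hα : 0 < α) (hβ : 0 < β) (hαβ : α + β < 1)
include hα hβ hαβ

lemma threeIET_mem {x : ℝ} (hx : x ∈ Set.Ico (0 : ℝ) 1) : threeIET α β x ∈ Set.Ico (0 : ℝ) 1 := by
  obtain ⟨h0, h1⟩ := hx
  unfold threeIET
  split_ifs with h2 h3 <;> constructor <;> linarith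

lemma iterate_threeIET_mem {x : ℝ} (hx : x ∈ Set.Ico (0 : ℝ) 1) (k : ℕ) :
    (threeIET α β)^[k] x ∈ Set.Ico (0 : ℝ) 1 := by
  induction k with
  | zero => exact hx
  | succ k ih => rw [Function.iterate_succ_apply']; exact threeIET_mem hα hβ hαβ ih

omit hα hβ hαβ in
lemma iterate_threeIET_eq (x : ℝ) (k : ℕ) : ∃ i : ℤ,
    (threeIET α β)^[k] x = x + returnTime α β x k * (1 - α) - i * (1 + β) := by
  induction k with
  | zero => exact ⟨0, by simp [returnTime]⟩
  | succ k ih =>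
    obtain ⟨i, hi⟩ := ih
    rw [Function.iterate_succ_apply', returnTime]
    set y := (threeIET α β)^[k] x
    unfold threeIET
    by_cases h1 : y < α
    · refine ⟨i, ?_⟩
      rw [if_pos h1, if_neg (fun h => not_lt.2 h.1 h1), hi]; push_cast; ring
    · by_cases h2 : y < α + β
      · refine ⟨i + 1, ?_⟩
        rw [if_neg h1, if_pos h2, if_pos ⟨not_lt.1 h1, h2⟩, hi]; push_cast; ring
      · refine ⟨i + 1, ?_⟩
        rw [if_neg h1, if_neg h2, if_neg (fun h => h2 h.2), hi]; push_cast; ring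

omit hα hαβ in
lemma fract_rotation {x z : ℝ} {m : ℕ} {i : ℤ} (hz : 0 ≤ z) (hz' : z < 1 + β)
    (h : z = x + m * (1 - α) - i * (1 + β)) :
    Int.fract (x / (1 + β) + m * ((1 - α) / (1 + β))) = z / (1 + β) := by
  have h1 : 0 < 1 + β := by linarith
  refine Int.fract_eq_iff.2 ⟨by positivity, by rw [div_lt_one h1]; exact hz', i, ?_⟩
  rw [h]; field_simp; ring

/-- The rotation orbit consists of the orbit of the exchange together with the intermediate points y
+ 1 - α ∈ [1, 1+β), one for each visit y to the middle interval. Intervals below 1 see the former,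
intervals above 1 the latter. -/
lemma visits_eq_rotation {x : ℝ} (hx : x ∈ Set.Ico (0 : ℝ) 1) {a b : ℝ} (hab : b ≤ 1 ∨ 1 ≤ a)
    (N : ℕ) :
    ∑ j ∈ Finset.range (returnTime α β x N), (Set.Ico (a / (1 + β)) (b / (1 + β))).indicator
      (1 : ℝ → ℝ) (Int.fract (x / (1 + β) + j * ((1 - α) / (1 + β)))) =
    if b ≤ 1 then visits (threeIET α β) (Set.Ico a b) N x else
      ∑ k ∈ Finset.range N, (Set.Ico α (α + β) ∩ Set.Ico (a - (1 - α)) (b - (1 - α))).indicator 1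
        ((threeIET α β)^[k] x) := by
  have hl : 0 < 1 + β := by linarith
  have ind : ∀ z, (Set.Ico (a / (1 + β)) (b / (1 + β))).indicator (1 : ℝ → ℝ) (z / (1 + β)) =
      (Set.Ico a b).indicator 1 z := by
    intro z
    simp only [Set.indicator, Set.mem_Ico, div_le_div_iff_of_pos_right hl,
      div_lt_div_iff_of_pos_right hl]
    rfl
  induction N with
  | zero => simp [returnTime, visits]
  | succ N ih =>
    obtain ⟨i, hi⟩ := iterate_threeIET_eq (α := α) (β := β) x N
    have hy := iterate_threeIET_mem hα hβ hαβ hx N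
    have e1 := fract_rotation hβ hy.1 (by linarith [hy.2]) hi
    simp only [visits] at ih ⊢
    rw [returnTime, Finset.sum_range_succ, Finset.sum_range_succ]
    set y := (threeIET α β)^[N] x
    by_cases h : y ∈ Set.Ico α (α + β)
    · have e2 : Int.fract (x / (1 + β) + ((returnTime α β x N + 1 : ℕ) : ℝ) *
          ((1 - α) / (1 + β))) = (y + (1 - α)) / (1 + β) :=
        fract_rotation hβ (i := i) (by linarith [h.1]) (by linarith [h.2])
          (by rw [hi]; push_cast; ring)
      rw [if_pos h, Finset.sum_range_succ, Finset.sum_range_succ, ih, e1, e2, ind, ind]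
      split_ifs with hb
      · have : (Set.Ico a b).indicator (1 : ℝ → ℝ) (y + (1 - α)) = 0 :=
          Set.indicator_of_notMem (fun hh => by linarith [hh.2, h.1]) _
        rw [this, add_zero]
      · have ha : 1 ≤ a := hab.resolve_left hb
        have : (Set.Ico a b).indicator (1 : ℝ → ℝ) y = 0 :=
          Set.indicator_of_notMem (fun hh => by linarith [hh.1, hy.2]) _
        rw [this, add_zero]
        congr 1
        simp only [Set.indicator, Set.mem_inter_iff, h, true_and, Set.mem_Ico]
        congr 1
        rw [sub_le_iff_le_add, lt_sub_iff_add_lt]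
    · rw [if_neg h, Finset.sum_range_succ, ih, e1, ind]
      split_ifs with hb
      · rfl
      · have ha : 1 ≤ a := hab.resolve_left hb
        have : (Set.Ico a b).indicator (1 : ℝ → ℝ) y = 0 :=
          Set.indicator_of_notMem (fun hh => by linarith [hh.1, hy.2]) _
        rw [this, Set.indicator_of_notMem (fun hh => h hh.1)]

/-- The orbits of a three-interval exchange visit the middle interval with frequency `β`, uniformly
in the starting point. -/
theorem visits_middle (hirr : Irrational ((1 - α) / (1 + β))) {ε : ℝ} (hε : 0 < ε) :
    ∃ N₀ : ℕ, ∀ N ≥ N₀, ∀ x ∈ Set.Ico (0 : ℝ) 1,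
      |visits (threeIET α β) (Set.Ico α (α + β)) N x - β * N| ≤ ε * N := by
  have hl : 0 < 1 + β := by linarith
  obtain ⟨N₀, h⟩ := rotation_count_Ico hirr (s := 1 / (1 + β)) (t := (1 + β) / (1 + β))
    (ε := ε / (2 * (1 + β))) (by positivity) (by gcongr; linarith) (by rw [div_self hl.ne'])
    (by positivity)
  refine ⟨N₀, fun N hN x hx => ?_⟩
  have hrt := returnTime_eq α β x N
  have hv0 := visits_nonneg (threeIET α β) (Set.Ico α (α + β)) N x
  have hv1 := visits_le (threeIET α β) (Set.Ico α (α + β)) N x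
  have hge : N₀ ≤ returnTime α β x N := by
    have : (N : ℝ) ≤ returnTime α β x N := by linarith
    exact hN.trans (by exact_mod_cast this)
  have h1 := h _ hge (x / (1 + β))
  rw [visits_eq_rotation hα hβ hαβ hx (Or.inr le_rfl), if_neg (by linarith)] at h1
  have e : Set.Ico α (α + β) ∩ Set.Ico (1 - (1 - α)) (1 + β - (1 - α)) = Set.Ico α (α + β) := by
    rw [show 1 - (1 - α) = α by ring, show 1 + β - (1 - α) = α + β by ring, Set.inter_self]
  rw [e] at h1
  change |visits (threeIET α β) (Set.Ico α (α + β)) N x - _| ≤ _ at h1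
  rw [hrt] at h1
  set V := visits (threeIET α β) (Set.Ico α (α + β)) N x
  -- The rotation visits [1, 1+β) exactly V times in N + V steps; solving V ≈ (N + V)β/(1+β) gives V
  -- ≈ βN.
  have e2 : V - (N + V) * ((1 + β) / (1 + β) - 1 / (1 + β)) = (V - β * N) / (1 + β) := by
    field_simp; ring
  rw [e2, abs_div, abs_of_pos hl, div_le_iff₀ hl] at h1
  refine h1.trans ?_
  have e3 : ε / (2 * (1 + β)) * (N + V) * (1 + β) = ε / 2 * (N + V) := by field_simp
  rw [e3]
  nlinarith

/-- The orbits of a three-interval exchange are uniformly distributed, uniformly in the starting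
point. -/
theorem visits_Ico (hirr : Irrational ((1 - α) / (1 + β))) {a b ε : ℝ} (ha : 0 ≤ a) (hab : a ≤ b)
    (hb : b ≤ 1) (hε : 0 < ε) : ∃ N₀ : ℕ, ∀ N ≥ N₀, ∀ x ∈ Set.Ico (0 : ℝ) 1,
      |visits (threeIET α β) (Set.Ico a b) N x - (b - a) * N| ≤ ε * N := by
  have hl : 0 < 1 + β := by linarith
  obtain ⟨N₁, h1⟩ := visits_middle hα hβ hαβ hirr (half_pos hε)
  obtain ⟨N₂, h2⟩ := rotation_count_Ico hirr (s := a / (1 + β)) (t := b / (1 + β))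
    (ε := ε / 4) (by positivity) (by gcongr) (by rw [div_le_one hl]; linarith) (by positivity)
  refine ⟨max N₁ N₂, fun N hN x hx => ?_⟩
  have hrt := returnTime_eq α β x N
  have hv0 := visits_nonneg (threeIET α β) (Set.Ico α (α + β)) N x
  have hv1 := visits_le (threeIET α β) (Set.Ico α (α + β)) N x
  have hge : N₂ ≤ returnTime α β x N := by
    have : (N : ℝ) ≤ returnTime α β x N := by linarith
    exact ((le_max_right _ _).trans hN).trans (by exact_mod_cast this)
  have g1 := h1 N ((le_max_left _ _).trans hN) x hx
  have g2 := h2 _ hge (x / (1 + β))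
  rw [visits_eq_rotation hα hβ hαβ hx (Or.inl hb), if_pos hb, hrt] at g2
  set V := visits (threeIET α β) (Set.Ico α (α + β)) N x
  have e : visits (threeIET α β) (Set.Ico a b) N x - (b - a) * N =
      (visits (threeIET α β) (Set.Ico a b) N x - (N + V) * (b / (1 + β) - a / (1 + β))) +
      (V - β * N) * ((b - a) / (1 + β)) := by
    field_simp; ring
  rw [e]
  refine (abs_add_le _ _).trans ?_
  have h3 : |(V - β * N) * ((b - a) / (1 + β))| ≤ ε / 2 * N := by
    rw [abs_mul]
    have : |(b - a) / (1 + β)| ≤ 1 := by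
      rw [abs_of_nonneg (div_nonneg (by linarith) hl.le), div_le_one hl]; linarith
    exact (mul_le_of_le_one_right (abs_nonneg _) this).trans g1
  nlinarith

end IET

/-! ### Cells of the natural coding -/

/-- The points `x`, `y` have the same itinerary up to time `n`. -/
def SameItinerary (α β : ℝ) (n : ℕ) (x y : ℝ) : Prop :=
  ∀ k < n, natPartition α β ((threeIET α β)^[k] x) = natPartition α β ((threeIET α β)^[k] y)

/-- The endpoints of the cells of order `n`. -/
def cutPoints (α β : ℝ) (n : ℕ) : Set ℝ :=
  {z | z = 0 ∨ z = 1 ∨ (z ∈ Set.Ico (0 : ℝ) 1 ∧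
    ∃ k < n, (threeIET α β)^[k] z = α ∨ (threeIET α β)^[k] z = α + β)}

section IET

variable {α β : ℝ} {n : ℕ} {x y z : ℝ}

lemma SameItinerary.symm (h : SameItinerary α β n x y) : SameItinerary α β n y x :=
  fun k hk => (h k hk).symm

lemma SameItinerary.mono {m : ℕ} (h : SameItinerary α β n x y) (hm : m ≤ n) :
    SameItinerary α β m x y := fun k hk => h k (hk.trans_le hm)

lemma threeIET_sub_eq (h : natPartition α β x = natPartition α β y) :
    threeIET α β y - threeIET α β x = y - x := by
  unfold natPartition at h
  unfold threeIET
  split_ifs at h ⊢ <;> first | exact absurd h (by decide) | ring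

lemma SameItinerary.iterate_sub (h : SameItinerary α β n x y) :
    (threeIET α β)^[n] y - (threeIET α β)^[n] x = y - x := by
  induction n with
  | zero => rfl
  | succ n ih =>
    rw [Function.iterate_succ_apply', Function.iterate_succ_apply',
      threeIET_sub_eq (h n (Nat.lt_succ_self n)), ih (h.mono (Nat.le_succ n))]

lemma natPartition_mono (hβ : 0 < β) (h : x ≤ y) : natPartition α β x ≤ natPartition α β y := by
  unfold natPartition
  split_ifs <;> first | exact le_rfl | (exfalso; linarith) | decide

lemma natPartition_lt (hβ : 0 < β) (h : x < y) (hy : y = α ∨ y = α + β) :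
    natPartition α β x ≠ natPartition α β y := by
  unfold natPartition
  rcases hy with rfl | rfl
  · rw [if_pos h, if_neg (lt_irrefl _), if_pos (by linarith)]; decide
  · rw [if_neg (show ¬ (α + β < α) by linarith), if_neg (lt_irrefl (α + β)), if_pos h]
    split_ifs <;> decide

lemma exists_cut_of_natPartition_ne (hxy : x ≤ y)
    (h : natPartition α β x ≠ natPartition α β y) : ∃ δ, (δ = α ∨ δ = α + β) ∧ x < δ ∧ δ ≤ y := by
  unfold natPartition at h
  by_contra! hne
  have h1 := hne α (Or.inl rfl)
  have h2 := hne (α + β) (Or.inr rfl)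
  apply h
  split_ifs <;> first | rfl | (exfalso; linarith) | (exfalso; linarith [h1 (by assumption)]) |
    (exfalso; linarith [h2 (by assumption)])

/-- As long as itineraries agree, the iterates are the same translation and keep the order; the
label is monotone, so it is squeezed. -/
lemma SameItinerary.of_mem_Icc (hβ : 0 < β) (h : SameItinerary α β n x y) (hz : z ∈ Set.Icc x y) :
    SameItinerary α β n x z := by
  induction n with
  | zero => exact fun k hk => absurd hk (Nat.not_lt_zero k)
  | succ n ih =>
    have h1 := ih (h.mono (Nat.le_succ n))
    intro k hk
    rcases Nat.lt_succ_iff_lt_or_eq.1 hk with hk | rfl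
    · exact h1 k hk
    · have h2 := h1.iterate_sub
      have h3 := (h.mono (Nat.le_succ k)).iterate_sub
      have h4 : natPartition α β ((threeIET α β)^[k] x) ≤ natPartition α β ((threeIET α β)^[k] z) :=
        natPartition_mono hβ (by linarith [hz.1])
      have h5 : natPartition α β ((threeIET α β)^[k] z) ≤ natPartition α β ((threeIET α β)^[k] y) :=
        natPartition_mono hβ (by linarith [hz.2])
      have h6 := h k (Nat.lt_succ_self k)
      exact le_antisymm h4 (h6 ▸ h5)

lemma not_sameItinerary_of_cut (hβ : 0 < β) (hxz : x < z) {k : ℕ} (hk : k < n)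
    (hz : (threeIET α β)^[k] z = α ∨ (threeIET α β)^[k] z = α + β) :
    ¬ SameItinerary α β n x z := by
  intro h
  have h1 := (h.mono hk.le).iterate_sub
  exact natPartition_lt hβ (by linarith) hz (h k hk)

lemma returnTime_mono (α β x : ℝ) : StrictMono (returnTime α β x) :=
  strictMono_nat_of_lt_succ fun k => by rw [returnTime]; split_ifs <;> omega

lemma returnTime_le (α β x : ℝ) (k : ℕ) : returnTime α β x k ≤ 2 * k := by
  induction k with
  | zero => simp [returnTime]
  | succ k ih => rw [returnTime]; split_ifs <;> omega

lemma zero_mem_cutPoints : (0 : ℝ) ∈ cutPoints α β n := Or.inl rfl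

lemma one_mem_cutPoints : (1 : ℝ) ∈ cutPoints α β n := Or.inr (Or.inl rfl)

lemma cutPoints_le_one (hz : z ∈ cutPoints α β n) : z ≤ 1 := by
  rcases hz with rfl | rfl | h
  · norm_num
  · exact le_rfl
  · exact h.1.2.le

lemma cutPoints_nonneg (hz : z ∈ cutPoints α β n) : 0 ≤ z := by
  rcases hz with rfl | rfl | h
  · exact le_rfl
  · norm_num
  · exact h.1.1

/-- The cut points are points of the lattice generated by `1 - α`, `1 + β`, up to an integer. -/
lemma exists_of_mem_cutPoints (hz : z ∈ cutPoints α β n) : ∃ e i : ℤ, ∃ M : ℕ, (e = 0 ∨ e = 1) ∧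
    (M = 0 ∨ (z ∈ Set.Ico (0 : ℝ) 1 ∧ M ≤ returnTime α β z n)) ∧
    z = e - M * (1 - α) + i * (1 + β) := by
  rcases hz with rfl | rfl | ⟨hz, k, hk, h⟩
  · exact ⟨0, 0, 0, Or.inl rfl, Or.inl rfl, by simp⟩
  · exact ⟨1, 0, 0, Or.inr rfl, Or.inl rfl, by simp⟩
  · obtain ⟨i, hi⟩ := iterate_threeIET_eq (α := α) (β := β) z k
    have hM : returnTime α β z k + 1 ≤ returnTime α β z n := returnTime_mono α β z hk
    -- Since α = 1 - (1-α) and α + β = -(1-α) + (1+β), one more rotation step leads from the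
    -- discontinuities to 1 and to 0 modulo 1+β. This explains e and the extra unit in M.
    rcases h with h | h
    · refine ⟨1, i, _, Or.inr rfl, Or.inr ⟨hz, hM⟩, ?_⟩
      push_cast; linarith
    · refine ⟨0, i + 1, _, Or.inl rfl, Or.inr ⟨hz, hM⟩, ?_⟩
      push_cast; linarith

variable (hα : 0 < α) (hβ : 0 < β) (hαβ : α + β < 1)

-- A cut point is determined by e and M, because its integer i is fixed by reduction modulo 1+β.
include hβ in
lemma finite_cutPoints : (cutPoints α β n).Finite := by
  have hl : 0 < 1 + β := by linarith
  have hsub : cutPoints α β n ⊆ (fun p : ℕ × ℕ =>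
      (1 + β) * Int.fract ((p.1 : ℝ) / (1 + β) - p.2 * ((1 - α) / (1 + β)))) ''
      (Finset.range 2 ×ˢ Finset.range (2 * n + 1) : Finset (ℕ × ℕ)) := by
    intro z hz
    have hz0 := cutPoints_nonneg hz
    have hz1 := cutPoints_le_one hz
    obtain ⟨e, i, M, he, hM, h⟩ := exists_of_mem_cutPoints hz
    have hM' : M ≤ 2 * n := by
      rcases hM with h | h
      · omega
      · exact h.2.trans (returnTime_le _ _ _ _)
    refine ⟨(e.toNat, M), by simp; omega, ?_⟩
    have e1 : ((e.toNat : ℕ) : ℝ) = e := by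
      have : ((e.toNat : ℕ) : ℤ) = e := Int.toNat_of_nonneg (by omega)
      exact_mod_cast this
    have : Int.fract ((e.toNat : ℝ) / (1 + β) - M * ((1 - α) / (1 + β))) = z / (1 + β) := by
      rw [e1]
      refine Int.fract_eq_iff.2 ⟨by positivity, by rw [div_lt_one hl]; linarith, -i, ?_⟩
      rw [h]; field_simp; push_cast; ring
    simp only
    rw [this]; field_simp
  exact (Set.Finite.image _ (Finset.finite_toSet _)).subset hsub

include hβ in
/-- The set of points with a given itinerary is an interval between consecutive cut points. -/
theorem exists_cell (n : ℕ) (hx : x ∈ Set.Ico (0 : ℝ) 1) : ∃ p ∈ cutPoints α β n,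
    ∃ p' ∈ cutPoints α β n, p ≤ x ∧ x < p' ∧
    (∀ z ∈ cutPoints α β n, z ≤ x → z ≤ p) ∧ (∀ z ∈ cutPoints α β n, x < z → p' ≤ z) ∧
    ∀ y ∈ Set.Ico (0 : ℝ) 1, SameItinerary α β n x y ↔ y ∈ Set.Ico p p' := by
  have hfin := finite_cutPoints (α := α) (n := n) hβ
  obtain ⟨p, ⟨hp, hpx⟩, hpmax⟩ := Set.exists_max_image _ id
    (hfin.subset (Set.inter_subset_left (t := {z | z ≤ x}))) ⟨0, zero_mem_cutPoints, hx.1⟩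
  obtain ⟨p', ⟨hp', hpx'⟩, hpmin⟩ := Set.exists_min_image _ id
    (hfin.subset (Set.inter_subset_left (t := {z | x < z}))) ⟨1, one_mem_cutPoints, hx.2⟩
  replace hpmax : ∀ z ∈ cutPoints α β n, z ≤ x → z ≤ p := fun z h1 h2 => hpmax z ⟨h1, h2⟩
  replace hpmin : ∀ z ∈ cutPoints α β n, x < z → p' ≤ z := fun z h1 h2 => hpmin z ⟨h1, h2⟩
  refine ⟨p, hp, p', hp', hpx, hpx', fun z hz => hpmax z hz, fun z hz => hpmin z hz, ?_⟩
  intro y hy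
  constructor
  · intro h
    constructor
    · by_contra! hlt
      have h1 : SameItinerary α β n y p := h.symm.of_mem_Icc hβ ⟨hlt.le, hpx⟩
      rcases hp with rfl | rfl | ⟨-, k, hk, hc⟩
      · linarith [hy.1]
      · linarith [hx.2, show (1 : ℝ) ≤ x from hpx]
      · exact not_sameItinerary_of_cut hβ hlt hk hc h1
    · by_contra! hle
      have h1 : SameItinerary α β n x p' := h.of_mem_Icc hβ ⟨le_of_lt hpx', hle⟩
      rcases hp' with rfl | rfl | ⟨-, k, hk, hc⟩
      · linarith [hx.1, show x < 0 from hpx']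
      · linarith [hy.2]
      · exact not_sameItinerary_of_cut hβ hpx' hk hc h1
  · intro hyp
    have aux : ∀ u v, u ∈ Set.Ico (0 : ℝ) 1 → v ∈ Set.Ico (0 : ℝ) 1 → u ≤ v →
        (∀ z ∈ cutPoints α β n, u < z → ¬ z ≤ v) → SameItinerary α β n u v := by
      intro u v hu hv huv hno
      have : ∀ m ≤ n, SameItinerary α β m u v := by
        intro m hm
        induction m with
        | zero => exact fun k hk => absurd hk (Nat.not_lt_zero k)
        | succ m ih =>
          have h1 := ih (by omega)
          intro k hk
          rcases Nat.lt_succ_iff_lt_or_eq.1 hk with hk | rfl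
          · exact h1 k hk
          · by_contra hne
            have h2 := h1.iterate_sub
            obtain ⟨δ, hδ, d1, d2⟩ := exists_cut_of_natPartition_ne (by linarith) hne
            -- The point between u and v that the common translation carries to the discontinuity δ;
            -- it is a cut point, against the hypothesis.
            set z := u + (δ - (threeIET α β)^[k] u) with hz
            have hzm : z ∈ Set.Icc u v := ⟨by linarith, by linarith⟩
            have h3 := (h1.of_mem_Icc hβ hzm).iterate_sub
            have h4 : (threeIET α β)^[k] z = δ := by linarith
            refine hno z (Or.inr (Or.inr ⟨⟨hu.1.trans hzm.1, hzm.2.trans_lt hv.2⟩, k, hm, ?_⟩))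
              (by linarith) hzm.2
            rw [h4]; exact hδ
      exact this n le_rfl
    rcases le_total x y with h | h
    · exact aux x y hx hy h fun z hz h1 h2 => by linarith [hpmin z hz h1, hyp.2]
    · exact (aux y x hy hx h fun z hz h1 h2 => by linarith [hpmax z hz h2, hyp.1]).symm

include hα hβ hαβ in
/-- The time at which the orbit under the rotation hits a given point. -/
lemma exists_returnTime_eq (hx : x ∈ Set.Ico (0 : ℝ) 1) {δ : ℝ} (hδ : δ ∈ Set.Ico (0 : ℝ) 1)
    {m : ℕ} {i : ℤ} (h : δ = x + m * (1 - α) - i * (1 + β)) :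
    ∃ k, returnTime α β x k = m ∧ (threeIET α β)^[k] x = δ := by
  have hl : 0 < 1 + β := by linarith
  have f := fract_rotation (α := α) hβ hδ.1 (by linarith [hδ.2]) h
  obtain ⟨k, hk, hk'⟩ : ∃ k, returnTime α β x k ≤ m ∧ m < returnTime α β x (k + 1) := by
    classical
    have hex : ∃ k, m < returnTime α β x k :=
      ⟨m + 1, (Nat.lt_succ_self m).trans_le (returnTime_mono α β x).le_apply⟩
    obtain ⟨k, hk⟩ : ∃ k, Nat.find hex = k + 1 := by
      refine Nat.exists_eq_succ_of_ne_zero fun h0 => ?_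
      have := Nat.find_spec hex
      rw [h0] at this
      exact absurd this (Nat.not_lt_zero m)
    exact ⟨k, not_lt.1 (Nat.find_min hex (by omega)), hk ▸ Nat.find_spec hex⟩
  obtain ⟨i', hi'⟩ := iterate_threeIET_eq (α := α) (β := β) x k
  have hy := iterate_threeIET_mem hα hβ hαβ hx k
  rcases hk.lt_or_eq with hlt | heq
  -- A rotation time strictly between two return times has its point in [1, 1+β), while δ < 1.
  · exfalso
    rw [returnTime] at hk'
    split_ifs at hk' with hmid
    · have hm : m = returnTime α β x k + 1 := by omega
      have f' := fract_rotation (α := α) (x := x) (z := (threeIET α β)^[k] x + (1 - α)) (m := m)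
        (i := i') hβ (by linarith [hmid.1]) (by linarith [hmid.2]) (by rw [hm, hi']; push_cast; ring)
      rw [f, div_left_inj' hl.ne'] at f'
      linarith [hδ.2, hmid.1]
    · omega
  · refine ⟨k, heq, ?_⟩
    rw [heq] at hi'
    have f' := fract_rotation (α := α) hβ hy.1 (by linarith [hy.2]) hi'
    rw [f, div_left_inj' hl.ne'] at f'
    exact f'.symm

end IET

/-! ### The invariant measure of the natural coding -/

lemma factor_eq_iff {A : Type*} {x y : ℕ → A} {r s n : ℕ} :
    factor x r n = factor y s n ↔ ∀ k < n, x (r + k) = y (s + k) := by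
  rw [factor, factor, List.ofFn_injective.eq_iff, funext_iff]
  exact ⟨fun h k hk => h ⟨k, hk⟩, fun h i => h i i.2⟩

lemma iterate_shift {A : Type*} (x : ℕ → A) (k j : ℕ) : shift^[k] x j = x (k + j) := by
  induction k generalizing j with
  | zero => simp
  | succ k ih => rw [Function.iterate_succ_apply', shift, ih]; congr 1; omega

lemma measurable_shift {A : Type*} [MeasurableSpace A] : Measurable (shift : (ℕ → A) → ℕ → A) :=
  measurable_pi_lambda _ fun n => measurable_pi_apply (n + 1)

/-- The set of all sequences that begin with a given word. -/
def cylinderSet (w : List (Fin 3)) : Set (ℕ → Fin 3) := {ω | factor ω 0 w.length = w}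

lemma mem_cylinderSet {w : List (Fin 3)} {ω : ℕ → Fin 3} :
    ω ∈ cylinderSet w ↔ factor ω 0 w.length = w := Iff.rfl

lemma mem_cylinderSet_iff {w : List (Fin 3)} {ω : ℕ → Fin 3} :
    ω ∈ cylinderSet w ↔ ∀ (k : ℕ) (h : k < w.length), ω k = w[k] := by
  rw [mem_cylinderSet, List.ext_getElem_iff]
  simp [factor]

lemma measurableSet_cylinderSet (w : List (Fin 3)) : MeasurableSet (cylinderSet w) := by
  have : cylinderSet w = ⋂ k, ⋂ h : k < w.length, {ω : ℕ → Fin 3 | ω k = w[k]} := by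
    ext ω
    simp [mem_cylinderSet_iff]
  rw [this]
  exact MeasurableSet.iInter fun k => MeasurableSet.iInter fun _ =>
    measurable_pi_apply k (MeasurableSet.singleton _)

lemma generateFrom_cylinderSet : (MeasurableSpace.pi : MeasurableSpace (ℕ → Fin 3)) =
    MeasurableSpace.generateFrom (Set.range cylinderSet) := by
  refine le_antisymm ?_ (MeasurableSpace.generateFrom_le ?_)
  · refine iSup_le fun i => ?_
    rintro _ ⟨s, -, rfl⟩
    have : (fun ω : ℕ → Fin 3 => ω i) ⁻¹' s =
        ⋃ w ∈ {w : List (Fin 3) | ∃ h : i < w.length, w[i] ∈ s}, cylinderSet w := by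
      ext ω
      simp only [Set.mem_preimage, Set.mem_ofPred_eq, Set.mem_iUnion, mem_cylinderSet_iff, exists_prop]
      constructor
      · intro h
        refine ⟨List.ofFn (fun j : Fin (i + 1) => ω j), ⟨by rw [List.length_ofFn]; omega,
          by rw [List.getElem_ofFn]; exact h⟩, fun k hk => by rw [List.getElem_ofFn]⟩
      · rintro ⟨w, ⟨h, hw⟩, hω⟩
        rw [hω i h]; exact hw
    rw [this]
    exact MeasurableSet.biUnion (Set.to_countable _) fun w _ =>
      MeasurableSpace.measurableSet_generateFrom ⟨w, rfl⟩
  · rintro _ ⟨w, rfl⟩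
    exact measurableSet_cylinderSet w

lemma isPiSystem_cylinderSet : IsPiSystem (Set.range cylinderSet) := by
  have aux : ∀ v w : List (Fin 3), v.length ≤ w.length → (cylinderSet v ∩ cylinderSet w).Nonempty →
      cylinderSet v ∩ cylinderSet w = cylinderSet w := by
    rintro v w hl ⟨ω, h1, h2⟩
    refine Set.inter_eq_right.2 fun ω' h' => ?_
    rw [mem_cylinderSet_iff] at *
    intro k hk
    rw [h' k (hk.trans_le hl), ← h2 k (hk.trans_le hl), h1 k hk]
  rintro _ ⟨v, rfl⟩ _ ⟨w, rfl⟩ hne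
  rcases le_total v.length w.length with h | h
  · exact ⟨w, (aux v w h hne).symm⟩
  · rw [Set.inter_comm] at hne ⊢
    exact ⟨v, (aux w v h hne).symm⟩

/-- The word of length `n` that codes the orbit of `x`. -/
noncomputable def codeword (α β : ℝ) (n : ℕ) (x : ℝ) : List (Fin 3) :=
  factor (fun k => natPartition α β ((threeIET α β)^[k] x)) 0 n

section IET

variable {α β : ℝ} {n : ℕ} {x y z : ℝ}

@[simp] lemma length_codeword : (codeword α β n x).length = n := by simp [codeword, factor]

lemma codeword_mem (hx : x ∈ Set.Ico (0 : ℝ) 1) : codeword α β n x ∈ ietLanguage α β :=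
  ⟨x, hx, 0, n, rfl⟩

lemma wordCylinder_eq {w : List (Fin 3)} : wordCylinder (ietLanguage α β) w =
    symbolicSpace (ietLanguage α β) ∩ cylinderSet w := rfl

variable (hα : 0 < α) (hβ : 0 < β) (hαβ : α + β < 1)
include hα hβ hαβ

lemma exists_codeword_eq {w : List (Fin 3)} (hw : w ∈ ietLanguage α β) :
    ∃ x ∈ Set.Ico (0 : ℝ) 1, codeword α β w.length x = w := by
  obtain ⟨x, hx, r, n, rfl⟩ := hw
  refine ⟨(threeIET α β)^[r] x, iterate_threeIET_mem hα hβ hαβ hx r, ?_⟩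
  have : (factor (fun k => natPartition α β ((threeIET α β)^[k] x)) r n).length = n := by
    simp [factor]
  rw [this, codeword, factor_eq_iff]
  intro k _
  rw [zero_add, add_comm r k, Function.iterate_add_apply]

omit hα hβ hαβ in
lemma measure_wordCylinder_eq {μ : Measure (ℕ → Fin 3)}
    (hμ : IsInvariantProbability (ietLanguage α β) μ) (w : List (Fin 3)) :
    μ (wordCylinder (ietLanguage α β) w) = μ (cylinderSet w) := by
  rw [wordCylinder_eq, Set.inter_comm]
  exact measure_inter_conull hμ.carried

/-- The frequency of a word with respect to any invariant probability measure. -/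
theorem measureReal_cylinderSet (hirr : Irrational ((1 - α) / (1 + β)))
    {μ : Measure (ℕ → Fin 3)} (hμ : IsInvariantProbability (ietLanguage α β) μ) {p p' : ℝ}
    (hp : 0 ≤ p) (hpp' : p ≤ p') (hp' : p' ≤ 1)
    (hcell : ∀ y ∈ Set.Ico (0 : ℝ) 1, SameItinerary α β n x y ↔ y ∈ Set.Ico p p') :
    μ.real (cylinderSet (codeword α β n x)) = p' - p := by
  have := hμ.isProbabilityMeasure
  set A := cylinderSet (codeword α β n x)
  have hA : MeasurableSet A := measurableSet_cylinderSet _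
  have hint : ∀ N : ℕ, ∫ ω, ∑ k ∈ Finset.range N, A.indicator (1 : (ℕ → Fin 3) → ℝ)
      (shift^[k] ω) ∂μ = N * μ.real A := by
    intro N
    have h1 : ∀ k, MeasurableSet (shift^[k] ⁻¹' A) := fun k => (measurable_shift.iterate k) hA
    have h2 : ∀ k, (fun ω => A.indicator (1 : (ℕ → Fin 3) → ℝ) (shift^[k] ω)) =
        (shift^[k] ⁻¹' A).indicator 1 := fun k => rfl
    rw [integral_finsetSum]
    · have : ∀ k ∈ Finset.range N, ∫ ω, A.indicator (1 : (ℕ → Fin 3) → ℝ) (shift^[k] ω) ∂μ =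
          μ.real A := by
        intro k _
        rw [h2, integral_indicator_one (h1 k), measureReal_def, measureReal_def,
          (hμ.invariant.iterate k).measure_preimage hA.nullMeasurableSet]
      rw [Finset.sum_congr rfl this]; simp
    · intro k _
      rw [h2]
      exact (integrable_const (1 : ℝ)).indicator (h1 k)
  have hae : ∀ᵐ ω ∂μ, ω ∈ symbolicSpace (ietLanguage α β) := by
    rw [ae_iff]; exact hμ.carried
  -- Only the first N + n letters of ω matter, and they code an actual orbit. Uniformity in the
  -- starting point then bounds the orbit sums on all of X_L, and integration against any invariant
  -- measure gives its value on the cylinder without an ergodic theorem.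
  have hcount : ∀ ω ∈ symbolicSpace (ietLanguage α β), ∀ N, ∃ y ∈ Set.Ico (0 : ℝ) 1,
      ∑ k ∈ Finset.range N, A.indicator (1 : (ℕ → Fin 3) → ℝ) (shift^[k] ω) =
        visits (threeIET α β) (Set.Ico p p') N y := by
    intro ω hω N
    obtain ⟨y, hy, h⟩ := exists_codeword_eq hα hβ hαβ (hω 0 (N + n))
    have hl : (factor ω 0 (N + n)).length = N + n := by simp [factor]
    rw [hl, codeword, factor_eq_iff] at h
    refine ⟨y, hy, Finset.sum_congr rfl fun k hk => ?_⟩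
    have hiff : shift^[k] ω ∈ A ↔ (threeIET α β)^[k] y ∈ Set.Ico p p' := by
      rw [← hcell _ (iterate_threeIET_mem hα hβ hαβ hy k), mem_cylinderSet, length_codeword,
        codeword, factor_eq_iff]
      refine forall₂_congr fun j hj => ?_
      rw [zero_add, iterate_shift]
      have := h (k + j) (by have := Finset.mem_range.1 hk; omega)
      rw [zero_add] at this
      rw [← this, add_comm k j, Function.iterate_add_apply]
      exact eq_comm
    simp only [Set.indicator, hiff, Pi.one_apply]
  refine eq_of_forall_dist_le fun ε hε => ?_
  rw [Real.dist_eq]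
  obtain ⟨N₀, hN₀⟩ := visits_Ico hα hβ hαβ hirr hp hpp' hp' hε
  set N := N₀ + 1
  have hb : ∀ᵐ ω ∂μ, ‖∑ k ∈ Finset.range N, A.indicator (1 : (ℕ → Fin 3) → ℝ) (shift^[k] ω) -
      (p' - p) * N‖ ≤ ε * N := by
    filter_upwards [hae] with ω hω
    obtain ⟨y, hy, e⟩ := hcount ω hω N
    rw [e]
    exact hN₀ N (Nat.le_succ _) y hy
  have h1 := norm_integral_le_of_norm_le_const hb
  rw [integral_sub _ (integrable_const _), hint] at h1
  · simp only [integral_const, probReal_univ, one_smul, mul_one, Real.norm_eq_abs] at h1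
    have hNpos : (0 : ℝ) < N := by positivity
    rw [mul_comm (N : ℝ), ← sub_mul, abs_mul, abs_of_pos hNpos] at h1
    exact le_of_mul_le_mul_right h1 hNpos
  · refine integrable_finsetSum _ fun k _ => ?_
    exact (integrable_const (1 : ℝ)).indicator ((measurable_shift.iterate k) hA)

lemma measure_wordCylinder_codeword (hirr : Irrational ((1 - α) / (1 + β)))
    {μ : Measure (ℕ → Fin 3)} (hμ : IsInvariantProbability (ietLanguage α β) μ) {p p' : ℝ}
    (hp : 0 ≤ p) (hpp' : p ≤ p') (hp' : p' ≤ 1)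
    (hcell : ∀ y ∈ Set.Ico (0 : ℝ) 1, SameItinerary α β n x y ↔ y ∈ Set.Ico p p') :
    μ (wordCylinder (ietLanguage α β) (codeword α β n x)) = ENNReal.ofReal (p' - p) := by
  have := hμ.isProbabilityMeasure
  rw [measure_wordCylinder_eq hμ,
    ← measureReal_cylinderSet hα hβ hαβ hirr hμ hp hpp' hp' hcell, ofReal_measureReal]

theorem invariantProbability_unique (hirr : Irrational ((1 - α) / (1 + β)))
    {μ ν : Measure (ℕ → Fin 3)} (hμ : IsInvariantProbability (ietLanguage α β) μ)
    (hν : IsInvariantProbability (ietLanguage α β) ν) : μ = ν := by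
  have := hμ.isProbabilityMeasure
  have := hν.isProbabilityMeasure
  refine ext_of_generate_finite _ generateFrom_cylinderSet isPiSystem_cylinderSet ?_ (by simp)
  rintro _ ⟨w, rfl⟩
  rw [← measure_wordCylinder_eq hμ, ← measure_wordCylinder_eq hν]
  by_cases hw : w ∈ ietLanguage α β
  · obtain ⟨x, hx, e⟩ := exists_codeword_eq hα hβ hαβ hw
    obtain ⟨p, hp, p', hp', h1, h2, -, -, hcell⟩ := exists_cell hβ w.length hx
    have q1 := cutPoints_nonneg hp
    have q2 := cutPoints_le_one hp'
    rw [← e, measure_wordCylinder_codeword hα hβ hαβ hirr hμ q1 (h1.trans h2.le) q2 hcell,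
      measure_wordCylinder_codeword hα hβ hαβ hirr hν q1 (h1.trans h2.le) q2 hcell]
  · have : wordCylinder (ietLanguage α β) w = ∅ := by
      ext ω
      simp only [wordCylinder, Set.mem_ofPred_eq, Set.mem_empty_iff_false, iff_false, not_and]
      intro h1 h2
      exact hw (h2 ▸ h1 0 w.length)
    rw [this, measure_empty, measure_empty]

omit hα hβ hαβ in
lemma measurable_threeIET : Measurable (threeIET α β) := by
  unfold threeIET
  refine Measurable.ite measurableSet_Iio (by fun_prop) ?_
  exact Measurable.ite measurableSet_Iio (by fun_prop) (by fun_prop)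

omit hα hβ hαβ in
lemma measurable_natPartition : Measurable (natPartition α β) := by
  unfold natPartition
  refine Measurable.ite measurableSet_Iio measurable_const ?_
  exact Measurable.ite measurableSet_Iio measurable_const measurable_const

lemma measurePreserving_threeIET : MeasurePreserving (threeIET α β)
    (volume.restrict (Set.Ico 0 1)) (volume.restrict (Set.Ico 0 1)) := by
  refine ⟨measurable_threeIET, ?_⟩
  have piece : ∀ (a b c : ℝ), (∀ x ∈ Set.Ico a b, threeIET α β x = x + c) →
      (volume.restrict (Set.Ico a b)).map (threeIET α β) =
        volume.restrict (Set.Ico (a + c) (b + c)) := by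
    intro a b c h
    have h1 : (volume.restrict (Set.Ico a b)).map (threeIET α β) =
        (volume.restrict (Set.Ico a b)).map (· + c) :=
      Measure.map_congr ((ae_restrict_iff' measurableSet_Ico).2 (Eventually.of_forall h))
    have h2 := ((measurePreserving_add_right (volume : Measure ℝ) c).restrict_preimage
      (measurableSet_Ico (a := a + c) (b := b + c))).map_eq
    rw [Set.preimage_add_const_Ico, add_sub_cancel_right, add_sub_cancel_right] at h2
    rw [h1, h2]
  have split : ∀ a b : ℝ, 0 ≤ a → a ≤ b → b ≤ 1 → (volume : Measure ℝ).restrict (Set.Ico 0 1) =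
      volume.restrict (Set.Ico 0 a) + volume.restrict (Set.Ico a b) +
        volume.restrict (Set.Ico b 1) := by
    intro a b h0 h1 h2
    have d1 : Disjoint (Set.Ico (0 : ℝ) a) (Set.Ico a b) :=
      Set.disjoint_left.2 fun x hx hx' => absurd hx.2 (not_lt.2 hx'.1)
    have d2 : Disjoint (Set.Ico (0 : ℝ) b) (Set.Ico b 1) :=
      Set.disjoint_left.2 fun x hx hx' => absurd hx.2 (not_lt.2 hx'.1)
    rw [← Measure.restrict_union d1 measurableSet_Ico, Set.Ico_union_Ico_eq_Ico h0 h1,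
      ← Measure.restrict_union d2 measurableSet_Ico, Set.Ico_union_Ico_eq_Ico (h0.trans h1) h2]
  have hm := measurable_threeIET (α := α) (β := β)
  rw [split α (α + β) hα.le (by linarith) hαβ.le, Measure.map_add _ _ hm, Measure.map_add _ _ hm,
    piece 0 α (1 - α) fun x hx => ?_, piece α (α + β) (1 - 2 * α - β) fun x hx => ?_,
    piece (α + β) 1 (-α - β) fun x hx => ?_, ← split α (α + β) hα.le (by linarith) hαβ.le,
    split (1 - α - β) (1 - α) (by linarith) (by linarith) (by linarith)]
  · rw [show 0 + (1 - α) = 1 - α by ring, show α + (1 - α) = 1 by ring,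
      show α + (1 - 2 * α - β) = 1 - α - β by ring,
      show α + β + (1 - 2 * α - β) = 1 - α by ring,
      show α + β + (-α - β) = 0 by ring, show 1 + (-α - β) = 1 - α - β by ring]
    abel
  · rw [threeIET, if_neg (by linarith [hx.1]), if_neg (by linarith [hx.1])]; ring
  · rw [threeIET, if_neg (by linarith [hx.1]), if_pos hx.2]; ring
  · rw [threeIET, if_pos hx.2]; ring

/-- The image of Lebesgue measure under the coding map. -/
theorem exists_invariantProbability :
    ∃ μ : Measure (ℕ → Fin 3), IsInvariantProbability (ietLanguage α β) μ := by
  let c : ℝ → ℕ → Fin 3 := fun x k => natPartition α β ((threeIET α β)^[k] x)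
  have hc : Measurable c := measurable_pi_lambda _ fun k =>
    measurable_natPartition.comp (measurable_threeIET.iterate k)
  have hcx : ∀ x ∈ Set.Ico (0 : ℝ) 1, c x ∈ symbolicSpace (ietLanguage α β) :=
    fun x hx r n => ⟨x, hx, r, n, rfl⟩
  have hsm : MeasurableSet (symbolicSpace (ietLanguage α β)) := by
    have : symbolicSpace (ietLanguage α β) = ⋂ r : ℕ, ⋂ n : ℕ,
        shift^[r] ⁻¹' (⋃ w ∈ {w | w ∈ ietLanguage α β ∧ w.length = n}, cylinderSet w) := by
      ext ω
      simp only [symbolicSpace, Set.mem_ofPred_eq, Set.mem_iInter, Set.mem_preimage, Set.mem_iUnion,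
        exists_prop]
      refine forall₂_congr fun r n => ?_
      have e : factor (shift^[r] ω) 0 n = factor ω r n := by
        rw [factor_eq_iff]; intro k _; rw [iterate_shift, zero_add]
      constructor
      · intro h
        refine ⟨_, ⟨h, by simp [factor]⟩, ?_⟩
        have hl : (factor ω r n).length = n := by simp [factor]
        rw [mem_cylinderSet, hl, e]
      · rintro ⟨w, ⟨h1, h2⟩, h3⟩
        rw [mem_cylinderSet, h2, e] at h3
        rw [h3]; exact h1
    rw [this]
    exact MeasurableSet.iInter fun r => MeasurableSet.iInter fun n =>
      (measurable_shift.iterate r) (MeasurableSet.biUnion (Set.to_countable _)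
        fun w _ => measurableSet_cylinderSet w)
  refine ⟨(volume.restrict (Set.Ico 0 1)).map c, ?_, ?_, ?_⟩
  · have : IsProbabilityMeasure (volume.restrict (Set.Ico (0 : ℝ) 1)) := ⟨by simp⟩
    exact Measure.isProbabilityMeasure_map hc.aemeasurable
  · rw [Measure.map_apply hc hsm.compl, Measure.restrict_apply (hc hsm.compl)]
    convert measure_empty (μ := (volume : Measure ℝ))
    ext x
    simp only [Set.mem_inter_iff, Set.mem_preimage, Set.mem_compl_iff, Set.mem_empty_iff_false,
      iff_false, not_and]
    exact fun h hx => h (hcx x hx)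
  · refine ⟨measurable_shift, ?_⟩
    have e : shift ∘ c = c ∘ threeIET α β := by
      ext x k
      simp only [c, shift, Function.comp_apply, Function.iterate_succ_apply]
    rw [Measure.map_map measurable_shift hc, e, ← Measure.map_map hc measurable_threeIET,
      (measurePreserving_threeIET hα hβ hαβ).map_eq]

end IET

/-! ### The value of `𝓑` and the grid of a three-interval exchange -/

/-- Finitely many grid points lie in the box |X| ≤ J, |Y| ≤ 1, and none of them on the axis. -/
lemma GridNondegenerate.exists_le_abs_gridY {s : GridState} (h : GridNondegenerate s)
    (hs : s ∈ gridBox) (J : ℝ) : ∃ δ > 0, ∀ p : ℤ × ℤ × ℤ, (p.1 = 0 ∨ p.1 = 1) → p ≠ (0, 0, 0) →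
      |gridX s p| ≤ J → δ ≤ |gridY s p| := by
  obtain ⟨D, hD⟩ := exists_nat_ge (J + 1 + 3)
  obtain ⟨δ, hδ, H⟩ := Finset.exists_pos_le (gridPoints D) (fun p => |gridY s p|) fun p hp =>
    abs_pos.2 (h p (mem_gridPoints.1 hp).2.1 (mem_gridPoints.1 hp).1)
  refine ⟨min δ 1, lt_min hδ one_pos, fun p hp hp0 hX => ?_⟩
  by_cases hY : |gridY s p| ≤ 1
  · refine (min_le_left _ _).trans (H p (mem_gridPoints.2 ⟨hp0, hp, ?_, ?_⟩))
    · have := (coeff_abs_le_of_coordinates hs hp hX hY).1.trans hD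
      exact_mod_cast this
    · have := (coeff_abs_le_of_coordinates hs hp hX hY).2.trans hD
      exact_mod_cast this
  · exact (min_le_right _ _).trans (not_le.1 hY).le

/-- The grid of the three-interval exchange. -/
noncomputable def ietState (α β : ℝ) : GridState := (0, 0, (1 - α) / (1 + β), 1 / (1 + β))

section IET

variable {α β : ℝ}

lemma gridX_ietState (p : ℤ × ℤ × ℤ) : gridX (ietState α β) p = p.2.1 := by
  simp [gridX, ietState]

lemma gridNorm_ietState (p : ℤ × ℤ × ℤ) :
    gridNorm (ietState α β) p = |(p.2.1 : ℝ)| * |gridY (ietState α β) p| := by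
  rw [gridNorm, gridX_ietState, abs_mul]
  simp [ietState]

lemma mul_gridY_ietState (hβ : 0 < β) (p : ℤ × ℤ × ℤ) : (1 + β) * gridY (ietState α β) p =
    p.1 - p.2.1 * (1 - α) + p.2.2 * (1 + β) := by
  have : 1 + β ≠ 0 := by linarith
  simp only [gridY, ietState]
  field_simp
  ring

/-- The first relation is e = 0, the third is e = 1, and the second is the third with opposite
signs. -/
lemma idoc_iff (hβ : 0 < β) : IDOC α β ↔ GridNondegenerate (ietState α β) := by
  have hl : 0 < 1 + β := by linarith
  have key : ∀ p, gridY (ietState α β) p = 0 ↔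
      (p.1 : ℝ) - p.2.1 * (1 - α) + p.2.2 * (1 + β) = 0 := by
    intro p
    rw [← mul_gridY_ietState hβ, mul_eq_zero]
    simp [hl.ne']
  constructor
  · rintro ⟨h1, -, h3⟩ ⟨e, m, n⟩ he h0 h
    rw [key] at h
    simp only at he h
    rcases he with rfl | rfl
    · refine h1 m n ?_ ?_
      · rintro ⟨rfl, rfl⟩; exact h0 rfl
      · push_cast at h; linarith
    · exact h3 m n (by push_cast at h; linarith)
  · intro h
    refine ⟨fun p q hpq e => h (0, p, q) (Or.inl rfl) ?_ ?_,
      fun p q e => h (1, -p, -q) (Or.inr rfl) (by simp) ?_,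
      fun p q e => h (1, p, q) (Or.inr rfl) (by simp) ?_⟩
    · intro h0
      simp only [Prod.mk.injEq, true_and] at h0
      exact hpq h0
    all_goals rw [key]; push_cast; linarith

lemma irrational_of_nondegenerate (h : GridNondegenerate (ietState α β)) :
    Irrational ((1 - α) / (1 + β)) := by
  rw [irrational_iff_ne_rational]
  intro a b hb e
  refine h (0, b, a) (Or.inl rfl) (by simp [hb]) ?_
  have hb' : (b : ℝ) ≠ 0 := by exact_mod_cast hb
  simp only [gridY, ietState, e]
  field_simp
  simp

variable (hα : 0 < α) (hβ : 0 < β) (hαβ : α + β < 1)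
include hα hβ hαβ

lemma ietState_mem : ietState α β ∈ gridBox := by
  have hl : 0 < 1 + β := by linarith
  have h1 : 0 ≤ (1 - α) / (1 + β) := div_nonneg (by linarith) hl.le
  have h2 : (1 - α) / (1 + β) ≤ 1 := by rw [div_le_one hl]; linarith
  have h3 : 0 < 1 / (1 + β) := by positivity
  have h4 : 1 / (1 + β) ≤ 1 := by rw [div_le_one hl]; linarith
  exact ⟨⟨le_rfl, le_rfl, h1, by simp only [ietState]; linarith⟩,
    ⟨zero_le_one, zero_le_two, h2, h4⟩⟩

/-- Dirichlet's theorem bounds the lower limit by 1; nondegeneracy makes the good approximations go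
to infinity. -/
theorem exists_isGridLiminf_ietState (h : GridNondegenerate (ietState α β)) :
    ∃ c, 0 ≤ c ∧ c ≤ 1 ∧ IsGridLiminf (ietState α β) c := by
  set s := ietState α β with hs
  have hbox : s ∈ gridBox := ietState_mem hα hβ hαβ
  let A : Set ℝ := {c | 0 ≤ c ∧ ∃ J : ℝ, ∀ p : ℤ × ℤ × ℤ, (p.1 = 0 ∨ p.1 = 1) →
    J ≤ |gridX s p| → c ≤ gridNorm s p}
  have h0 : (0 : ℝ) ∈ A := ⟨le_rfl, 0, fun p _ _ => gridNorm_nonneg hbox p⟩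
  have h1 : ∀ c ∈ A, c ≤ 1 := by
    rintro c ⟨-, J, hJ⟩
    obtain ⟨δ, hδ, H⟩ := h.exists_le_abs_gridY hbox J
    obtain ⟨N, hN⟩ := exists_nat_one_div_lt hδ
    obtain ⟨k, hk, hkN, hk'⟩ :=
      Real.exists_nat_abs_mul_sub_round_le ((1 - α) / (1 + β)) (Nat.succ_pos N)
    set p : ℤ × ℤ × ℤ := (0, k, round (k * ((1 - α) / (1 + β)))) with hp
    have hY : |gridY s p| = |k * ((1 - α) / (1 + β)) - round (k * ((1 - α) / (1 + β)))| := by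
      rw [abs_sub_comm]
      simp [gridY, hs, ietState, hp]
    rw [← hY] at hk'
    have hp0 : p ≠ (0, 0, 0) := by
      simp only [hp, ne_eq, Prod.mk.injEq, not_and]
      intro _ h; omega
    have hX : J ≤ |gridX s p| := by
      by_contra! hlt
      have := H p (Or.inl rfl) hp0 hlt.le
      have h2 : 1 / (((N + 1 : ℕ) : ℝ) + 1) ≤ 1 / ((N : ℝ) + 1) := by
        push_cast
        gcongr
        linarith
      push_cast [Nat.succ_eq_add_one] at hk' h2
      linarith
    refine (hJ p (Or.inl rfl) hX).trans ?_
    rw [hs, gridNorm_ietState, ← hs]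
    have e : |((p.2.1 : ℤ) : ℝ)| = k := by simp [hp]
    have hkN' : (k : ℝ) ≤ (N.succ : ℝ) := by exact_mod_cast hkN
    rw [e]
    calc (k : ℝ) * |gridY s p| ≤ N.succ * (1 / (N.succ + 1)) :=
          mul_le_mul hkN' hk' (abs_nonneg _) (by positivity)
      _ ≤ 1 := by
          rw [mul_one_div, div_le_one (by positivity)]; linarith
  have hb : BddAbove A := ⟨1, h1⟩
  refine ⟨sSup A, le_csSup hb h0, csSup_le ⟨0, h0⟩ h1, fun ε hε => ?_, fun ε hε J => ?_⟩
  · obtain ⟨a, ⟨-, J, hJ⟩, ha⟩ := exists_lt_of_lt_csSup ⟨0, h0⟩ (sub_lt_self (sSup A) hε)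
    exact ⟨J, fun p hp hX => ha.trans_le (hJ p hp hX)⟩
  · by_contra! hcon
    have hmem : sSup A + ε ∈ A :=
      ⟨by linarith [le_csSup hb h0], J, fun p hp hX => hcon p hp hX⟩
    linarith [le_csSup hb hmem]

omit hα hαβ in
/-- The difference of two cut points is a coordinate of a grid point. -/
lemma exists_gridPoint_of_cutPoints {n : ℕ} {p p' : ℝ} (hp : p ∈ cutPoints α β n)
    (hp' : p' ∈ cutPoints α β n) (hlt : p < p') : ∃ q : ℤ × ℤ × ℤ, (q.1 = 0 ∨ q.1 = 1) ∧
      q ≠ (0, 0, 0) ∧ p' - p = (1 + β) * |gridY (ietState α β) q| ∧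
      ∃ z ∈ Set.Ico (0 : ℝ) 1, |(q.2.1 : ℝ)| ≤ returnTime α β z n := by
  have hl : 0 < 1 + β := by linarith
  obtain ⟨e, i, M, he, hM, h⟩ := exists_of_mem_cutPoints hp
  obtain ⟨e', i', M', he', hM', h'⟩ := exists_of_mem_cutPoints hp'
  have hz : ∃ z ∈ Set.Ico (0 : ℝ) 1, |(M' : ℝ) - M| ≤ returnTime α β z n := by
    have c0 : (0 : ℝ) ≤ M := by positivity
    have c1 : (0 : ℝ) ≤ M' := by positivity
    rcases le_total M M' with hle | hle
    · have hle' : (M : ℝ) ≤ M' := by exact_mod_cast hle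
      rcases hM' with rfl | ⟨hz, hr⟩
      · refine ⟨0, by simp, ?_⟩
        have : M = 0 := by omega
        simp [this]
      · refine ⟨p', hz, ?_⟩
        have : (M' : ℝ) ≤ returnTime α β p' n := by exact_mod_cast hr
        rw [abs_of_nonneg] <;> linarith
    · have hle' : (M' : ℝ) ≤ M := by exact_mod_cast hle
      rcases hM with rfl | ⟨hz, hr⟩
      · refine ⟨0, by simp, ?_⟩
        have : M' = 0 := by omega
        simp [this]
      · refine ⟨p, hz, ?_⟩
        have : (M : ℝ) ≤ returnTime α β p n := by exact_mod_cast hr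
        rw [abs_of_nonpos] <;> linarith
  obtain ⟨z, hz, hzM⟩ := hz
  have fin : ∀ (q : ℤ × ℤ × ℤ), (1 + β) * |gridY (ietState α β) q| = p' - p → q ≠ (0, 0, 0) := by
    rintro q hq rfl
    simp [gridY] at hq
    linarith
  -- If e' - e = -1, the opposite grid point is used, so that its first coefficient is again 0 or 1.
  by_cases hee : e' - e = 0 ∨ e' - e = 1
  · have hq : (1 + β) * |gridY (ietState α β) (e' - e, (M' : ℤ) - M, i' - i)| = p' - p := by
      rw [← abs_of_pos hl, ← abs_mul, mul_gridY_ietState hβ,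
        ← abs_of_pos (sub_pos.2 hlt), h, h']
      congr 1; push_cast; ring
    exact ⟨_, hee, fin _ hq, hq.symm, z, hz, by push_cast; exact hzM⟩
  · have hq : (1 + β) * |gridY (ietState α β) (e - e', (M : ℤ) - M', i - i')| = p' - p := by
      rw [← abs_of_pos hl, ← abs_mul, mul_gridY_ietState hβ,
        ← abs_of_pos (sub_pos.2 hlt), ← abs_neg, h, h']
      congr 1; push_cast; ring
    exact ⟨_, by simp only; omega, fin _ hq, hq.symm, z, hz, by
      push_cast; rw [abs_sub_comm]; exact hzM⟩

lemma abs_returnTime_sub_le (hirr : Irrational ((1 - α) / (1 + β))) {ε : ℝ} (hε : 0 < ε) :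
    ∃ N₀ : ℕ, ∀ N ≥ N₀, ∀ x ∈ Set.Ico (0 : ℝ) 1,
      |(returnTime α β x N : ℝ) - (1 + β) * N| ≤ ε * N := by
  obtain ⟨N₀, h⟩ := visits_middle hα hβ hαβ hirr hε
  refine ⟨N₀, fun N hN x hx => ?_⟩
  rw [returnTime_eq]
  convert h N hN x hx using 2
  ring

/-- If the products at far grid points are at least `d`, then the cut points are separated. -/
lemma eventually_le_sub_cutPoints (h : GridNondegenerate (ietState α β)) {d d' J : ℝ}
    (hd' : 0 < d') (hdd : d' < d) (hJ : ∀ p : ℤ × ℤ × ℤ, (p.1 = 0 ∨ p.1 = 1) →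
      J ≤ |gridX (ietState α β) p| → d ≤ gridNorm (ietState α β) p) :
    ∀ᶠ n : ℕ in atTop, ∀ p ∈ cutPoints α β n, ∀ p' ∈ cutPoints α β n, p < p' →
      d' ≤ n * (p' - p) := by
  have hl : 0 < 1 + β := by linarith
  obtain ⟨δ, hδ, H⟩ := h.exists_le_abs_gridY (ietState_mem hα hβ hαβ) J
  -- The tolerance is chosen so that return times are at most (1+β)(d/d')n, which loses exactly the
  -- factor d/d' in the product.
  obtain ⟨N₀, hN₀⟩ := abs_returnTime_sub_le hα hβ hαβ (irrational_of_nondegenerate h)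
    (ε := (1 + β) * (d - d') / d') (by have := sub_pos.2 hdd; positivity)
  have hlim : Tendsto (fun n : ℕ => (n : ℝ) * ((1 + β) * δ)) atTop atTop :=
    tendsto_natCast_atTop_atTop.atTop_mul_const (by positivity)
  filter_upwards [eventually_ge_atTop N₀, hlim.eventually_ge_atTop d'] with n hn hn'
  intro p hp p' hp' hlt
  obtain ⟨q, hq, hq0, e, z, hz, hm⟩ := exists_gridPoint_of_cutPoints hβ hp hp' hlt
  rw [e]
  by_cases hX : J ≤ |gridX (ietState α β) q|
  · have h1 := hJ q hq hX
    rw [gridNorm_ietState] at h1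
    have h2 := (abs_le.1 (hN₀ n hn z hz)).2
    have h3 : |(q.2.1 : ℝ)| ≤ (1 + β) * (d / d') * n := by
      refine hm.trans ?_
      have : (1 + β) * (d / d') * n = (1 + β) * (d - d') / d' * n + (1 + β) * n := by
        field_simp; ring
      linarith
    have h4 := h1.trans (mul_le_mul_of_nonneg_right h3 (abs_nonneg _))
    have h5 : (1 + β) * (d / d') * n * |gridY (ietState α β) q| =
        d / d' * (n * ((1 + β) * |gridY (ietState α β) q|)) := by ring
    rw [h5, div_mul_eq_mul_div, le_div_iff₀ hd'] at h4
    exact le_of_mul_le_mul_left h4 (hd'.trans hdd)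
  · have := H q hq hq0 (not_le.1 hX).le
    refine hn'.trans ?_
    gcongr

/-- A far grid point with a small product gives close cut points. -/
lemma exists_cutPoints_of_gridPoint {q : ℤ × ℤ × ℤ} (hq : q.1 = 0 ∨ q.1 = 1) (hm : q.2.1 ≠ 0)
    (hY : gridY (ietState α β) q ≠ 0)
    (hs : (1 + β) * |gridY (ietState α β) q| ≤ min α (1 - α - β) / 2) :
    ∃ k : ℕ, ∃ x ∈ Set.Ico (0 : ℝ) 1, (returnTime α β x k : ℝ) = |(q.2.1 : ℝ)| ∧
      ∃ p ∈ cutPoints α β (k + 1), ∃ p' ∈ cutPoints α β (k + 1), p < p' ∧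
        p' - p = (1 + β) * |gridY (ietState α β) q| := by
  have hl : 0 < 1 + β := by linarith
  have hm1 := min_le_left α (1 - α - β)
  have hm2 := min_le_right α (1 - α - β)
  have hm0 : 0 < min α (1 - α - β) := lt_min hα (by linarith)
  -- A point x at distance (1+β)|Y| from a discontinuity δ reaches a discontinuity δ' after |m|
  -- rotation steps; x and δ then are both cut points. For e = 0 both discontinuities are α + β, for
  -- e = 1 they differ, and the sign of m decides which comes first.
  have key : ∀ (x δ δ' : ℝ) (i : ℤ), (δ = α ∨ δ = α + β) → (δ' = α ∨ δ' = α + β) →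
      |x - δ| = (1 + β) * |gridY (ietState α β) q| →
      δ' = x + (q.2.1.natAbs : ℕ) * (1 - α) - i * (1 + β) →
      ∃ k : ℕ, ∃ x ∈ Set.Ico (0 : ℝ) 1, (returnTime α β x k : ℝ) = |(q.2.1 : ℝ)| ∧
      ∃ p ∈ cutPoints α β (k + 1), ∃ p' ∈ cutPoints α β (k + 1), p < p' ∧
        p' - p = (1 + β) * |gridY (ietState α β) q| := by
    intro x δ δ' i hδ hδ' hx e
    have mem : ∀ δ, (δ = α ∨ δ = α + β) → δ ∈ Set.Ico (0 : ℝ) 1 := by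
      rintro δ (rfl | rfl)
      · exact ⟨hα.le, by linarith⟩
      · exact ⟨by linarith, hαβ⟩
    have hxm : x ∈ Set.Ico (0 : ℝ) 1 := by
      have := abs_le.1 (hx.le.trans hs)
      rcases hδ with rfl | rfl <;> constructor <;> linarith
    obtain ⟨k, hk, hk'⟩ := exists_returnTime_eq hα hβ hαβ hxm (mem δ' hδ') e
    have c1 : x ∈ cutPoints α β (k + 1) :=
      Or.inr (Or.inr ⟨hxm, k, Nat.lt_succ_self k, by rw [hk']; exact hδ'⟩)
    have c2 : δ ∈ cutPoints α β (k + 1) := Or.inr (Or.inr ⟨mem δ hδ, 0, Nat.succ_pos k, hδ⟩)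
    have hne : x ≠ δ := by
      rintro rfl
      rw [sub_self, abs_zero] at hx
      have := abs_pos.2 hY
      exact absurd hx (by positivity)
    refine ⟨k, x, hxm, by rw [hk]; simp [Nat.cast_natAbs], ?_⟩
    rcases hne.lt_or_gt with hlt | hlt
    · exact ⟨x, c1, δ, c2, hlt, by rw [← hx, abs_of_neg (by linarith)]; ring⟩
    · exact ⟨δ, c2, x, c1, hlt, by rw [← hx, abs_of_pos (by linarith)]⟩
  have hg := mul_gridY_ietState (α := α) hβ q
  have habs : ∀ δ : ℝ, |(δ + (1 + β) * gridY (ietState α β) q) - δ| =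
      (1 + β) * |gridY (ietState α β) q| := fun δ => by
    rw [add_sub_cancel_left, abs_mul, abs_of_pos hl]
  have habs' : ∀ δ : ℝ, |(δ - (1 + β) * gridY (ietState α β) q) - δ| =
      (1 + β) * |gridY (ietState α β) q| := fun δ => by
    rw [sub_sub_cancel_left, abs_neg, abs_mul, abs_of_pos hl]
  rcases lt_or_gt_of_ne hm with hneg | hpos
  · have hc : ((q.2.1.natAbs : ℕ) : ℝ) = -(q.2.1 : ℝ) := by
      rw [Nat.cast_natAbs, abs_of_neg hneg]; push_cast; ring
    rcases hq with h0 | h0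
    · refine key _ (α + β) (α + β) (-q.2.2) (Or.inr rfl) (Or.inr rfl) (habs' _) ?_
      rw [hg, hc, h0]; push_cast; ring
    · refine key _ α (α + β) (-(q.2.2 + 1)) (Or.inl rfl) (Or.inr rfl) (habs' _) ?_
      rw [hg, hc, h0]; push_cast; ring
  · have hc : ((q.2.1.natAbs : ℕ) : ℝ) = (q.2.1 : ℝ) := by
      rw [Nat.cast_natAbs, abs_of_pos hpos]
    rcases hq with h0 | h0
    · refine key _ (α + β) (α + β) q.2.2 (Or.inr rfl) (Or.inr rfl) (habs _) ?_
      rw [hg, hc, h0]; push_cast; ring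
    · refine key _ (α + β) α (q.2.2 + 1) (Or.inr rfl) (Or.inl rfl) (habs _) ?_
      rw [hg, hc, h0]; push_cast; ring

lemma frequently_exists_cutPoints (h : GridNondegenerate (ietState α β)) {d d' : ℝ}
    (hd : 0 < d) (hdd : d < d') (hJ : ∀ J : ℝ, ∃ p : ℤ × ℤ × ℤ, (p.1 = 0 ∨ p.1 = 1) ∧
      J ≤ |gridX (ietState α β) p| ∧ gridNorm (ietState α β) p < d) :
    ∃ᶠ n : ℕ in atTop, ∃ p ∈ cutPoints α β n, ∃ p' ∈ cutPoints α β n, p < p' ∧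
      n * (p' - p) ≤ d' := by
  have hl : 0 < 1 + β := by linarith
  have hd' : 0 < d' := hd.trans hdd
  obtain ⟨N₀, hN₀⟩ := abs_returnTime_sub_le hα hβ hαβ (irrational_of_nondegenerate h)
    (ε := (1 + β) * ((d' - d) / (2 * d'))) (by have := sub_pos.2 hdd; positivity)
  have hm0 : 0 < min α (1 - α - β) / 2 := half_pos (lt_min hα (by linarith))
  set μ := min α (1 - α - β) / 2
  -- The cut points appear at order k + 1 and not k; k ≥ K absorbs this extra unit.
  obtain ⟨K, hK⟩ := exists_nat_ge (d / ((d' - d) / 2))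
  rw [div_le_iff₀ (by linarith)] at hK
  rw [frequently_atTop]
  intro N
  obtain ⟨q, hq, hX, hN⟩ := hJ (max (max (2 * (N + N₀ + K) : ℕ) 1) ((1 + β) * d / μ))
  rw [gridX_ietState] at hX
  rw [gridNorm_ietState] at hN
  have hX1 : ((2 * (N + N₀ + K) : ℕ) : ℝ) ≤ |(q.2.1 : ℝ)| :=
    ((le_max_left _ _).trans (le_max_left _ _)).trans hX
  have hX2 : (1 : ℝ) ≤ |(q.2.1 : ℝ)| := ((le_max_right _ _).trans (le_max_left _ _)).trans hX
  have hX3 : (1 + β) * d / μ ≤ |(q.2.1 : ℝ)| := (le_max_right _ _).trans hX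
  have hm : q.2.1 ≠ 0 := by
    intro h0; rw [h0] at hX2; norm_num at hX2
  have hY : gridY (ietState α β) q ≠ 0 := h q hq (by rintro rfl; exact hm rfl)
  have hXpos : 0 < |(q.2.1 : ℝ)| := by linarith
  have hsmall : (1 + β) * |gridY (ietState α β) q| ≤ μ := by
    rw [div_le_iff₀ hm0] at hX3
    have : |(q.2.1 : ℝ)| * ((1 + β) * |gridY (ietState α β) q|) ≤ |(q.2.1 : ℝ)| * μ := by
      have := mul_le_mul_of_nonneg_left hN.le hl.le
      linarith
    exact le_of_mul_le_mul_left this hXpos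
  obtain ⟨k, x, hx, hk, p, hp, p', hp', hlt, e⟩ :=
    exists_cutPoints_of_gridPoint hα hβ hαβ hq hm hY hsmall
  have hkl : N + N₀ + K ≤ k := by
    have h1 := returnTime_le α β x k
    have h2 : (2 * (N + N₀ + K) : ℕ) ≤ returnTime α β x k := by exact_mod_cast hk ▸ hX1
    omega
  refine ⟨k + 1, by omega, p, hp, p', hp', hlt, ?_⟩
  have h1 := (abs_le.1 (hN₀ k (by omega) x hx)).1
  rw [hk] at h1
  have hkK : (K : ℝ) ≤ k := by exact_mod_cast (by omega : K ≤ k)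
  have h2 : (1 + β) * ((d + d') / (2 * d')) * k ≤ |(q.2.1 : ℝ)| := by
    have : (1 + β) * ((d + d') / (2 * d')) * k =
        (1 + β) * k - (1 + β) * ((d' - d) / (2 * d')) * k := by field_simp; ring
    linarith
  rw [e]
  set y := |gridY (ietState α β) q|
  have hy : 0 ≤ y := abs_nonneg _
  have h3 := (mul_le_mul_of_nonneg_right h2 hy).trans hN.le
  have h4 : (1 + β) * ((d + d') / (2 * d')) * k * y = (d + d') / 2 * k * ((1 + β) * y) / d' := by
    field_simp
  rw [h4, div_le_iff₀ hd'] at h3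
  have h5 : d * (k + 1) ≤ (d + d') / 2 * k := by nlinarith
  have h6 := (mul_le_mul_of_nonneg_right h5 (by positivity : 0 ≤ (1 + β) * y)).trans h3
  push_cast
  refine le_of_mul_le_mul_left ?_ hd
  linarith

section Frequency

variable (hirr : Irrational ((1 - α) / (1 + β))) {μ : Measure (ℕ → Fin 3)}
  (hμ : IsInvariantProbability (ietLanguage α β) μ)
include hirr hμ

lemma le_smallestFrequency {n : ℕ} {d : ℝ}
    (h : ∀ p ∈ cutPoints α β n, ∀ p' ∈ cutPoints α β n, p < p' → d ≤ p' - p) :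
    ENNReal.ofReal d ≤ smallestFrequency (ietLanguage α β) μ n := by
  refine le_sInf ?_
  rintro _ ⟨-, w, hw, rfl, rfl⟩
  obtain ⟨x, hx, e⟩ := exists_codeword_eq hα hβ hαβ hw
  obtain ⟨p, hp, p', hp', h1, h2, -, -, hcell⟩ := exists_cell (α := α) hβ w.length hx
  nth_rw 1 [← e]
  rw [measure_wordCylinder_codeword hα hβ hαβ hirr hμ (cutPoints_nonneg hp) (h1.trans h2.le)
    (cutPoints_le_one hp') hcell]
  exact ENNReal.ofReal_le_ofReal (h p hp p' hp' (h1.trans_lt h2))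

/-- The cell that begins at p ends at the next cut point, which is at most p'. -/
lemma smallestFrequency_le {n : ℕ} {p p' : ℝ} (hp : p ∈ cutPoints α β n)
    (hp' : p' ∈ cutPoints α β n) (hlt : p < p') :
    smallestFrequency (ietLanguage α β) μ n ≤ ENNReal.ofReal (p' - p) := by
  have hx : p ∈ Set.Ico (0 : ℝ) 1 := ⟨cutPoints_nonneg hp, hlt.trans_le (cutPoints_le_one hp')⟩
  obtain ⟨r, hr, r', hr', h1, h2, h3, h4, hcell⟩ := exists_cell (α := α) hβ n hx
  have hrp : r = p := le_antisymm h1 (h3 p hp le_rfl)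
  subst hrp
  refine sInf_le_of_le ⟨?_, codeword α β n r, codeword_mem hx, length_codeword, rfl⟩ ?_
  · rw [measure_wordCylinder_codeword hα hβ hαβ hirr hμ hx.1 h2.le (cutPoints_le_one hr') hcell]
    exact ENNReal.ofReal_pos.2 (sub_pos.2 h2)
  · rw [measure_wordCylinder_codeword hα hβ hαβ hirr hμ hx.1 h2.le (cutPoints_le_one hr') hcell]
    exact ENNReal.ofReal_le_ofReal (by linarith [h4 p' hp' hlt])

end Frequency

/-- The value of `𝓑` is the inverse of the lower limit of the products of the grid. -/
theorem upperBL_eq {μ : Measure (ℕ → Fin 3)} (hμ : IsInvariantProbability (ietLanguage α β) μ)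
    (h : GridNondegenerate (ietState α β)) {c : ℝ} (hc : 0 ≤ c)
    (hlim : IsGridLiminf (ietState α β) c) :
    upperBL (ietLanguage α β) μ = (ENNReal.ofReal c)⁻¹ := by
  have hirr := irrational_of_nondegenerate h
  rw [upperBL, ← ENNReal.inv_liminf]
  congr 1
  refine le_antisymm ?_ ?_
  -- Bounds are proved for d ≠ c and passed to the limit, so that c = 0 needs no separate treatment.
  · have step : ∀ d > c, liminf (fun n : ℕ => (n : ℝ≥0∞) *
        smallestFrequency (ietLanguage α β) μ n) atTop ≤ ENNReal.ofReal d := by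
      intro d hd
      refine liminf_le_of_frequently_le' ?_
      have hJ := hlim.2 ((d - c) / 2) (by linarith)
      refine (frequently_exists_cutPoints hα hβ hαβ h (by linarith : 0 < c + (d - c) / 2)
        (by linarith : c + (d - c) / 2 < d) hJ).mono ?_
      rintro n ⟨p, hp, p', hp', hlt, hle⟩
      calc (n : ℝ≥0∞) * smallestFrequency (ietLanguage α β) μ n
          ≤ n * ENNReal.ofReal (p' - p) := by
            gcongr; exact smallestFrequency_le hα hβ hαβ hirr hμ hp hp' hlt
        _ = ENNReal.ofReal (n * (p' - p)) := by
            rw [ENNReal.ofReal_mul (by positivity), ENNReal.ofReal_natCast]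
        _ ≤ ENNReal.ofReal d := ENNReal.ofReal_le_ofReal hle
    have ht : Tendsto ENNReal.ofReal (𝓝[>] c) (𝓝 (ENNReal.ofReal c)) :=
      ENNReal.continuous_ofReal.continuousAt.tendsto.mono_left nhdsWithin_le_nhds
    exact ge_of_tendsto ht (eventually_nhdsWithin_of_forall step)
  · have step : ∀ d < c, ENNReal.ofReal d ≤ liminf (fun n : ℕ => (n : ℝ≥0∞) *
        smallestFrequency (ietLanguage α β) μ n) atTop := by
      intro d hd
      rcases le_or_gt d 0 with h0 | h0
      · rw [ENNReal.ofReal_of_nonpos h0]; exact zero_le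
      obtain ⟨J, hJ⟩ := hlim.1 ((c - d) / 2) (by linarith)
      refine le_liminf_of_le (by isBoundedDefault) ?_
      filter_upwards [eventually_le_sub_cutPoints hα hβ hαβ h h0
        (by linarith : d < c - (c - d) / 2) fun p hp hX => (hJ p hp hX).le,
        eventually_gt_atTop 0] with n hn hn0
      have hn0' : (0 : ℝ) < n := by exact_mod_cast hn0
      calc ENNReal.ofReal d = n * ENNReal.ofReal (d / n) := by
            rw [← ENNReal.ofReal_natCast n, ← ENNReal.ofReal_mul (by positivity),
              mul_div_cancel₀ _ hn0'.ne']
        _ ≤ n * smallestFrequency (ietLanguage α β) μ n := by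
            gcongr
            refine le_smallestFrequency hα hβ hαβ hirr hμ fun p hp p' hp' hlt => ?_
            rw [div_le_iff₀ hn0', mul_comm]
            exact hn p hp p' hp' hlt
    have ht : Tendsto ENNReal.ofReal (𝓝[<] c) (𝓝 (ENNReal.ofReal c)) :=
      ENNReal.continuous_ofReal.continuousAt.tendsto.mono_left nhdsWithin_le_nhds
    exact le_of_tendsto ht (eventually_nhdsWithin_of_forall step)

end IET

/-! ### The spectrum -/

lemma mem_gridSpectrum_of_start {ζ r c : ℝ} (h1 : Irrational ζ) (h2 : 0 < ζ) (h3 : ζ < 1)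
    (h4 : -ζ ≤ r) (h5 : r ≤ 1) (hc : 0 < c) (h : IsGridLiminf (0, 0, ζ, r) c)
    (hn : GridNondegenerate (0, 0, ζ, r)) : c ∈ gridSpectrum := by
  obtain ⟨G, hG, -, -⟩ := CodedGrid.exists_of_start h1 h2 h3 h4 h5
  rw [← hG] at h hn
  obtain ⟨M, hM⟩ := G.exists_letter_bound_of_isGridLiminf hc h
  exact ⟨hc, M, G, hM, G.isLiminf_of_isGridLiminf hM le_rfl h hn⟩

lemma irrational_of_start {ζ r : ℝ} (h : GridNondegenerate (0, 0, ζ, r)) : Irrational ζ := by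
  rw [irrational_iff_ne_rational]
  rintro a b hb rfl
  have hb' : (b : ℝ) ≠ 0 := by exact_mod_cast hb
  refine h (0, b, a) (Or.inl rfl) (by simp [hb]) ?_
  simp only [gridY]
  field_simp
  simp

/-- There is only one element of the spectrum above `1000 / 4787`. -/
theorem eq_of_mem_gridSpectrum_of_lt {c : ℝ} (h : c ∈ gridSpectrum) (hc : 1000 / 4787 < c) :
    c = 1 / (2 * √5) := by
  obtain ⟨ζ, r, h1, h2, h3, h4, hlim, hn⟩ := exists_start_of_mem_gridSpectrum h
  -- The grid is recoded by the numeration algorithm: its letters, unlike the original ones, are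
  -- admissible, as the search requires.
  obtain ⟨G, hG, hadm, hr⟩ := CodedGrid.exists_of_start (irrational_of_start hn) h1
    (by linarith : ζ < 1) (by linarith : -ζ ≤ r) (by linarith)
  rw [← hG] at hlim hn
  obtain ⟨M, hM⟩ := G.exists_letter_bound_of_isGridLiminf h.1 hlim
  exact G.isLiminf_eq_of_lt hadm hr (by omega : 3 ≤ M + 6) hc
    (G.isLiminf_of_isGridLiminf hM le_rfl hlim hn)

lemma le_of_mem_gridSpectrum {c : ℝ} (h : c ∈ gridSpectrum) : c ≤ 1 / (2 * √5) := by
  by_cases hc : 1000 / 4787 < c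
  · exact (eq_of_mem_gridSpectrum_of_lt h hc).le
  · refine (not_lt.1 hc).trans ?_
    have h5 : √5 ≤ 2.3 := by rw [Real.sqrt_le_left (by norm_num)]; norm_num
    rw [div_le_div_iff₀ (by norm_num) (by positivity)]
    linarith

/-- Adding 0 allows limits of small values; it corresponds to 𝓑 = ∞, so the spectrum in [0,∞] is the
continuous image of a compact set. -/
theorem isCompact_gridSpectrum : IsCompact (insert 0 gridSpectrum) := by
  refine isCompact_Icc.of_isClosed_subset (s := Set.Icc 0 (1 / (2 * √5))) ?_ ?_
  · refine IsSeqClosed.isClosed fun u d hu hd => ?_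
    have h0 : 0 ≤ d := ge_of_tendsto' hd fun i => by
      rcases hu i with h | h
      · exact h.ge
      · exact h.1.le
    rcases h0.eq_or_lt with h0 | h0
    · exact Or.inl h0.symm
    · obtain ⟨N, hN⟩ := eventually_atTop.1 (hd.eventually_const_lt h0)
      refine Or.inr (mem_gridSpectrum_of_tendsto (c := fun i => u (i + N)) (fun i => ?_)
        (hd.comp (tendsto_add_atTop_nat N)) h0)
      exact (hu (i + N)).resolve_left (hN _ (Nat.le_add_left N i)).ne'
  · rintro c (rfl | h)
    · exact ⟨le_rfl, by positivity⟩
    · exact ⟨h.1.le, le_of_mem_gridSpectrum h⟩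

/-- A grid, in a normalized position, with arbitrarily small products. -/
lemma exists_start_zero : ∃ ζ r : ℝ, 0 < ζ ∧ ζ < 1 / 2 ∧ 1 - ζ < r ∧ r < 2 * ζ ∧
    IsGridLiminf (0, 0, ζ, r) 0 ∧ GridNondegenerate (0, 0, ζ, r) := by
  -- ζ > 1/3 makes the interval (1 - ζ, 2ζ) for r nonempty; avoiding the countable set ℤζ + ℤ there
  -- keeps the translate off the axis.
  obtain ⟨ζ, hζ, h1, h2⟩ := dense_liouville.exists_between (show (1 / 3 : ℝ) < 1 / 2 by norm_num)
  have hcount : (Set.range fun q : ℤ × ℤ => (q.1 : ℝ) * ζ - q.2).Countable := Set.countable_range _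
  obtain ⟨r, hr, h3, h4⟩ := (hcount.dense_compl ℝ).exists_between
    (show 1 - ζ < 2 * ζ by linarith)
  have hirr : Irrational ζ := Liouville.irrational hζ
  have hn : GridNondegenerate (0, 0, ζ, r) := by
    rintro ⟨e, m, n⟩ he h0 h
    simp only [gridY] at he h
    rcases he with rfl | rfl
    · by_cases hm : m = 0
      · subst hm
        simp at h
        exact h0 (by rw [h])
      · refine (irrational_iff_ne_rational ζ).1 hirr n m hm ?_
        have : (m : ℝ) ≠ 0 := by exact_mod_cast hm
        field_simp
        push_cast at h
        linarith
    · exact hr ⟨(m, n), by push_cast at h ⊢; linarith⟩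
  have hbox : ((0, 0, ζ, r) : GridState) ∈ gridBox :=
    ⟨⟨le_rfl, le_rfl, by linarith, by simp only; linarith⟩,
      ⟨zero_le_one, zero_le_two, by simp only; linarith, by simp only; linarith⟩⟩
  refine ⟨ζ, r, by linarith, h2, h3, h4, ⟨fun ε hε => ⟨0, fun p _ _ => ?_⟩, fun ε hε J => ?_⟩, hn⟩
  · linarith [gridNorm_nonneg hbox p]
  · obtain ⟨δ, hδ, H⟩ := hn.exists_le_abs_gridY hbox J
    obtain ⟨N, hN⟩ := exists_pow_lt_of_lt_one (lt_min hδ hε) (by norm_num : (1 / 2 : ℝ) < 1)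
    obtain ⟨a, b, hb, -, hab⟩ := hζ (N + 2)
    have hb' : (2 : ℝ) ≤ b := by exact_mod_cast hb
    have hbpos : (0 : ℝ) < b := by linarith
    have hp0 : ((0, b, a) : ℤ × ℤ × ℤ) ≠ (0, 0, 0) := by
      simp only [ne_eq, Prod.mk.injEq, not_and]; intro _ h; omega
    have hY : |gridY (0, 0, ζ, r) (0, b, a)| = b * |ζ - a / b| := by
      have e : gridY (0, 0, ζ, r) (0, b, a) = -(b * (ζ - a / b)) := by
        rw [mul_sub, mul_div_cancel₀ _ hbpos.ne']
        simp only [gridY]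
        push_cast; ring
      rw [e, abs_neg, abs_mul, abs_of_pos hbpos]
    have hX : gridX (0, 0, ζ, r) (0, b, a) = b := by simp [gridX]
    have hprod : (b : ℝ) * (b * |ζ - a / b|) < min δ ε := by
      refine lt_of_lt_of_le ?_ hN.le
      calc (b : ℝ) * (b * |ζ - a / b|) < b * (b * (1 / b ^ (N + 2))) := by gcongr
        _ = (1 / b) ^ N := by rw [pow_add, one_div_pow]; field_simp
        _ ≤ (1 / 2) ^ N := by gcongr
    refine ⟨(0, b, a), Or.inl rfl, ?_, ?_⟩
    · by_contra! hlt
      have h5 := H _ (Or.inl rfl) hp0 hlt.le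
      rw [hY] at h5
      have h6 : (b : ℝ) * |ζ - a / b| ≤ b * (b * |ζ - a / b|) :=
        le_mul_of_one_le_left (by positivity) (by linarith)
      linarith [min_le_left δ ε]
    · rw [gridNorm, hX, abs_mul, hY, abs_of_pos hbpos]
      simp only [zero_mul, add_zero, div_one, zero_add]
      exact hprod.trans_le (min_le_right _ _)

/-- The parameters are recovered as α = 1 - ζ/r, β = 1/r - 1. The inequalities r < 2ζ, 1 - ζ < r and
ζ < 1/2 become α < 1/2, α + β < 1 and 2α + β > 1. -/
lemma inv_mem_of_start {ζ r c : ℝ} (h2 : ζ < 1 / 2) (h3 : 1 - ζ < r) (h4 : r < 2 * ζ)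
    (hc : 0 ≤ c) (h : IsGridLiminf (0, 0, ζ, r) c) (hn : GridNondegenerate (0, 0, ζ, r)) :
    (ENNReal.ofReal c)⁻¹ ∈ ietUpperBLSpectrum normalizedIdocParams := by
  have hr : 0 < r := by linarith
  have hα : 0 < 1 - ζ / r := by rw [sub_pos, div_lt_one hr]; linarith
  have hα' : 1 - ζ / r < 1 / 2 := by
    have : 1 / 2 < ζ / r := by rw [lt_div_iff₀ hr]; linarith
    linarith
  have hβ : 0 < 1 / r - 1 := by rw [sub_pos, lt_div_iff₀ hr]; linarith
  have hαβ : 1 - ζ / r + (1 / r - 1) < 1 := by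
    have : 1 - ζ / r + (1 / r - 1) = (1 - ζ) / r := by ring
    rw [this, div_lt_one hr]; exact h3
  have h2αβ : 1 < 2 * (1 - ζ / r) + (1 / r - 1) := by
    have : 2 * (1 - ζ / r) + (1 / r - 1) = 1 + (1 - 2 * ζ) / r := by field_simp; ring
    rw [this]
    have : 0 < (1 - 2 * ζ) / r := div_pos (by linarith) hr
    linarith
  have hs : ietState (1 - ζ / r) (1 / r - 1) = (0, 0, ζ, r) := by
    have e1 : (1 - (1 - ζ / r)) / (1 + (1 / r - 1)) = ζ := by field_simp; ring
    have e2 : 1 / (1 + (1 / r - 1)) = r := by field_simp; ring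
    rw [ietState, e1, e2]
  rw [← hs] at h hn
  obtain ⟨μ, hμ⟩ := exists_invariantProbability hα hβ hαβ
  exact ⟨_, ⟨(1 - ζ / r, 1 / r - 1), ⟨⟨hα, hβ, hαβ, (idoc_iff hβ).2 hn⟩, hα', h2αβ⟩, rfl⟩, μ, hμ,
    (upperBL_eq hα hβ hαβ hμ hn hc h).symm⟩

lemma exists_of_mem_ietUpperBLSpectrum {b : ℝ≥0∞} (h : b ∈ ietUpperBLSpectrum idocParams) :
    ∃ c ∈ insert 0 gridSpectrum, (ENNReal.ofReal c)⁻¹ = b := by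
  obtain ⟨_, ⟨⟨α, β⟩, ⟨hα, hβ, hαβ, hidoc⟩, rfl⟩, μ, hμ, rfl⟩ := h
  simp only at hα hβ hαβ hidoc hμ ⊢
  have hn := (idoc_iff hβ).1 hidoc
  obtain ⟨c, hc, -, hlim⟩ := exists_isGridLiminf_ietState hα hβ hαβ hn
  refine ⟨c, ?_, (upperBL_eq hα hβ hαβ hμ hn hc hlim).symm⟩
  rcases hc.eq_or_lt with rfl | hc
  · exact Or.inl rfl
  · have hl : 0 < 1 + β := by linarith
    have h1 : 0 < (1 - α) / (1 + β) := div_pos (by linarith) hl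
    have h2 : (1 - α) / (1 + β) < 1 := by rw [div_lt_one hl]; linarith
    have h3 : 0 < 1 / (1 + β) := by positivity
    have h4 : 1 / (1 + β) ≤ 1 := by rw [div_le_one hl]; linarith
    exact Or.inr (mem_gridSpectrum_of_start (irrational_of_nondegenerate hn) h1 h2 (by linarith)
      h4 hc hlim hn)

/-- The general family gives only values 1/c with c in the grid spectrum or c = 0, and the
normalized family already gives all of these. -/
theorem ietUpperBLSpectrum_eq {P : Set (ℝ × ℝ)} (hP : P = idocParams ∨ P = normalizedIdocParams) :
    ietUpperBLSpectrum P = (fun c => (ENNReal.ofReal c)⁻¹) '' insert 0 gridSpectrum := by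
  have mono : ∀ {P Q : Set (ℝ × ℝ)}, P ⊆ Q → ietUpperBLSpectrum P ⊆ ietUpperBLSpectrum Q := by
    rintro P Q hPQ b ⟨L, ⟨a, ha, e⟩, h⟩
    exact ⟨L, ⟨a, hPQ ha, e⟩, h⟩
  have hsub : normalizedIdocParams ⊆ idocParams := fun a ha => ha.1
  have h1 : normalizedIdocParams ⊆ P := by rcases hP with rfl | rfl; exacts [hsub, le_rfl]
  have h2 : P ⊆ idocParams := by rcases hP with rfl | rfl; exacts [le_rfl, hsub]
  refine Set.Subset.antisymm (fun b hb => exists_of_mem_ietUpperBLSpectrum (mono h2 hb)) ?_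
  rintro _ ⟨c, h, rfl⟩
  refine mono h1 ?_
  rcases h with rfl | h
  · obtain ⟨ζ, r, -, i2, i3, i4, i5, i6⟩ := exists_start_zero
    exact inv_mem_of_start i2 i3 i4 le_rfl i5 i6
  · obtain ⟨ζ, r, -, i2, i3, i4, i5, i6⟩ := exists_start_of_mem_gridSpectrum h
    exact inv_mem_of_start i2 i3 i4 h.1.le i5 i6

theorem theorem4 :
    -- each system has exactly one invariant probability measure, so that its `𝓑` is well defined
    (∀ a ∈ idocParams, ∃! μ : Measure (ℕ → Fin 3),
      IsInvariantProbability (ietLanguage a.1 a.2) μ) ∧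
    -- the spectrum of all i.d.o.c. three-interval exchanges, and that of the normalized ones
    (∀ P ∈ ({idocParams, normalizedIdocParams} : Set (Set (ℝ × ℝ))),
      IsLeast (ietUpperBLSpectrum P) (ENNReal.ofReal (2 * √5)) ∧
      (∀ b ∈ ietUpperBLSpectrum P,
        b < ENNReal.ofReal ((12 + 29 * √3) / 13) → b = ENNReal.ofReal (2 * √5)) ∧
      IsClosed (ietUpperBLSpectrum P) ∧
      6 ∈ ietUpperBLSpectrum P ∧
      AccPt (6 : ℝ≥0∞) (𝓟 (ietUpperBLSpectrum P))) := by
  have hf : Continuous fun c : ℝ => (ENNReal.ofReal c)⁻¹ :=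
    ENNReal.continuous_ofReal.inv
  have hf5 : (ENNReal.ofReal (1 / (2 * √5)))⁻¹ = ENNReal.ofReal (2 * √5) := by
    rw [← ENNReal.ofReal_inv_of_pos (by positivity), one_div, inv_inv]
  have hf6 : (ENNReal.ofReal (1 / 6))⁻¹ = 6 := by
    rw [← ENNReal.ofReal_inv_of_pos (by positivity), one_div, inv_inv]
    simp
  refine ⟨?_, fun P hP => ?_⟩
  · rintro ⟨α, β⟩ ⟨hα, hβ, hαβ, hidoc⟩
    obtain ⟨μ, hμ⟩ := exists_invariantProbability hα hβ hαβ
    exact ⟨μ, hμ, fun ν hν => invariantProbability_unique hα hβ hαβ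
      (irrational_of_nondegenerate ((idoc_iff hβ).1 hidoc)) hν hμ⟩
  rw [ietUpperBLSpectrum_eq (by simpa using hP)]
  refine ⟨⟨⟨_, Or.inr inv_two_mul_sqrt_five_mem_gridSpectrum, hf5⟩, ?_⟩, ?_,
    (isCompact_gridSpectrum.image hf).isClosed, ⟨_, Or.inr one_sixth_mem_gridSpectrum, hf6⟩, ?_⟩
  · rintro _ ⟨c, hc, rfl⟩
    rw [← hf5]
    refine ENNReal.inv_le_inv.2 (ENNReal.ofReal_le_ofReal ?_)
    rcases hc with rfl | hc
    · positivity
    · exact le_of_mem_gridSpectrum hc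
  · rintro _ ⟨c, hc, rfl⟩ hlt
    rcases hc with rfl | hc
    · simp at hlt
    · simp only at hlt ⊢
      rw [← ENNReal.ofReal_inv_of_pos hc.1, ENNReal.ofReal_lt_ofReal_iff (by positivity)] at hlt
      -- This makes (12 + 29√3)/13 = 4.78688… smaller than 4.787, the threshold of the search.
      have h3 : √3 < 1.73206 := by rw [Real.sqrt_lt' (by norm_num)]; norm_num
      have h4 : c⁻¹ < 4787 / 1000 := hlt.trans (by linarith)
      rw [eq_of_mem_gridSpectrum_of_lt hc (by rw [inv_lt_comm₀ hc.1 (by norm_num)] at h4; linarith),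
        hf5]
  · rw [accPt_iff_nhds]
    intro U hU
    have hU' : (fun c : ℝ => (ENNReal.ofReal c)⁻¹) ⁻¹' U ∈ 𝓝 (1 / 6 : ℝ) :=
      hf.continuousAt.preimage_mem_nhds (by rw [hf6]; exact hU)
    obtain ⟨ε, hε, hball⟩ := Metric.mem_nhds_iff.1 hU'
    obtain ⟨c, hc, h1, h2⟩ := exists_mem_gridSpectrum_near_one_sixth (half_pos hε)
    refine ⟨_, ⟨hball (a := c) ?_, c, Or.inr hc, rfl⟩, ?_⟩
    · rw [Metric.mem_ball, Real.dist_eq, abs_lt]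
      constructor <;> linarith
    · simp only
      rw [← hf6, ne_eq, inv_inj]
      exact ((ENNReal.ofReal_lt_ofReal_iff (by norm_num)).2 h2).ne
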